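/- **Setting.** Let $N\ge 2$, $q=e^{i\pi\zeta}$, $p=e^{2i\pi\tau}$ with $\mathrm{Im}\,\zeta,\mathrm{Im}\,\tau>0$. Put $q^s=e^{i\pi\zeta s}$, $\ln q=i\pi\zeta$, and write $z=e^{i\pi\xi}$, $w=e^{i\pi\eta}$ for spectral parameters ($\xi,\eta\in\mathbb C$; functions of $z$ that are multivalued are functions of $\xi$). Assume $q^2\notin p^{\mathbb Z}$ and $q^2\notin (pq^{2N})^{\mathbb Z}$, so that the $R$-matrices below exist. Let $(z;a,b)_\infty=\prod_{m,n\ge0}(1-za^mb^n)$, $\Theta_a(z)=\prod_{n\ge 0}(1-za^n)(1-z^{-1}a^{n+1})(1-a^{n+1})$, $$\vartheta\big[{\textstyle{\gamma_1\atop\gamma_2}}\big](\xi,\tau)=\sum_{m\in\mathbb Z}e^{i\pi(m+\gamma_1)^2\tau+2i\pi(m+\gamma_1)(\xi+\gamma_2)},\qquad \tau_N(z)=z^{\frac2N-2}\,\frac{\Theta_{q^{2N}}(qz^2)}{\Theta_{q^{2N}}(qz^{-2})}.$$ With $\omega=e^{2i\pi/N}$, $g_{ij}=\omega^i\delta_{ij}$,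 $h_{ij}=\delta_{i+1,j}$ (indices $1,\dots,N$ modulo $N$), let $R_{12}(z)=R_{12}(z,q,p)$ be the gauge-transformed $\mathbb Z_N$-vertex elliptic $R$-matrix on $\mathbb C^N\otimes\mathbb C^N$, $$R_{12}(z)=(g^{\frac12}\otimes g^{\frac12})\Big[\frac{z^{\frac2N-2}}{\kappa(z^2)}\,\frac{\vartheta[\frac12,\frac12](\zeta,\tau)}{\vartheta[\frac12,\frac12](\xi+\zeta,\tau)}\sum_{\alpha\in\mathbb Z_N^2}\frac{\vartheta[\frac12+\frac{\alpha_1}N,\frac12+\frac{\alpha_2}N](\xi+\frac\zeta N,\tau)}{N\,\vartheta[\frac12+\frac{\alpha_1}N,\frac12+\frac{\alpha_2}N](\frac\zeta N,\tau)}\;I_\alpha\otimes I_\alpha^{-1}\Big](g^{-\frac12}\otimes g^{-\frac12}),$$ where $I_\alpha=g^{\alpha_2}h^{\alpha_1}$ and, with $(u)_\infty=(u;p,q^{2N})_\infty$, $$\frac1{\kappa(z^2)}=\frac{(q^{2N}z^{-2})_\infty(q^2z^2)_\infty(pz^{-2})_\infty(pq^{2N-2}z^2)_\infty}{(q^{2N}z^2)_\infty(q^2z^{-2})_\infty(pz^2)_\infty(pq^{2N-2}z^{-2})_\infty}.$$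 Put $\widehat R_{12}(z)=\tau_N(q^{\frac12}z^{-1})R_{12}(z)$ and $\widehat R^*_{12}(z)=\widehat R_{12}(z,q,pq^{-2c})$. The algebra $\mathcal A_{q,p}(\widehat{gl}(N)_c)$ is the unital $\mathbb C$-algebra generated by the entries of $N\times N$ matrices $L(z)$ and of their inverses, with relations $$\widehat R_{12}(z/w)L_1(z)L_2(w)=L_2(w)L_1(z)\widehat R^*_{12}(z/w)$$ for generic $z/w$; $\mathcal A_{q,p}(\widehat{sl}(N)_c)$ is its quotient by $\sum_{\sigma\in\mathfrak S_N}\varepsilon(\sigma)\prod_{i=1}^N L_{i,\sigma(i)}(zq^{i-N-1})=q^{c/2}$. Here "generic" means $(z/w)^2\notin p^{\mathbb Z}q^{2\mathbb Z}q^{2c\mathbb Z}$; in particular, at $c=-N$, $(z/w)^2\notin p^{\mathbb Z}q^{2\mathbb Z}$. Put $L^+(z)=L(q^{\frac c2}z)$, $L^-(z)=G\,L(-p^{\frac12}z)\,G^{-1}$ with $G=g^{\frac12}hg^{\frac12}$ and with $-p^{\frac12}z=e^{i\pi(\xi+\tau+1)}$, and $$\mathcal L(z)=L^+(q^{\frac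 c2}z)L^-(z)^{-1},\qquad t(z)=\mathrm{Tr}\,\mathcal L(z).$$ The exchange matrix of the $t(z)$ at level $c$, for which $t(z)t(w)=\mathrm{Tr}_{12}\big(\mathcal Y(w/z)\,\mathcal L_2(w)\mathcal L_1(z)\big)$, is $\mathcal Y(x)=T(x)\mathcal M(x)$ with ($t_2$ denoting transposition in the second factor) $$T(x)=\frac{\tau_N(q^{\frac12}x^{-1})\,\tau_N(q^{\frac12-c}x)}{\tau_N(q^{\frac12}x)\,\tau_N(q^{\frac12-c}x^{-1})},\qquad \mathcal M(x)=\Big(\big(R_{21}(x)R_{21}(q^{c+N}x)^{-1}R_{12}(x^{-1})^{-1}\big)^{t_2}R_{12}(q^cx^{-1})^{t_2}\Big)^{t_2}.$$ The natural Poisson bracket at the critical level is defined on the $t(z)$ by $$\{t(z),t(w)\}=\mathrm{Tr}_{12}\Big(\tfrac{d\mathcal Y}{dc}(w/z)\,\mathcal L_2(w)\,\mathcal L_1(z)\Big)\Big|_{c=-N}.$$ **Theorem.** Let $c=-N$, and let $x=w/z$ be generic. In $\mathcal A_{q,p}(\widehat{sl}(N)_{c})$, and already in $\mathcal A_{q,p}(\widehat{gl}(N)_{c})$,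 $t(z)$ commutes with all $L_{ij}(w)$ and with $t(w)$, and the $t(z)$ form a closed algebra under the (antisymmetric) bracket: $$\{t(z),t(w)\}=-\ln q\Big(x\frac{d}{dx}\ln\tau_N(q^{\frac12}x)-x^{-1}\frac{d}{dx^{-1}}\ln\tau_N(q^{\frac12}x^{-1})\Big)\,t(z)\,t(w).$$ More precisely, $\mathcal Y(x)$ is differentiable in $c$ at $c=-N$, and $\frac{d\mathcal Y}{dc}(x)\big|_{c=-N}$ is the scalar $-\ln q(\cdots)$ displayed here times $\mathbb I\otimes\mathbb I$. For every $x$ with $x^2\notin q^{2N\mathbb Z}\cup q^{2N\mathbb Z+2}\cup q^{2N\mathbb Z-2}$ this scalar equals $$f(x)=-2\ln q\Big[\sum_{\ell\ge0}\Big(\frac{2x^2q^{2N\ell}}{1-x^2q^{2N\ell}}-\frac{x^2q^{2N\ell+2}}{1-x^2q^{2N\ell+2}}-\frac{x^2q^{2N\ell-2}}{1-x^2q^{2N\ell-2}}\Big)-\frac{x^2}{1-x^2}+\frac12\frac{x^2q^2}{1-x^2q^2}+\frac12\frac{x^2q^{-2}}{1-x^2q^{-2}}-(x\leftrightarrow x^{-1})\Big],$$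 the series being convergent. -/

import Mathlib

/-
Conventions. All parameters are written additively:
  `z = e^{iπξ}`, `w = e^{iπη}`, `x = w/z = e^{iπχ}` with `χ = η - ξ`,
  `q = e^{iπζ}`, `p = e^{2iπτ}`.
This fixes every power `q^s = e^{iπζs}`, `z^s = e^{iπξs}`, and `ln q = iπζ`, so that
`y d/dy = (iπ)⁻¹ d/ds` in the coordinate `y = e^{iπs}`. In particular `q^s z` corresponds to
`ξ + sζ`, and `-p^{1/2} z` to `ξ + τ + 1`.
An index `i : Fin N` stands for the index `i + 1` in `{1, …, N}`, read in `ℤ/Nℤ`.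
-/

namespace EllipticW

noncomputable section

/-- `e^{iπs}`. -/
def ex (s : ℂ) : ℂ := Complex.exp (Complex.I * (Real.pi : ℂ) * s)

/-! ### Theta functions -/

/-- `ϑ[γ₁, γ₂](ξ, τ) = ∑_{m ∈ ℤ} exp(iπ(m+γ₁)²τ + 2iπ(m+γ₁)(ξ+γ₂))`. -/
def thetaChar (γ₁ γ₂ ξ τ : ℂ) : ℂ :=
  ∑' m : ℤ, Complex.exp (Complex.I * (Real.pi : ℂ) * ((m : ℂ) + γ₁) ^ 2 * τ
    + 2 * Complex.I * (Real.pi : ℂ) * ((m : ℂ) + γ₁) * (ξ + γ₂))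

/-- `(z; a)_∞`. -/
def poch (z a : ℂ) : ℂ := ∏' n : ℕ, (1 - z * a ^ n)

/-- `(z; a, b)_∞`. -/
def poch₂ (z a b : ℂ) : ℂ := ∏' n : ℕ × ℕ, (1 - z * a ^ n.1 * b ^ n.2)

/-- `Θ_a(z) = (z; a)_∞ (a z⁻¹; a)_∞ (a; a)_∞`. -/
def bigTheta (a z : ℂ) : ℂ := poch z a * poch (a * z⁻¹) a * poch a a

/-- `τ_N(z) = z^{2/N-2} Θ_{q^{2N}}(q z²) / Θ_{q^{2N}}(q z⁻²)` at `z = e^{iπs}`. -/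
def tauN (N : ℕ) (ζ s : ℂ) : ℂ :=
  ex ((2 / (N : ℂ) - 2) * s) *
    bigTheta (ex ζ ^ (2 * N)) (ex ζ * ex s ^ 2) /
    bigTheta (ex ζ ^ (2 * N)) (ex ζ * (ex s ^ 2)⁻¹)

/-! ### The elliptic `R`-matrix -/

/-- The normalization factor `1/κ(z²)` at `z = e^{iπξ}`. -/
def invKappa (N : ℕ) (ζ τ ξ : ℂ) : ℂ :=
  let q := ex ζ
  let p := ex (2 * τ)
  let Q := q ^ (2 * N)
  let y := ex ξ ^ 2
  (poch₂ (Q * y⁻¹) p Q * poch₂ (q ^ 2 * y) p Q * poch₂ (p * y⁻¹) p Q *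
      poch₂ (p * q ^ (2 * N - 2) * y) p Q) /
    (poch₂ (Q * y) p Q * poch₂ (q ^ 2 * y⁻¹) p Q * poch₂ (p * y) p Q *
      poch₂ (p * q ^ (2 * N - 2) * y⁻¹) p Q)

/-- `g = diag(ω^i)`, `ω = e^{2iπ/N}`. -/
def gMat (N : ℕ) : Matrix (Fin N) (Fin N) ℂ :=
  Matrix.diagonal fun i => ex (2 * ((i : ℂ) + 1) / N)

/-- `g^{1/2} = diag(ω^{i/2})`. -/
def gHalf (N : ℕ) : Matrix (Fin N) (Fin N) ℂ :=
  Matrix.diagonal fun i => ex (((i : ℂ) + 1) / N)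

/-- `h_{ij} = δ_{i+1,j}`, indices modulo `N`. -/
def hMat (N : ℕ) : Matrix (Fin N) (Fin N) ℂ :=
  Matrix.of fun i j => if (j : ℕ) = ((i : ℕ) + 1) % N then 1 else 0

/-- `I_α = g^{α₂} h^{α₁}`. -/
def Imat (N : ℕ) (α : Fin N × Fin N) : Matrix (Fin N) (Fin N) ℂ :=
  gMat N ^ (α.2 : ℕ) * hMat N ^ (α.1 : ℕ)

/-- `W_α(ξ, ζ, τ)`. -/
def Wfun (N : ℕ) (α : Fin N × Fin N) (ξ ζ τ : ℂ) : ℂ :=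
  thetaChar (1 / 2 + (α.1 : ℂ) / N) (1 / 2 + (α.2 : ℂ) / N) (ξ + ζ / N) τ /
    ((N : ℂ) * thetaChar (1 / 2 + (α.1 : ℂ) / N) (1 / 2 + (α.2 : ℂ) / N) (ζ / N) τ)

/-- Elements of `End(ℂ^N) ⊗ End(ℂ^N)`, or of this space with coefficients in `A`. -/
abbrev Mat₂ (N : ℕ) (A : Type*) := Matrix (Fin N × Fin N) (Fin N × Fin N) A

/-- The tensor product of two matrices. -/
def tens {N : ℕ} {A : Type*} [Mul A] (X Y : Matrix (Fin N) (Fin N) A) : Mat₂ N A :=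
  Matrix.kroneckerMap (· * ·) X Y

/-- The `ℤ_N`-vertex model `R`-matrix before the gauge transformation. -/
def Rtilde (N : ℕ) (ζ τ ξ : ℂ) : Mat₂ N ℂ :=
  (ex ((2 / (N : ℂ) - 2) * ξ) * invKappa N ζ τ ξ *
      (thetaChar (1 / 2) (1 / 2) ζ τ / thetaChar (1 / 2) (1 / 2) (ξ + ζ) τ)) •
    ∑ α : Fin N × Fin N, Wfun N α ξ ζ τ • tens (Imat N α) (Imat N α)⁻¹

/-- `R₁₂(z, q, p) = (g^{1/2} ⊗ g^{1/2}) R̃(z, q, p) (g^{-1/2} ⊗ g^{-1/2})`, `z = e^{iπξ}`. -/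
def R (N : ℕ) (ζ τ ξ : ℂ) : Mat₂ N ℂ :=
  tens (gHalf N) (gHalf N) * Rtilde N ζ τ ξ * tens (gHalf N)⁻¹ (gHalf N)⁻¹

/-- `R̂₁₂(z, q, p) = τ_N(q^{1/2} z⁻¹) R₁₂(z, q, p)`. -/
def Rhat (N : ℕ) (ζ τ ξ : ℂ) : Mat₂ N ℂ := tauN N ζ (ζ / 2 - ξ) • R N ζ τ ξ

/-- Exchange of the two tensor factors, `M₁₂ ↦ M₂₁`. -/
def flip₁₂ {N : ℕ} {A : Type*} (M : Mat₂ N A) : Mat₂ N A :=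
  M.submatrix Prod.swap Prod.swap

/-- Partial transposition in the second tensor factor. -/
def pt₂ {N : ℕ} {A : Type*} (M : Mat₂ N A) : Mat₂ N A :=
  Matrix.of fun a b => M (a.1, b.2) (b.1, a.2)

/-! ### The elliptic quantum algebras -/

/-- The exponents of the values of `z/w` at which the functions entering the exchange relations
at level `c` may have zeros or poles: `ℤ + ℤτ + ℤζ + ℤcζ`, that is, `(z/w)² ∈ p^ℤ q^{2ℤ} q^{2cℤ}`.
Outside it `R̂(z/w)` and `R̂*(z/w)` are holomorphic and invertible. -/
def singular (ζ τ c : ℂ) : Set ℂ :=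
  {s | ∃ k l m n : ℤ, s = k + l * τ + m * ζ + n * (c * ζ)}

/-- `G = g^{1/2} h g^{1/2}`. -/
def Gmat (N : ℕ) : Matrix (Fin N) (Fin N) ℂ := gHalf N * hMat N * gHalf N

section LOperators

variable {N : ℕ} {A : Type*} [Ring A] [Algebra ℂ A]

/-- `X₁ = X ⊗ 𝟙`. -/
def inFst (X : Matrix (Fin N) (Fin N) A) : Mat₂ N A := tens X 1

/-- `X₂ = 𝟙 ⊗ X`. -/
def inSnd (X : Matrix (Fin N) (Fin N) A) : Mat₂ N A := tens 1 X

/-- A matrix of numbers viewed as a matrix over `A`. -/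
def scal {n : Type*} (X : Matrix n n ℂ) : Matrix n n A := X.map (algebraMap ℂ A)

/-- `q-det L(z) = ∑_σ ε(σ) ∏_{i=1}^N L_{i,σ(i)}(z q^{i-N-1})`, the product being ordered. -/
def qdet (ζ : ℂ) (L : ℂ → Matrix (Fin N) (Fin N) A) (ξ : ℂ) : A :=
  ∑ σ : Equiv.Perm (Fin N), ((Equiv.Perm.sign σ : ℤ) : A) *
    (List.ofFn fun i : Fin N => L (ξ + ((i : ℂ) - N) * ζ) i (σ i)).prod

/-- `L⁺(z) = L(q^{c/2} z)`. -/
def Lplus (ζ c : ℂ) (L : ℂ → Matrix (Fin N) (Fin N) A) (ξ : ℂ) : Matrix (Fin N) (Fin N) A :=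
  L (ξ + c / 2 * ζ)

/-- `L⁻(z) = G L(-p^{1/2} z) G⁻¹`. -/
def Lminus (τ : ℂ) (L : ℂ → Matrix (Fin N) (Fin N) A) (ξ : ℂ) : Matrix (Fin N) (Fin N) A :=
  scal (Gmat N) * L (ξ + τ + 1) * scal (Gmat N)⁻¹

/-- `𝓛(z) = L⁺(q^{c/2} z) L⁻(z)⁻¹`. -/
def calL (ζ τ c : ℂ) (L : ℂ → Matrix (Fin N) (Fin N) A) (ξ : ℂ) : Matrix (Fin N) (Fin N) A :=
  Lplus ζ c L (ξ + c / 2 * ζ) * Ring.inverse (Lminus τ L ξ)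

/-- `t(z) = Tr 𝓛(z)`. -/
def tOp (ζ τ c : ℂ) (L : ℂ → Matrix (Fin N) (Fin N) A) (ξ : ℂ) : A :=
  Matrix.trace (calL ζ τ c L ξ)

end LOperators

/-- Generators: the entries of `L(z)` and of `L(z)⁻¹`, `z = e^{iπξ}`. -/
inductive Gen (N : ℕ) : Type
  | L (ξ : ℂ) (i j : Fin N)
  | Linv (ξ : ℂ) (i j : Fin N)

/-- Which of the two algebras, `gl(N)` or `sl(N)`, is considered. -/
inductive Kind : Type
  | gl
  | sl

/-- `L(z)` over the free algebra. -/
def freeL (N : ℕ) (ξ : ℂ) : Matrix (Fin N) (Fin N) (FreeAlgebra ℂ (Gen N)) :=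
  Matrix.of fun i j => FreeAlgebra.ι ℂ (Gen.L ξ i j)

/-- `L(z)⁻¹` over the free algebra. -/
def freeLinv (N : ℕ) (ξ : ℂ) : Matrix (Fin N) (Fin N) (FreeAlgebra ℂ (Gen N)) :=
  Matrix.of fun i j => FreeAlgebra.ι ℂ (Gen.Linv ξ i j)

/-- The defining relations: `R̂₁₂(z/w) L₁(z) L₂(w) = L₂(w) L₁(z) R̂*₁₂(z/w)` with
`R̂* = R̂(·, q, p* = p q^{-2c})`, the invertibility of `L(z)`, and, for `sl(N)`,
`q-det L(z) = q^{c/2}`. -/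
inductive Rel (k : Kind) (N : ℕ) (ζ τ c : ℂ) :
    FreeAlgebra ℂ (Gen N) → FreeAlgebra ℂ (Gen N) → Prop
  | exchange (ξ η : ℂ) (hreg : ξ - η ∉ singular ζ τ c) (a b : Fin N × Fin N) :
      Rel k N ζ τ c
        ((scal (Rhat N ζ τ (ξ - η)) * inFst (freeL N ξ) * inSnd (freeL N η) :
          Mat₂ N (FreeAlgebra ℂ (Gen N))) a b)
        ((inSnd (freeL N η) * inFst (freeL N ξ) * scal (Rhat N ζ (τ - c * ζ) (ξ - η)) :
          Mat₂ N (FreeAlgebra ℂ (Gen N))) a b)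
  | mul_inv (ξ : ℂ) (i j : Fin N) :
      Rel k N ζ τ c ((freeL N ξ * freeLinv N ξ) i j) (if i = j then 1 else 0)
  | inv_mul (ξ : ℂ) (i j : Fin N) :
      Rel k N ζ τ c ((freeLinv N ξ * freeL N ξ) i j) (if i = j then 1 else 0)
  | qdet_eq (hk : k = Kind.sl) (ξ : ℂ) :
      Rel k N ζ τ c (qdet ζ (freeL N) ξ) (algebraMap ℂ _ (ex (c / 2 * ζ)))

/-- The elliptic quantum algebra `𝒜_{q,p}(ĝl(N)_c)` or `𝒜_{q,p}(ŝl(N)_c)`. -/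
abbrev EllipticAlgebra (k : Kind) (N : ℕ) (ζ τ c : ℂ) : Type :=
  RingQuot (Rel k N ζ τ c)

/-- The generating matrix `L(z)`, `z = e^{iπξ}`, of the elliptic quantum algebra. -/
def Lop (k : Kind) (N : ℕ) (ζ τ c ξ : ℂ) :
    Matrix (Fin N) (Fin N) (EllipticAlgebra k N ζ τ c) :=
  (freeL N ξ).map (RingQuot.mkAlgHom ℂ (Rel k N ζ τ c))

/-! ### The exchange matrix and the Poisson bracket -/

/-- `T(x)` at `x = e^{iπχ}`. -/
def Tfun (N : ℕ) (ζ c χ : ℂ) : ℂ :=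
  (tauN N ζ (ζ / 2 - χ) * tauN N ζ ((1 / 2 - c) * ζ + χ)) /
    (tauN N ζ (ζ / 2 + χ) * tauN N ζ ((1 / 2 - c) * ζ - χ))

/-- `𝓜(x) = ((R₂₁(x) R₂₁(q^{c+N} x)⁻¹ R₁₂(x⁻¹)⁻¹)^{t₂} R₁₂(q^c x⁻¹)^{t₂})^{t₂}`. -/
def Mcal (N : ℕ) (ζ τ c χ : ℂ) : Mat₂ N ℂ :=
  pt₂ (pt₂ (flip₁₂ (R N ζ τ χ) * (flip₁₂ (R N ζ τ (χ + (c + N) * ζ)))⁻¹ * (R N ζ τ (-χ))⁻¹) *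
    pt₂ (R N ζ τ (-χ + c * ζ)))

/-- The exchange matrix `𝒴(x) = T(x) 𝓜(x)` at level `c`, for which
`t(z) t(w) = Tr₁₂ (𝒴(w/z) 𝓛₂(w) 𝓛₁(z))`. -/
def Ycal (N : ℕ) (ζ τ c χ : ℂ) : Mat₂ N ℂ := Tfun N ζ c χ • Mcal N ζ τ c χ

/-- The bracket `{t(z), t(w)} = Tr₁₂ (d𝒴/dc (w/z) 𝓛₂(w) 𝓛₁(z))` at `c = -N`. -/
def tBracket {N : ℕ} {A : Type*} [Ring A] [Algebra ℂ A] (ζ τ : ℂ)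
    (L : ℂ → Matrix (Fin N) (Fin N) A) (ξ η : ℂ) : A :=
  ∑ i₁ : Fin N, ∑ i₂ : Fin N, ∑ j₁ : Fin N, ∑ j₂ : Fin N,
    deriv (fun c : ℂ => Ycal N ζ τ c (η - ξ) (i₁, i₂) (j₁, j₂)) (-(N : ℂ)) •
      (calL ζ τ (-(N : ℂ)) L η j₂ i₂ * calL ζ τ (-(N : ℂ)) L ξ j₁ i₁)

/-- `y d/dy ln τ_N(q^{1/2} y)` at `y = e^{iπs}`. -/
def eulerLogTau (N : ℕ) (ζ s : ℂ) : ℂ :=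
  logDeriv (fun u : ℂ => tauN N ζ (ζ / 2 + u)) s / (Complex.I * (Real.pi : ℂ))

/-- `-ln q (x d/dx ln τ_N(q^{1/2} x) - x⁻¹ d/dx⁻¹ ln τ_N(q^{1/2} x⁻¹))` at `x = e^{iπχ}`. -/
def structureCoeff (N : ℕ) (ζ χ : ℂ) : ℂ :=
  -(Complex.I * (Real.pi : ℂ) * ζ) * (eulerLogTau N ζ χ - eulerLogTau N ζ (-χ))

/-- The general term of the series in the explicit structure function, with `y = x²`. -/
def fTerm (N : ℕ) (q y : ℂ) (l : ℕ) : ℂ :=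
  2 * (y * q ^ (2 * N * l)) / (1 - y * q ^ (2 * N * l))
    - y * q ^ (2 * N * l + 2) / (1 - y * q ^ (2 * N * l + 2))
    - y * q ^ (2 * (N : ℤ) * l - 2) / (1 - y * q ^ (2 * (N : ℤ) * l - 2))

/-- The half of the explicit structure function that is then antisymmetrized, with `y = x²`. -/
def fHalf (N : ℕ) (q y : ℂ) : ℂ :=
  (∑' l : ℕ, fTerm N q y l) - y / (1 - y)
    + 1 / 2 * (y * q ^ 2 / (1 - y * q ^ 2))
    + 1 / 2 * (y * q ^ (-2 : ℤ) / (1 - y * q ^ (-2 : ℤ)))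

/-- The explicit structure function `f(x)`, at `x = e^{iπχ}`. -/
def fStruct (N : ℕ) (ζ χ : ℂ) : ℂ :=
  -2 * (Complex.I * (Real.pi : ℂ) * ζ) *
    (fHalf N (ex ζ) (ex χ ^ 2) - fHalf N (ex ζ) (ex χ ^ 2)⁻¹)

end

end EllipticW

/-!
# The centre and the Poisson bracket of the elliptic quantum algebra at the critical level

All multiplicative parameters are powers of `e^{iπ}`: `z = e^{iπξ}`, `q = e^{iπζ}`, `p = e^{2iπτ}`.

**The `R`-matrix.** Up to a scalar and conjugation by a diagonal matrix, `R(z)` is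
`∑_β φ_β(ξ) I_β ⊗ I_β⁻¹`, where `φ_β(ξ) = ϑ_β(ξ + ζ/N) / ϑ_β(ζ/N)` and `ϑ_β` runs through the theta
functions whose characteristics are the `N`-torsion points. Since the flip of `I_β ⊗ I_β⁻¹` is its
inverse, the product `R₁₂(z) R₂₁(z⁻¹)` is computed by a convolution of the `φ_β` twisted by roots of
unity, and the crossed product `R₁₂(z)^{t₂} R₂₁(q^{-N} z⁻¹)^{t₂}` by an untwisted one. Both
convolutions vanish off the diagonal and are products of odd theta functions on it
(`unitSum_eq_zero`, `sum_phi_mul_phi_neg`, `crossSum_eq_zero`, `crossSum_zero_zero`). Each of these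
identities compares two theta functions with the same zeros and quasi-periods up to characters of
absolute value one, so Liouville's theorem (`exists_eq_const_mul`) leaves a constant to determine.
The factor `1/κ` is what normalizes the diagonal terms to `1`. This gives unitarity (`R_mul_flip`)
and crossing unitarity (`pt₂_R_mul`). The quasi-periods of the `φ_β` give
`(G ⊗ 𝟙) R̂(-p^{1/2} z) = τ_N(q^{1/2} z)⁻¹ R(z) (G ⊗ 𝟙)` (`Gmat_mul_Rhat`), in which the scalar does
not depend on `p`.

**The centre.** Let `c = -N`. The two factors of `𝓛(z) = L(q^{-N} z) (G L(-p^{1/2} z) G⁻¹)⁻¹` have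
exchange relations with `L(w)`. By quasi-periodicity their right-hand sides contain the same
matrix `R*(q^{-N} z/w)`, which cancels in
`L₂(w) 𝓛₁(z) = R(q^{-N} z/w) 𝓛₁(z) R(z/w)⁻¹ L₂(w)` (`inSnd_mul_inFst_mul`). By crossing
unitarity the partial transposes of the two remaining `R`-matrices are inverse to each other, which
is what is needed for the trace over the first factor not to see them (`ptr₁_conj`). Hence
`L(w) t(z) = t(z) L(w)` (`commute_tOp_Lop`), and `t(z)` commutes with `t(w)`, which
is built from values of `L`.

**The bracket.** Near `c = -N` the first three factors of `𝓜(x)` are `R₂₁(q^{-c-N} x)` up to second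
order in `c + N`, by unitarity. Crossing unitarity then says that `𝓜(x)` is the identity up to second
order (`Regular.Mcal_deriv`), so that only the scalar `T(x)` contributes to the derivative of
`𝒴(x)`. Because `τ_N` is invariant under `z ↦ q^N z`, this derivative is a difference of logarithmic
derivatives of `τ_N` (`Regular.hasDerivAt_Tfun`). Logarithmic differentiation of the infinite
products in `τ_N` gives the explicit series (`structureCoeff_eq_fStruct`).
-/

open Filter Topology

namespace EllipticW

/-! ### Liouville's theorem for ratios of quasi-periodic entire functions -/

/-- An entire function whose absolute value has the two periods `L` and `Lτ` is constant. -/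
theorem exists_const_of_norm_periodic {τ : ℂ} (hτ : 0 < τ.im) {L : ℝ} (hL : 0 < L) {f : ℂ → ℂ}
    (hf : Differentiable ℂ f) (h1 : ∀ z, ‖f (z + L)‖ = ‖f z‖)
    (h2 : ∀ z, ‖f (z + L * τ)‖ = ‖f z‖) : ∃ C, ∀ z, f z = C := by
  apply hf.exists_const_forall_eq_of_bounded
  have hp1 : Function.Periodic (fun z => ‖f z‖) (L : ℂ) := h1
  have hp2 : Function.Periodic (fun z => ‖f z‖) (L * τ : ℂ) := h2
  have hK : IsCompact ((fun p : ℝ × ℝ => (L * (p.1 + p.2 * τ) : ℂ)) ''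
      (Set.Icc (0 : ℝ) 1 ×ˢ Set.Icc (0 : ℝ) 1)) :=
    (isCompact_Icc.prod isCompact_Icc).image (by fun_prop)
  obtain ⟨M, hM⟩ := (hK.image_of_continuousOn hf.continuous.norm.continuousOn).isBounded.bddAbove
  rw [isBounded_iff_forall_norm_le]
  refine ⟨M, ?_⟩
  rintro _ ⟨z, rfl⟩
  set b : ℝ := z.im / (L * τ.im) with hb
  set a : ℝ := (z.re - b * L * τ.re) / L with ha
  have hz : z = L * (a + b * τ) := by
    apply Complex.ext
    · simp only [Complex.re_ofReal_mul, Complex.add_re, Complex.ofReal_re]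
      rw [ha]; field_simp; ring
    · simp only [Complex.im_ofReal_mul, Complex.add_im, Complex.ofReal_im]
      rw [hb]; field_simp; ring
  have hz' : (L * ((Int.fract a : ℝ) + (Int.fract b : ℝ) * τ) : ℂ)
      = z - ⌊a⌋ • (L : ℂ) - ⌊b⌋ • (L * τ : ℂ) := by
    simp only [Int.fract]
    push_cast
    conv_rhs => rw [hz]
    simp only [zsmul_eq_mul]
    ring
  have : ‖f z‖ = ‖f (L * ((Int.fract a : ℝ) + (Int.fract b : ℝ) * τ))‖ := by
    rw [hz']
    have e2 := hp2.sub_zsmul_eq (x := z - ⌊a⌋ • (L : ℂ)) ⌊b⌋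
    have e1 := hp1.sub_zsmul_eq (x := z) ⌊a⌋
    exact (e2.trans e1).symm
  rw [this]
  apply hM
  refine ⟨_, ⟨(Int.fract a, Int.fract b), ⟨⟨Int.fract_nonneg _, (Int.fract_lt_one _).le⟩,
    ⟨Int.fract_nonneg _, (Int.fract_lt_one _).le⟩⟩, rfl⟩, rfl⟩

/-- Two continuous functions that agree where `B` does not vanish are equal, if `B` has only
simple zeros. -/
theorem eq_of_eq_of_simple_zeros {B F G : ℂ → ℂ} (hB : Differentiable ℂ B)
    (hs : ∀ z, B z = 0 → deriv B z ≠ 0) (hF : Continuous F) (hG : Continuous G)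
    (h : ∀ z, B z ≠ 0 → F z = G z) (z : ℂ) : F z = G z := by
  by_cases hz : B z = 0
  · have hev : ∀ᶠ w in 𝓝[≠] z, F w = G w :=
      ((hB z).hasDerivAt.eventually_ne (c := 0) (hs z hz)).mono fun w hw => h w hw
    exact tendsto_nhds_unique_of_eventuallyEq (hF.continuousAt.mono_left nhdsWithin_le_nhds)
      (hG.continuousAt.mono_left nhdsWithin_le_nhds) hev
  · exact h z hz

/-- An entire function is divisible by an entire function with simple zeros as soon as it vanishes
at these zeros. -/
theorem exists_entire_quotient {A B : ℂ → ℂ} (hA : Differentiable ℂ A) (hB : Differentiable ℂ B)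
    (hz : ∀ z, B z = 0 → A z = 0) (hs : ∀ z, B z = 0 → deriv B z ≠ 0) :
    ∃ H : ℂ → ℂ, Differentiable ℂ H ∧ ∀ z, A z = H z * B z := by
  classical
  refine ⟨fun z => if B z = 0 then deriv A z / deriv B z else A z / B z, fun z₀ => ?_, fun z => ?_⟩
  · by_cases h0 : B z₀ = 0
    · have hA' : DifferentiableAt ℂ (dslope A z₀) z₀ :=
        ((Complex.differentiableOn_dslope univ_mem).2 hA.differentiableOn).differentiableAt univ_mem
      have hB' : DifferentiableAt ℂ (dslope B z₀) z₀ :=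
        ((Complex.differentiableOn_dslope univ_mem).2 hB.differentiableOn).differentiableAt univ_mem
      have hne : dslope B z₀ z₀ ≠ 0 := by rw [dslope_same]; exact hs z₀ h0
      refine (hA'.div hB' hne).congr_of_eventuallyEq ?_
      have hev := ((hB z₀).hasDerivAt.eventually_ne (c := 0) (hs z₀ h0))
      rw [eventually_nhdsWithin_iff] at hev
      filter_upwards [hev] with z hz'
      by_cases hzz : z = z₀
      · subst hzz
        simp [h0]
      · have hBz := hz' hzz
        rw [if_neg hBz]
        simp only [Pi.div_apply, dslope_of_ne _ hzz, slope_def_field, h0, hz z₀ h0, sub_zero]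
        have : z - z₀ ≠ 0 := sub_ne_zero.2 hzz
        field_simp
    · refine ((hA z₀).div (hB z₀) h0).congr_of_eventuallyEq ?_
      filter_upwards [(hB z₀).continuousAt.eventually_ne h0] with z hz'
      simp [hz']
  · by_cases h0 : B z = 0
    · simp [h0, hz z h0]
    · simp [h0]

/-- A quotient of entire functions without poles whose absolute value has the periods `L` and `Lτ`
is constant. -/
theorem exists_eq_const_mul {τ : ℂ} (hτ : 0 < τ.im) {L : ℝ} (hL : 0 < L) {A B : ℂ → ℂ}
    (hA : Differentiable ℂ A) (hB : Differentiable ℂ B)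
    (hz : ∀ z, B z = 0 → A z = 0) (hs : ∀ z, B z = 0 → deriv B z ≠ 0)
    (h1 : ∀ z, B z ≠ 0 → B (z + L) ≠ 0 ∧ ‖A (z + L)‖ * ‖B z‖ = ‖A z‖ * ‖B (z + L)‖)
    (h2 : ∀ z, B z ≠ 0 → B (z + L * τ) ≠ 0 ∧
      ‖A (z + L * τ)‖ * ‖B z‖ = ‖A z‖ * ‖B (z + L * τ)‖) :
    ∃ C, ∀ z, A z = C * B z := by
  obtain ⟨H, hH, hAH⟩ := exists_entire_quotient hA hB hz hs
  have key : ∀ ω : ℂ, (∀ z, B z ≠ 0 → B (z + ω) ≠ 0 ∧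
      ‖A (z + ω)‖ * ‖B z‖ = ‖A z‖ * ‖B (z + ω)‖) → ∀ z, ‖H (z + ω)‖ = ‖H z‖ := by
    intro ω h z
    have := eq_of_eq_of_simple_zeros hB hs (F := fun z => ((‖H (z + ω)‖ : ℝ) : ℂ))
      (G := fun z => ((‖H z‖ : ℝ) : ℂ))
      (Complex.continuous_ofReal.comp (hH.continuous.comp (by fun_prop)).norm)
      (Complex.continuous_ofReal.comp hH.continuous.norm) (fun z hz => by
        obtain ⟨h3, h4⟩ := h z hz
        rw [hAH, hAH, norm_mul, norm_mul] at h4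
        have h5 : ‖B z‖ ≠ 0 := norm_ne_zero_iff.2 hz
        have h6 : ‖B (z + ω)‖ ≠ 0 := norm_ne_zero_iff.2 h3
        congr 1
        apply mul_right_cancel₀ (mul_ne_zero h5 h6)
        linear_combination h4) z
    exact Complex.ofReal_injective this
  obtain ⟨C, hC⟩ := exists_const_of_norm_periodic hτ hL hH (key _ h1) (key _ h2)
  exact ⟨C, fun z => by rw [hAH, hC]⟩

/-- Induction over the lattice `ℤ + ℤτ`. -/
theorem lattice_induction {τ : ℂ} {P : ℂ → Prop} (h0 : P 0) (h1 : ∀ z, P (z + 1) ↔ P z)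
    (h2 : ∀ z, P (z + τ) ↔ P z) (m n : ℤ) : P (m + n * τ) := by
  have hm : ∀ (z : ℂ) (m : ℤ), P (z + m) ↔ P z := by
    intro z m
    induction m using Int.induction_on with
    | zero => simp
    | succ k ih => rw [← ih, ← h1 (z + (k : ℤ))]; push_cast; ring_nf
    | pred k ih => rw [← ih, ← h1]; push_cast; ring_nf
  have hn : ∀ (z : ℂ) (n : ℤ), P (z + n * τ) ↔ P z := by
    intro z n
    induction n using Int.induction_on with
    | zero => simp
    | succ k ih => rw [← ih, ← h2 (z + (k : ℤ) * τ)]; push_cast; ring_nf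
    | pred k ih => rw [← ih, ← h2]; push_cast; ring_nf
  rw [hn]
  have := (hm 0 m).2 h0
  simpa using this

/-! ### The exponential `e^{iπs}` -/

theorem ex_add (s t : ℂ) : ex (s + t) = ex s * ex t := by
  simp [ex, mul_add, Complex.exp_add]

theorem ex_ne_zero (s : ℂ) : ex s ≠ 0 := Complex.exp_ne_zero _

theorem ex_zero : ex 0 = 1 := by simp [ex]

theorem ex_neg (s : ℂ) : ex (-s) = (ex s)⁻¹ := by simp [ex, Complex.exp_neg]

theorem ex_sub (s t : ℂ) : ex (s - t) = ex s / ex t := by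
  rw [sub_eq_add_neg, ex_add, ex_neg, div_eq_mul_inv]

theorem ex_nat_mul (n : ℕ) (s : ℂ) : ex (n * s) = ex s ^ n := by
  simp only [ex, ← Complex.exp_nat_mul]; ring_nf

theorem ex_int_mul (n : ℤ) (s : ℂ) : ex (n * s) = ex s ^ n := by
  simp only [ex, ← Complex.exp_int_mul]; ring_nf

theorem ex_two_mul (s : ℂ) : ex (2 * s) = ex s ^ 2 := by
  simpa using ex_nat_mul 2 s

theorem ex_one : ex 1 = -1 := by
  simp [ex, mul_comm Complex.I, Complex.exp_pi_mul_I]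

theorem ex_eq_one_iff (s : ℂ) : ex s = 1 ↔ ∃ n : ℤ, s = 2 * n := by
  rw [ex, Complex.exp_eq_one_iff]
  have hpi : (Real.pi : ℂ) ≠ 0 := by exact_mod_cast Real.pi_ne_zero
  refine exists_congr fun n => ⟨fun h => ?_, fun h => by rw [h]; ring⟩
  apply mul_left_cancel₀ (mul_ne_zero Complex.I_ne_zero hpi)
  rw [h]; ring

theorem ex_eq_ex_iff (s t : ℂ) : ex s = ex t ↔ ∃ n : ℤ, s = t + 2 * n := by
  rw [← div_eq_one_iff_eq (ex_ne_zero t), ← ex_sub, ex_eq_one_iff]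
  exact exists_congr fun n => by rw [sub_eq_iff_eq_add, add_comm]

theorem norm_ex (s : ℂ) : ‖ex s‖ = Real.exp (-(Real.pi * s.im)) := by
  rw [ex, Complex.norm_exp]
  simp [mul_assoc]

theorem norm_ex_lt_one {s : ℂ} (hs : 0 < s.im) : ‖ex s‖ < 1 := by
  rw [norm_ex, Real.exp_lt_one_iff]
  have := mul_pos Real.pi_pos hs
  linarith

theorem norm_ex_eq_one {s : ℂ} (hs : s.im = 0) : ‖ex s‖ = 1 := by
  simp [norm_ex, hs]

theorem hasDerivAt_ex (s : ℂ) : HasDerivAt ex (Complex.I * Real.pi * ex s) s := by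
  have := ((hasDerivAt_id s).const_mul (Complex.I * (Real.pi : ℂ))).cexp
  unfold ex
  simpa [mul_comm] using this

theorem differentiable_ex : Differentiable ℂ ex := fun s => (hasDerivAt_ex s).differentiableAt

/-! ### Infinite products -/

section Products

variable {ι : Type*} {c : ι → ℂ}

theorem multipliable_one_sub (hc : Summable fun i => ‖c i‖) (z : ℂ) :
    Multipliable fun i => 1 - z * c i := by
  simp_rw [sub_eq_add_neg]
  exact multipliable_one_add_of_summable (by simpa using hc.mul_left ‖z‖)

theorem multipliableLocallyUniformlyOn_one_sub (hc : Summable fun i => ‖c i‖) (R : ℝ) :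
    MultipliableLocallyUniformlyOn (fun i (z : ℂ) => 1 - z * c i) (Metric.ball 0 R) := by
  simp_rw [sub_eq_add_neg]
  refine Summable.multipliableLocallyUniformlyOn_one_add (u := fun i => R * ‖c i‖)
    Metric.isOpen_ball (hc.mul_left R) (.of_forall fun i z hz => ?_) (fun i => by fun_prop)
  rw [norm_neg, norm_mul]
  have : ‖z‖ < R := by simpa using hz
  gcongr

theorem differentiable_tprod_one_sub (hc : Summable fun i => ‖c i‖) :
    Differentiable ℂ fun z => ∏' i, (1 - z * c i) := by
  intro z
  have h := (multipliableLocallyUniformlyOn_one_sub hc (‖z‖ + 1)).hasProdLocallyUniformlyOn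
  have h2 : DifferentiableOn ℂ (fun z => ∏' i, (1 - z * c i)) (Metric.ball 0 (‖z‖ + 1)) :=
    h.differentiableOn (.of_forall fun s => by
      simpa [Finset.prod_fn] using DifferentiableOn.finsetProd (fun _ _ => by fun_prop))
      Metric.isOpen_ball
  exact h2.differentiableAt (Metric.isOpen_ball.mem_nhds (by simp))

theorem tprod_one_sub_eq_zero_iff (hc : Summable fun i => ‖c i‖) (z : ℂ) :
    ∏' i, (1 - z * c i) = 0 ↔ ∃ i, 1 - z * c i = 0 := by
  refine ⟨fun h => ?_, fun ⟨i, hi⟩ => ?_⟩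
  · by_contra hne
    push Not at hne
    refine tprod_one_add_ne_zero_of_summable (f := fun i => -(z * c i)) ?_ ?_ ?_
    · simpa [← sub_eq_add_neg] using hne
    · simpa using hc.mul_left ‖z‖
    · simpa [← sub_eq_add_neg] using h
  · exact tprod_of_exists_eq_zero ⟨i, hi⟩

end Products

theorem summable_norm_pow {a : ℂ} (ha : ‖a‖ < 1) : Summable fun n : ℕ => ‖a ^ n‖ := by
  simpa using summable_geometric_of_lt_one (norm_nonneg _) ha

theorem summable_norm_pow_mul_pow {a b : ℂ} (ha : ‖a‖ < 1) (hb : ‖b‖ < 1) :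
    Summable fun n : ℕ × ℕ => ‖a ^ n.1 * b ^ n.2‖ := by
  simp_rw [norm_mul]
  exact (summable_norm_pow ha).mul_of_nonneg (summable_norm_pow hb) (fun _ => norm_nonneg _)
    (fun _ => norm_nonneg _)

theorem differentiable_poch {a : ℂ} (ha : ‖a‖ < 1) : Differentiable ℂ fun z => poch z a :=
  differentiable_tprod_one_sub (summable_norm_pow ha)

theorem poch_eq_zero_iff {a : ℂ} (ha : ‖a‖ < 1) (z : ℂ) :
    poch z a = 0 ↔ ∃ n : ℕ, 1 - z * a ^ n = 0 :=
  tprod_one_sub_eq_zero_iff (summable_norm_pow ha) z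

theorem poch_step {a : ℂ} (ha : ‖a‖ < 1) (z : ℂ) : poch z a = (1 - z) * poch (a * z) a := by
  have e : ∀ n : ℕ, 1 - z * a ^ (n + 1) = 1 - a * z * a ^ n := fun n => by ring
  have hm : Multipliable fun n : ℕ => 1 - z * a ^ (n + 1) := by
    simpa only [e] using multipliable_one_sub (summable_norm_pow ha) (a * z)
  have := tprod_eq_zero_mul' (f := fun n : ℕ => 1 - z * a ^ n) hm
  simpa only [poch, e, pow_zero, mul_one] using this

theorem differentiable_poch₂ {a b : ℂ} (ha : ‖a‖ < 1) (hb : ‖b‖ < 1) :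
    Differentiable ℂ fun z => poch₂ z a b := by
  have := differentiable_tprod_one_sub (summable_norm_pow_mul_pow ha hb)
  simpa only [poch₂, mul_assoc] using this

theorem poch₂_eq_zero_iff {a b : ℂ} (ha : ‖a‖ < 1) (hb : ‖b‖ < 1) (z : ℂ) :
    poch₂ z a b = 0 ↔ ∃ m n : ℕ, 1 - z * a ^ m * b ^ n = 0 := by
  have := tprod_one_sub_eq_zero_iff (summable_norm_pow_mul_pow ha hb) z
  simpa only [poch₂, mul_assoc, Prod.exists] using this

theorem poch₂_comm (z a b : ℂ) : poch₂ z a b = poch₂ z b a := by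
  unfold poch₂
  rw [← (Equiv.prodComm ℕ ℕ).tprod_eq]
  simp [mul_right_comm]

theorem hasProd_poch₂ {a b : ℂ} (ha : ‖a‖ < 1) (hb : ‖b‖ < 1) (z : ℂ) :
    HasProd (fun m : ℕ => poch (z * a ^ m) b) (poch₂ z a b) := by
  have hm : Multipliable fun n : ℕ × ℕ => 1 - z * a ^ n.1 * b ^ n.2 := by
    simpa only [mul_assoc] using multipliable_one_sub (summable_norm_pow_mul_pow ha hb) z
  exact HasProd.prod_fiberwise (f := fun n : ℕ × ℕ => 1 - z * a ^ n.1 * b ^ n.2) hm.hasProd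
    fun m => (multipliable_one_sub (summable_norm_pow hb) (z * a ^ m)).hasProd

/-- `(z; a, b)_∞ = (z; b)_∞ (az; a, b)_∞`. -/
theorem poch₂_step_left {a b : ℂ} (ha : ‖a‖ < 1) (hb : ‖b‖ < 1) (z : ℂ) :
    poch₂ z a b = poch z b * poch₂ (a * z) a b := by
  have e : ∀ m : ℕ, poch (z * a ^ (m + 1)) b = poch (a * z * a ^ m) b := fun m => by ring_nf
  have h2 := hasProd_poch₂ ha hb (a * z)
  have hm : Multipliable fun m : ℕ => poch (z * a ^ (m + 1)) b := by
    simpa only [e] using h2.multipliable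
  have := tprod_eq_zero_mul' (f := fun m : ℕ => poch (z * a ^ m) b) hm
  simpa only [e, pow_zero, mul_one, (hasProd_poch₂ ha hb z).tprod_eq, h2.tprod_eq] using this

/-- `(z; a, b)_∞ = (z; a)_∞ (bz; a, b)_∞`. -/
theorem poch₂_step_right {a b : ℂ} (ha : ‖a‖ < 1) (hb : ‖b‖ < 1) (z : ℂ) :
    poch₂ z a b = poch z a * poch₂ (b * z) a b := by
  rw [poch₂_comm, poch₂_step_left hb ha, poch₂_comm]

/-! ### The multiplicative theta function -/

theorem bigTheta_mul {a z : ℂ} (ha : ‖a‖ < 1) (ha0 : a ≠ 0) (hz : z ≠ 0) :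
    bigTheta a (a * z) = -z⁻¹ * bigTheta a z := by
  have e : a * (a * z)⁻¹ = z⁻¹ := by field_simp
  rw [bigTheta, bigTheta, e, poch_step ha z, poch_step ha z⁻¹]
  field_simp
  ring

theorem bigTheta_eq_zero_iff {a z : ℂ} (ha : ‖a‖ < 1) (ha0 : a ≠ 0) (hz : z ≠ 0) :
    bigTheta a z = 0 ↔ ∃ n : ℤ, z = a ^ n := by
  have h1 : poch a a ≠ 0 := by
    rw [Ne, poch_eq_zero_iff ha]
    rintro ⟨n, hn⟩
    have : ‖a ^ (n + 1)‖ < 1 := by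
      rw [norm_pow]; exact pow_lt_one₀ (norm_nonneg _) ha (by omega)
    rw [pow_succ', ← sub_eq_zero.1 hn] at this
    simp at this
  rw [bigTheta, mul_eq_zero, mul_eq_zero, or_iff_left h1, poch_eq_zero_iff ha, poch_eq_zero_iff ha]
  constructor
  · rintro (⟨n, hn⟩ | ⟨n, hn⟩)
    · refine ⟨-n, ?_⟩
      rw [zpow_neg, zpow_natCast]
      exact eq_inv_of_mul_eq_one_left (sub_eq_zero.1 hn).symm
    · refine ⟨n + 1, ?_⟩
      have := sub_eq_zero.1 hn
      rw [zpow_add₀ ha0, zpow_natCast, zpow_one]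
      field_simp at this
      linear_combination this
  · rintro ⟨n, rfl⟩
    rcases lt_or_ge 0 n with h | h
    · right
      obtain ⟨k, rfl⟩ : ∃ k : ℕ, n = k + 1 := ⟨(n - 1).toNat, by omega⟩
      refine ⟨k, ?_⟩
      rw [zpow_add₀ ha0, zpow_natCast, zpow_one]
      field_simp
      ring
    · left
      obtain ⟨k, rfl⟩ : ∃ k : ℕ, n = -k := ⟨(-n).toNat, by omega⟩
      refine ⟨k, ?_⟩
      rw [zpow_neg, zpow_natCast, inv_mul_cancel₀ (pow_ne_zero _ ha0), sub_self]

theorem differentiableAt_bigTheta {a z : ℂ} (ha : ‖a‖ < 1) (hz : z ≠ 0) :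
    DifferentiableAt ℂ (bigTheta a) z := by
  have h1 := (differentiable_poch ha) z
  have h2 : DifferentiableAt ℂ (fun z => poch (a * z⁻¹) a) z :=
    (differentiable_poch ha (a * z⁻¹)).comp z ((differentiableAt_inv hz).const_mul a)
  exact (h1.mul h2).mul_const _

/-! ### Theta functions with characteristics -/

theorem thetaChar_eq_tsum (γ₁ γ₂ ξ τ : ℂ) :
    thetaChar γ₁ γ₂ ξ τ = ∑' m : ℤ, ex ((m + γ₁) ^ 2 * τ + 2 * (m + γ₁) * (ξ + γ₂)) := by
  unfold thetaChar ex
  refine tsum_congr fun m => ?_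
  ring_nf

theorem thetaChar_eq_jacobiTheta₂ (γ₁ γ₂ ξ τ : ℂ) :
    thetaChar γ₁ γ₂ ξ τ = ex (γ₁ ^ 2 * τ + 2 * γ₁ * (ξ + γ₂)) *
      jacobiTheta₂ (ξ + γ₂ + γ₁ * τ) τ := by
  rw [thetaChar_eq_tsum, jacobiTheta₂, ← tsum_mul_left]
  refine tsum_congr fun m => ?_
  have : jacobiTheta₂_term m (ξ + γ₂ + γ₁ * τ) τ = ex (2 * m * (ξ + γ₂ + γ₁ * τ) + m ^ 2 * τ) := by
    unfold jacobiTheta₂_term ex; ring_nf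
  rw [this, ← ex_add]
  ring_nf

theorem thetaChar_left_add_one (γ₁ γ₂ ξ τ : ℂ) :
    thetaChar (γ₁ + 1) γ₂ ξ τ = thetaChar γ₁ γ₂ ξ τ := by
  symm
  rw [thetaChar_eq_tsum, thetaChar_eq_tsum, ← (Equiv.addRight (1 : ℤ)).tsum_eq]
  refine tsum_congr fun m => ?_
  rw [Equiv.coe_addRight]
  push_cast
  ring_nf

theorem thetaChar_right_add (γ₁ γ₂ ξ τ t : ℂ) :
    thetaChar γ₁ (γ₂ + t) ξ τ = thetaChar γ₁ γ₂ (ξ + t) τ := by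
  rw [thetaChar_eq_tsum, thetaChar_eq_tsum]
  refine tsum_congr fun m => ?_
  ring_nf

theorem thetaChar_add_one (γ₁ γ₂ ξ τ : ℂ) :
    thetaChar γ₁ γ₂ (ξ + 1) τ = ex (2 * γ₁) * thetaChar γ₁ γ₂ ξ τ := by
  rw [thetaChar_eq_tsum, thetaChar_eq_tsum, ← tsum_mul_left]
  refine tsum_congr fun m => ?_
  rw [← ex_add, ex_eq_ex_iff]
  exact ⟨m, by ring⟩

theorem thetaChar_add_mul (γ₁ γ₂ ξ τ t : ℂ) :
    thetaChar γ₁ γ₂ (ξ + t * τ) τ =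
      ex (-(t ^ 2 * τ) - 2 * t * (ξ + γ₂)) * thetaChar (γ₁ + t) γ₂ ξ τ := by
  rw [thetaChar_eq_tsum, thetaChar_eq_tsum, ← tsum_mul_left]
  refine tsum_congr fun m => ?_
  rw [← ex_add]
  ring_nf

theorem thetaChar_neg (γ₁ γ₂ ξ τ : ℂ) :
    thetaChar (-γ₁) (-γ₂) (-ξ) τ = thetaChar γ₁ γ₂ ξ τ := by
  rw [thetaChar_eq_tsum, thetaChar_eq_tsum, ← (Equiv.neg ℤ).tsum_eq]
  refine tsum_congr fun m => ?_
  rw [Equiv.neg_apply]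
  push_cast
  ring_nf

theorem differentiable_thetaChar {τ : ℂ} (hτ : 0 < τ.im) (γ₁ γ₂ : ℂ) :
    Differentiable ℂ fun ξ => thetaChar γ₁ γ₂ ξ τ := by
  intro ξ
  simp_rw [thetaChar_eq_jacobiTheta₂]
  refine DifferentiableAt.mul ?_ ?_
  · exact (differentiable_ex _).comp ξ (by fun_prop)
  · exact (differentiableAt_jacobiTheta₂_fst _ hτ).comp ξ (by fun_prop)

/-- The constant Fourier coefficient of the theta function is `1`, so it does not vanish
identically. -/
theorem exists_jacobiTheta₂_ne_zero {τ : ℂ} (hτ : 0 < τ.im) : ∃ x : ℝ, jacobiTheta₂ x τ ≠ 0 := by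
  by_contra! h
  have hterm : ∀ (n : ℤ) (x : ℝ), jacobiTheta₂_term n x τ =
      jacobiTheta₂_term n 0 τ * Complex.exp (2 * Real.pi * Complex.I * n * x) := by
    intro n x
    rw [jacobiTheta₂_term, jacobiTheta₂_term, ← Complex.exp_add]
    ring_nf
  have hcont : ∀ n : ℤ, Continuous fun x : ℝ => jacobiTheta₂_term n x τ := by
    intro n; unfold jacobiTheta₂_term; fun_prop
  have hnorm : ∀ (n : ℤ) (x : ℝ), ‖jacobiTheta₂_term n x τ‖ = ‖jacobiTheta₂_term n 0 τ‖ := by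
    intro n x
    rw [norm_jacobiTheta₂_term, norm_jacobiTheta₂_term]; simp
  have hsum := intervalIntegral.hasSum_integral_of_dominated_convergence
    (μ := MeasureTheory.volume) (a := 0) (b := 1)
    (F := fun (n : ℤ) (x : ℝ) => jacobiTheta₂_term n x τ) (f := fun _ => 0)
    (fun n _ => ‖jacobiTheta₂_term n 0 τ‖)
    (fun n => (hcont n).aestronglyMeasurable)
    (fun n => .of_forall fun x _ => (hnorm n x).le)
    (.of_forall fun x _ => ((summable_jacobiTheta₂_term_iff 0 τ).2 hτ).norm)
    (by simp)
    (.of_forall fun x _ => by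
      have := hasSum_jacobiTheta₂_term (x : ℂ) hτ
      rwa [h x] at this)
  have hint : ∀ n : ℤ, (∫ x in (0 : ℝ)..1, jacobiTheta₂_term n x τ) = if n = 0 then 1 else 0 := by
    intro n
    split_ifs with hn
    · subst hn; simp [jacobiTheta₂_term]
    · simp_rw [hterm n]
      have hc : (2 * Real.pi * Complex.I * n : ℂ) ≠ 0 := by
        simp [Real.pi_ne_zero, hn]
      rw [intervalIntegral.integral_const_mul, integral_exp_mul_complex hc]
      have : Complex.exp (2 * Real.pi * Complex.I * n) = 1 :=
        Complex.exp_eq_one_iff.2 ⟨n, by ring⟩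
      simp [this]
  simp_rw [hint] at hsum
  have := hsum.unique (hasSum_ite_eq (0 : ℤ) (1 : ℂ))
  simp at this

/-- The odd theta function `ϑ[1/2, 1/2](v, τ)`. -/
noncomputable def oddTheta (τ v : ℂ) : ℂ := thetaChar (1 / 2) (1 / 2) v τ

theorem differentiable_oddTheta {τ : ℂ} (hτ : 0 < τ.im) : Differentiable ℂ (oddTheta τ) :=
  differentiable_thetaChar hτ _ _

theorem oddTheta_add_one (τ v : ℂ) : oddTheta τ (v + 1) = -oddTheta τ v := by
  rw [oddTheta, thetaChar_add_one, show (2 * (1 / 2) : ℂ) = 1 by norm_num, ex_one, oddTheta]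
  ring

theorem oddTheta_add_tau (τ v : ℂ) :
    oddTheta τ (v + τ) = -ex (-τ - 2 * v) * oddTheta τ v := by
  have := thetaChar_add_mul (1 / 2) (1 / 2) v τ 1
  rw [one_mul, thetaChar_left_add_one] at this
  rw [oddTheta, this, oddTheta]
  congr 1
  rw [show (-(1 ^ 2 * τ) - 2 * 1 * (v + 1 / 2) : ℂ) = -τ - 2 * v - 1 by ring, ex_sub, ex_one]
  ring

theorem oddTheta_neg (τ v : ℂ) : oddTheta τ (-v) = -oddTheta τ v := by
  have h1 := thetaChar_neg (-(1 / 2)) (-(1 / 2)) v τ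
  have h2 := thetaChar_left_add_one (-(1 / 2)) (-(1 / 2)) v τ
  have h3 := thetaChar_right_add (1 / 2) (-(1 / 2)) v τ 1
  rw [show (-(1 / 2) + 1 : ℂ) = 1 / 2 by norm_num] at h2 h3
  rw [neg_neg] at h1
  rw [oddTheta, h1, ← h2, oddTheta, h3, thetaChar_add_one, show (2 * (1 / 2) : ℂ) = 1 by norm_num,
    ex_one]
  ring

theorem oddTheta_zero (τ : ℂ) : oddTheta τ 0 = 0 := by
  have := oddTheta_neg τ 0
  rw [neg_zero] at this
  linear_combination this / 2

theorem exists_oddTheta_ne_zero {τ : ℂ} (hτ : 0 < τ.im) : ∃ v, oddTheta τ v ≠ 0 := by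
  obtain ⟨x, hx⟩ := exists_jacobiTheta₂_ne_zero hτ
  refine ⟨x - 1 / 2 - 1 / 2 * τ, ?_⟩
  rw [oddTheta, thetaChar_eq_jacobiTheta₂]
  refine mul_ne_zero (ex_ne_zero _) ?_
  ring_nf
  exact hx

/-- The product side of the Jacobi triple product identity. -/
noncomputable def prodTheta (τ v : ℂ) : ℂ := ex (-v) * bigTheta (ex (2 * τ)) (ex v ^ 2)

theorem im_two_mul_pos {τ : ℂ} (hτ : 0 < τ.im) : 0 < (2 * τ).im := by simpa using hτ

theorem differentiable_prodTheta {τ : ℂ} (hτ : 0 < τ.im) : Differentiable ℂ (prodTheta τ) := by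
  intro v
  refine DifferentiableAt.mul ((differentiable_ex _).comp v (by fun_prop)) ?_
  exact (differentiableAt_bigTheta (norm_ex_lt_one (im_two_mul_pos hτ))
    (pow_ne_zero 2 (ex_ne_zero v))).comp v ((differentiable_ex v).pow 2)

theorem prodTheta_add_one (τ v : ℂ) : prodTheta τ (v + 1) = -prodTheta τ v := by
  rw [prodTheta, prodTheta, neg_add, ex_add, ex_neg 1, ex_add v 1, ex_one]
  ring_nf

theorem prodTheta_add_tau {τ : ℂ} (hτ : 0 < τ.im) (v : ℂ) :
    prodTheta τ (v + τ) = -ex (-τ - 2 * v) * prodTheta τ v := by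
  have e : ex (v + τ) ^ 2 = ex (2 * τ) * ex v ^ 2 := by rw [ex_add, ex_two_mul]; ring
  rw [prodTheta, prodTheta, e, bigTheta_mul (norm_ex_lt_one (im_two_mul_pos hτ)) (ex_ne_zero _)
    (pow_ne_zero 2 (ex_ne_zero v)), ← ex_two_mul, ← ex_neg, neg_add, ex_add, ex_sub, ex_neg (2 * v)]
  ring

theorem prodTheta_eq_zero_iff {τ : ℂ} (hτ : 0 < τ.im) (v : ℂ) :
    prodTheta τ v = 0 ↔ ∃ m n : ℤ, v = m + n * τ := by
  rw [prodTheta, mul_eq_zero, or_iff_right (ex_ne_zero _), bigTheta_eq_zero_iff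
    (norm_ex_lt_one (im_two_mul_pos hτ)) (ex_ne_zero _) (pow_ne_zero 2 (ex_ne_zero v)), exists_comm]
  refine exists_congr fun n => ?_
  rw [← ex_two_mul, ← ex_int_mul, ex_eq_ex_iff]
  refine exists_congr fun m => ?_
  constructor
  · intro h; linear_combination (1 / 2 : ℂ) * h
  · intro h; linear_combination 2 * h

/-- Simple zeros are preserved by quasi-periods. -/
theorem simple_zero_add_iff {B m : ℂ → ℂ} {ω : ℂ} (hB : Differentiable ℂ B)
    (hm : Differentiable ℂ m) (hm0 : ∀ z, m z ≠ 0) (h : ∀ z, B (z + ω) = m z * B z) (z : ℂ) :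
    (B (z + ω) = 0 ∧ deriv B (z + ω) ≠ 0) ↔ (B z = 0 ∧ deriv B z ≠ 0) := by
  have h1 : B (z + ω) = 0 ↔ B z = 0 := by rw [h, mul_eq_zero, or_iff_right (hm0 z)]
  rw [h1]
  refine and_congr_right fun hz => not_congr ?_
  have h2 : deriv B (z + ω) = m z * deriv B z := by
    rw [← deriv_comp_add_const, funext h, deriv_fun_mul (hm z) (hB z), hz]
    ring
  rw [h2, mul_eq_zero, or_iff_right (hm0 z)]

theorem deriv_prodTheta_zero_ne_zero {τ : ℂ} (hτ : 0 < τ.im) : deriv (prodTheta τ) 0 ≠ 0 := by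
  have hp := norm_ex_lt_one (im_two_mul_pos hτ)
  set p := ex (2 * τ)
  have hfun : prodTheta τ = fun v => (1 - ex v ^ 2) *
      (ex (-v) * (poch (p * ex v ^ 2) p * poch (p * (ex v ^ 2)⁻¹) p * poch p p)) := by
    funext v
    rw [prodTheta, bigTheta, poch_step hp (ex v ^ 2)]
    ring
  have hp0 : poch p p ≠ 0 := by
    rw [Ne, poch_eq_zero_iff hp]
    rintro ⟨n, hn⟩
    have : ‖p ^ (n + 1)‖ < 1 := by
      rw [norm_pow]; exact pow_lt_one₀ (norm_nonneg _) hp (by omega)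
    rw [pow_succ', ← sub_eq_zero.1 hn] at this
    simp at this
  have h1 : HasDerivAt (fun v => 1 - ex v ^ 2) (-(2 * (Complex.I * Real.pi))) 0 := by
    have := ((hasDerivAt_ex 0).pow 2).const_sub 1
    simpa [ex_zero] using this
  have h2 : DifferentiableAt ℂ (fun v => ex (-v) *
      (poch (p * ex v ^ 2) p * poch (p * (ex v ^ 2)⁻¹) p * poch p p)) 0 := by
    refine DifferentiableAt.mul ((differentiable_ex _).comp 0 (by fun_prop)) ?_
    refine DifferentiableAt.mul (DifferentiableAt.mul ?_ ?_) (differentiableAt_const _)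
    · exact (differentiable_poch hp _).comp (0 : ℂ) (((differentiable_ex 0).pow 2).const_mul p)
    · exact (differentiable_poch hp _).comp (0 : ℂ)
        ((((differentiable_ex 0).pow 2).inv (pow_ne_zero 2 (ex_ne_zero 0))).const_mul p)
  have h3 := (h1.mul h2.hasDerivAt).deriv
  rw [hfun]
  erw [h3]
  simp [ex_zero, hp0, Real.pi_ne_zero]

theorem prodTheta_simple {τ : ℂ} (hτ : 0 < τ.im) (v : ℂ) (hv : prodTheta τ v = 0) :
    deriv (prodTheta τ) v ≠ 0 := by
  obtain ⟨m, n, rfl⟩ := (prodTheta_eq_zero_iff hτ v).1 hv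
  refine (lattice_induction (P := fun v => prodTheta τ v = 0 ∧ deriv (prodTheta τ) v ≠ 0)
    ⟨(prodTheta_eq_zero_iff hτ 0).2 ⟨0, 0, by simp⟩, deriv_prodTheta_zero_ne_zero hτ⟩
    (simple_zero_add_iff (differentiable_prodTheta hτ) (m := fun _ => -1) (by fun_prop) (by simp)
      fun z => by rw [prodTheta_add_one]; ring)
    (simple_zero_add_iff (differentiable_prodTheta hτ) (m := fun z => -ex (-τ - 2 * z))
      ((differentiable_ex.comp (by fun_prop)).neg) (fun z => neg_ne_zero.2 (ex_ne_zero _))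
      (prodTheta_add_tau hτ)) m n).2

/-- The Jacobi triple product identity, up to the value of the constant. -/
theorem exists_oddTheta_eq_prodTheta {τ : ℂ} (hτ : 0 < τ.im) :
    ∃ C : ℂ, C ≠ 0 ∧ ∀ v, oddTheta τ v = C * prodTheta τ v := by
  have hz : ∀ v, prodTheta τ v = 0 → oddTheta τ v = 0 := by
    intro v hv
    obtain ⟨m, n, rfl⟩ := (prodTheta_eq_zero_iff hτ v).1 hv
    refine lattice_induction (P := fun v => oddTheta τ v = 0) (oddTheta_zero τ) (fun z => ?_)
      (fun z => ?_) m n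
    · rw [oddTheta_add_one, neg_eq_zero]
    · rw [oddTheta_add_tau, mul_eq_zero, or_iff_right (neg_ne_zero.2 (ex_ne_zero _))]
  obtain ⟨C, hC⟩ := exists_eq_const_mul hτ one_pos (differentiable_oddTheta hτ)
    (differentiable_prodTheta hτ) hz (prodTheta_simple hτ)
    (fun z h => by
      rw [Complex.ofReal_one, prodTheta_add_one, oddTheta_add_one, norm_neg, norm_neg]
      exact ⟨neg_ne_zero.2 h, rfl⟩)
    (fun z h => by
      rw [Complex.ofReal_one, one_mul, prodTheta_add_tau hτ, oddTheta_add_tau, norm_mul, norm_mul]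
      exact ⟨mul_ne_zero (neg_ne_zero.2 (ex_ne_zero _)) h, by ring⟩)
  refine ⟨C, ?_, hC⟩
  rintro rfl
  obtain ⟨v, hv⟩ := exists_oddTheta_ne_zero hτ
  exact hv (by rw [hC]; simp)

theorem oddTheta_eq_zero_iff {τ : ℂ} (hτ : 0 < τ.im) (v : ℂ) :
    oddTheta τ v = 0 ↔ ∃ m n : ℤ, v = m + n * τ := by
  obtain ⟨C, hC, h⟩ := exists_oddTheta_eq_prodTheta hτ
  rw [h, mul_eq_zero, or_iff_right hC, prodTheta_eq_zero_iff hτ]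

theorem oddTheta_simple {τ : ℂ} (hτ : 0 < τ.im) (v : ℂ) (hv : oddTheta τ v = 0) :
    deriv (oddTheta τ) v ≠ 0 := by
  obtain ⟨C, hC, h⟩ := exists_oddTheta_eq_prodTheta hτ
  rw [h, mul_eq_zero, or_iff_right hC] at hv
  rw [funext h, deriv_const_mul _ (differentiable_prodTheta hτ v)]
  exact mul_ne_zero hC (prodTheta_simple hτ v hv)

/-- An entire function with the quasi-periods of the odd theta function, up to characters of
absolute value one, is a multiple of it if it vanishes at the origin. -/
theorem exists_eq_const_mul_oddTheta {τ : ℂ} (hτ : 0 < τ.im) {A : ℂ → ℂ} {μ₁ μ₂ : ℂ}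
    (hA : Differentiable ℂ A) (hA0 : A 0 = 0) (hμ₁ : ‖μ₁‖ = 1) (hμ₂ : ‖μ₂‖ = 1)
    (h1 : ∀ z, oddTheta τ z ≠ 0 → A (z + 1) = μ₁ * A z)
    (h2 : ∀ z, oddTheta τ z ≠ 0 → A (z + τ) = μ₂ * ex (-τ - 2 * z) * A z) :
    ∃ C, ∀ z, A z = C * oddTheta τ z := by
  have hs := differentiable_oddTheta hτ
  have hA1 : Continuous fun z => A (z + 1) := hA.continuous.comp (by fun_prop)
  have hA2 : Continuous fun z => A (z + τ) := hA.continuous.comp (by fun_prop)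
  have hex : Continuous fun z => ex (-τ - 2 * z) := differentiable_ex.continuous.comp (by fun_prop)
  have h1' := eq_of_eq_of_simple_zeros hs (oddTheta_simple hτ) (F := fun z => A (z + 1))
    (G := fun z => μ₁ * A z) hA1 (hA.continuous.const_mul _) h1
  have h2' := eq_of_eq_of_simple_zeros hs (oddTheta_simple hτ) (F := fun z => A (z + τ))
    (G := fun z => μ₂ * ex (-τ - 2 * z) * A z) hA2 ((hex.const_mul _).mul hA.continuous) h2
  have hμ₁0 : μ₁ ≠ 0 := norm_ne_zero_iff.1 (by rw [hμ₁]; exact one_ne_zero)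
  have hμ₂0 : μ₂ ≠ 0 := norm_ne_zero_iff.1 (by rw [hμ₂]; exact one_ne_zero)
  refine exists_eq_const_mul hτ one_pos hA hs (fun z hz => ?_) (oddTheta_simple hτ)
    (fun z hz => ?_) (fun z hz => ?_)
  · obtain ⟨m, n, rfl⟩ := (oddTheta_eq_zero_iff hτ z).1 hz
    refine lattice_induction (P := fun z => A z = 0) hA0 (fun z => ?_) (fun z => ?_) m n
    · simp only [h1', mul_eq_zero, hμ₁0, false_or]
    · simp only [h2', mul_eq_zero, hμ₂0, ex_ne_zero, false_or]
  · rw [Complex.ofReal_one, oddTheta_add_one, h1 z hz, norm_mul, hμ₁, norm_neg, one_mul]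
    exact ⟨neg_ne_zero.2 hz, rfl⟩
  · rw [Complex.ofReal_one, one_mul, oddTheta_add_tau, h2 z hz, norm_mul, norm_mul, norm_mul, hμ₂,
      norm_neg]
    exact ⟨mul_ne_zero (neg_ne_zero.2 (ex_ne_zero _)) hz, by ring⟩

/-- If moreover one of the two characters is not that of the odd theta function, then the function
vanishes identically. -/
theorem eq_zero_of_nontrivial_character {τ : ℂ} (hτ : 0 < τ.im) {A : ℂ → ℂ} {μ₁ μ₂ : ℂ}
    (hA : Differentiable ℂ A) (hA0 : A 0 = 0) (hμ₁ : ‖μ₁‖ = 1) (hμ₂ : ‖μ₂‖ = 1)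
    (h1 : ∀ z, oddTheta τ z ≠ 0 → A (z + 1) = μ₁ * A z)
    (h2 : ∀ z, oddTheta τ z ≠ 0 → A (z + τ) = μ₂ * ex (-τ - 2 * z) * A z)
    (hne : μ₁ ≠ -1 ∨ μ₂ ≠ -1) (z : ℂ) : A z = 0 := by
  obtain ⟨C, hC⟩ := exists_eq_const_mul_oddTheta hτ hA hA0 hμ₁ hμ₂ h1 h2
  obtain ⟨v, hv⟩ := exists_oddTheta_ne_zero hτ
  suffices C = 0 by rw [hC, this, zero_mul]
  by_contra hC0
  rcases hne with h | h
  · apply h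
    have := h1 v hv
    rw [hC, hC, oddTheta_add_one] at this
    apply mul_right_cancel₀ (mul_ne_zero hC0 hv)
    linear_combination -this
  · apply h
    have := h2 v hv
    rw [hC, hC, oddTheta_add_tau] at this
    apply mul_right_cancel₀ (mul_ne_zero (mul_ne_zero (ex_ne_zero (-τ - 2 * v)) hC0) hv)
    linear_combination -this

/-! ### Theta functions whose characteristics are `N`-torsion points -/

/-- `ϑ[1/2 + a/N, 1/2 + b/N](v, τ)`, for arbitrary integers `a`, `b`. -/
noncomputable def th (N : ℕ) (τ : ℂ) (a b : ℤ) (v : ℂ) : ℂ :=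
  thetaChar (1 / 2 + a / N) (1 / 2 + b / N) v τ

/-- `ω^k = e^{2iπk/N}`. -/
noncomputable def om (N : ℕ) (k : ℤ) : ℂ := ex (2 * k / N)

section Torsion

variable {N : ℕ} {τ : ℂ}

theorem om_add (N : ℕ) (k l : ℤ) : om N (k + l) = om N k * om N l := by
  rw [om, om, om, ← ex_add]; push_cast; ring_nf

theorem om_zero (N : ℕ) : om N 0 = 1 := by simp [om, ex_zero]

theorem om_ne_zero (N : ℕ) (k : ℤ) : om N k ≠ 0 := ex_ne_zero _

theorem om_neg (N : ℕ) (k : ℤ) : om N (-k) = (om N k)⁻¹ := by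
  rw [om, om, ← ex_neg]; push_cast; ring_nf

theorem norm_om (N : ℕ) (k : ℤ) : ‖om N k‖ = 1 := by
  refine norm_ex_eq_one ?_
  have : (2 * (k : ℂ) / N) = ((2 * (k : ℝ) / N : ℝ) : ℂ) := by push_cast; ring
  rw [this, Complex.ofReal_im]

theorem th_add_inv (a b : ℤ) (v : ℂ) : th N τ a b (v + 1 / N) = th N τ a (b + 1) v := by
  rw [th, th, ← thetaChar_right_add]; push_cast; ring_nf

theorem th_add_tau_div (a b : ℤ) (v : ℂ) : th N τ a b (v + τ / N) =
    ex (-(τ / N ^ 2) - 2 / N * (v + (1 / 2 + b / N))) * th N τ (a + 1) b v := by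
  have := thetaChar_add_mul (1 / 2 + a / N) (1 / 2 + b / N) v τ (1 / N)
  rw [th, th, show v + τ / N = v + 1 / N * τ by ring, this]
  push_cast
  ring_nf

theorem th_add_one (a b : ℤ) (v : ℂ) : th N τ a b (v + 1) = -om N a * th N τ a b v := by
  rw [th, thetaChar_add_one, th]
  congr 1
  rw [show (2 * (1 / 2 + a / N) : ℂ) = 1 + 2 * a / N by ring, ex_add, ex_one, om]
  ring

theorem th_add_tau (a b : ℤ) (v : ℂ) :
    th N τ a b (v + τ) = -om N (-b) * ex (-τ - 2 * v) * th N τ a b v := by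
  have := thetaChar_add_mul (1 / 2 + a / N) (1 / 2 + b / N) v τ 1
  rw [one_mul, thetaChar_left_add_one] at this
  rw [th, this, th, om]
  congr 1
  rw [show (-(1 ^ 2 * τ) - 2 * 1 * (v + (1 / 2 + b / N)) : ℂ) =
    (2 * ((-b : ℤ) : ℂ) / N) + (-τ - 2 * v) - 1 by push_cast; ring, ex_sub, ex_one, ex_add]
  ring

theorem th_neg (a b : ℤ) (v : ℂ) : th N τ (-a) (-b) (-v) = -om N (-a) * th N τ a b v := by
  have h1 := thetaChar_neg (-(1 / 2) + a / N) (-(1 / 2) + b / N) v τ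
  rw [← thetaChar_left_add_one (-(1 / 2) + a / N)] at h1
  have h2 := thetaChar_right_add (1 / 2 + a / N) (-(1 / 2) + b / N) v τ 1
  rw [thetaChar_add_one] at h2
  have e1 : (-(1 / 2) + a / N + 1 : ℂ) = 1 / 2 + a / N := by ring
  have e2 : (-(1 / 2) + b / N + 1 : ℂ) = 1 / 2 + b / N := by ring
  rw [e1] at h1
  rw [e2] at h2
  have e3 : th N τ (-a) (-b) (-v) = thetaChar (-(-(1 / 2) + a / N)) (-(-(1 / 2) + b / N)) (-v) τ := by
    rw [th]; push_cast; ring_nf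
  rw [e3, h1, th, h2, show (2 * (1 / 2 + a / N) : ℂ) = 1 + 2 * a / N by ring, ex_add, ex_one, om_neg,
    om]
  have := ex_ne_zero (2 * a / N)
  field_simp

theorem th_eq_oddTheta (a b : ℤ) (v : ℂ) : ∃ c : ℂ, c ≠ 0 ∧
    oddTheta τ (v + (a * τ + b) / N) = c * th N τ a b v := by
  have := thetaChar_add_mul (1 / 2) (1 / 2) (v + b / N) τ (a / N)
  rw [← thetaChar_right_add (1 / 2 + a / N)] at this
  refine ⟨ex (-((a / N) ^ 2 * τ) - 2 * (a / N) * (v + b / N + 1 / 2)), ex_ne_zero _, ?_⟩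
  rw [oddTheta, th, ← this]
  ring_nf

theorem th_zero_zero (v : ℂ) : th N τ 0 0 v = oddTheta τ v := by
  simp [th, oddTheta]

theorem differentiable_th (hτ : 0 < τ.im) (a b : ℤ) : Differentiable ℂ (th N τ a b) :=
  differentiable_thetaChar hτ _ _

theorem th_eq_zero_iff (hτ : 0 < τ.im) (a b : ℤ) (v : ℂ) :
    th N τ a b v = 0 ↔ ∃ m n : ℤ, v + (a * τ + b) / N = m + n * τ := by
  obtain ⟨c, hc, h⟩ := th_eq_oddTheta (N := N) (τ := τ) a b v
  rw [← oddTheta_eq_zero_iff hτ, h, mul_eq_zero, or_iff_right hc]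

/-- A function of period `N` on the integers descends to `Fin N`. -/
theorem periodic_emod {X : Type*} {f : ℤ → X} (h : ∀ k, f (k + N) = f k) (k : ℤ) :
    f (k % N) = f k := by
  have hp : Function.Periodic f (N : ℤ) := h
  have := hp.sub_zsmul_eq (x := k) (k / N)
  rw [← this, Int.emod_def, zsmul_eq_mul, mul_comm]
  simp

theorem periodic_fin_add {X : Type*} {f : ℤ → X} (h : ∀ k, f (k + N) = f k) (x y : Fin N) :
    f ((x + y : Fin N) : ℕ) = f (x + y) := by
  rw [← periodic_emod h (x + y), Fin.val_add]
  push_cast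
  rfl

/-- The product of all the theta functions whose characteristics are torsion points. -/
noncomputable def thProd (N : ℕ) (τ z : ℂ) : ℂ :=
  ∏ β : Fin N × Fin N, th N τ β.1 β.2 (z / N)

theorem differentiable_thProd (hτ : 0 < τ.im) : Differentiable ℂ (thProd N τ) := by
  unfold thProd
  exact Differentiable.fun_finsetProd fun β _ => (differentiable_th hτ _ _).comp (by fun_prop)

variable [NeZero N]

theorem om_eq_one_iff (k : ℤ) : om N k = 1 ↔ (N : ℤ) ∣ k := by
  have hN : (N : ℂ) ≠ 0 := NeZero.ne _
  rw [om, ex_eq_one_iff]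
  refine exists_congr fun n => ⟨fun h => ?_, fun h => ?_⟩
  · field_simp at h
    have h' : ((k : ℤ) : ℂ) = ((N * n : ℤ) : ℂ) := by push_cast; linear_combination h
    exact_mod_cast h'
  · rw [h]; push_cast; field_simp

theorem om_add_mul (k j : ℤ) : om N (k + N * j) = om N k := by
  rw [om_add, (om_eq_one_iff _).2 (Dvd.intro j rfl), mul_one]

theorem th_left_add (a b : ℤ) (v : ℂ) : th N τ (a + N) b v = th N τ a b v := by
  have hN : (N : ℂ) ≠ 0 := NeZero.ne _
  rw [th, th, ← thetaChar_left_add_one (1 / 2 + a / N)]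
  push_cast
  rw [add_div, div_self hN, add_assoc]

theorem th_right_add (a b : ℤ) (v : ℂ) : th N τ a (b + N) v = -om N a * th N τ a b v := by
  have hN : (N : ℂ) ≠ 0 := NeZero.ne _
  rw [← th_add_one, th, th, ← thetaChar_right_add]
  push_cast
  rw [add_div, div_self hN, add_assoc]

theorem th_div_ne_zero (hτ : 0 < τ.im) {z : ℂ} (hz : oddTheta τ z ≠ 0) (a b : ℤ) :
    th N τ a b (z / N) ≠ 0 := by
  have hN : (N : ℂ) ≠ 0 := NeZero.ne _
  rw [Ne, th_eq_zero_iff hτ]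
  rintro ⟨m, n, h⟩
  apply hz
  rw [oddTheta_eq_zero_iff hτ]
  refine ⟨m * N - b, n * N - a, ?_⟩
  field_simp at h
  push_cast
  linear_combination h

/-! ### Sums and products over the torsion points -/

theorem th_zero_ne_zero (hτ : 0 < τ.im) (β : Fin N × Fin N) (hβ : β ≠ 0) :
    th N τ β.1 β.2 0 ≠ 0 := by
  have hN : (N : ℂ) ≠ 0 := NeZero.ne _
  rw [Ne, th_eq_zero_iff hτ]
  rintro ⟨m, n, h⟩
  apply hβ
  field_simp at h
  have him := congrArg Complex.im h
  have hre := congrArg Complex.re h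
  simp at him hre
  have e1 : (β.1 : ℤ) = N * n := by
    have : ((β.1 : ℕ) : ℝ) = N * n := by
      apply mul_right_cancel₀ hτ.ne'
      linear_combination him
    exact_mod_cast this
  have e2 : (β.2 : ℤ) = N * m := by
    have h1 : ((β.1 : ℕ) : ℝ) = N * n := by exact_mod_cast e1
    have : ((β.2 : ℕ) : ℝ) = N * m := by
      rw [h1] at hre
      linear_combination hre
    exact_mod_cast this
  have l1 := β.1.2
  have l2 := β.2.2
  have hz : ∀ (x : Fin N) (k : ℤ), ((x : ℕ) : ℤ) = N * k → x = 0 := by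
    intro x k hx
    have h1 : (N : ℤ) ∣ ((x : ℕ) : ℤ) := ⟨k, hx⟩
    have h2 := Nat.eq_zero_of_dvd_of_lt (Int.natCast_dvd_natCast.1 h1) x.2
    exact Fin.ext (by simpa using h2)
  exact Prod.ext (hz _ _ e1) (hz _ _ e2)

@[to_additive]
theorem prod_shift {M : Type*} [CommMonoid M] {g : ℤ → M} (h : ∀ k, g (k + N) = g k) :
    ∏ i : Fin N, g (i + 1) = ∏ i : Fin N, g i := by
  obtain ⟨n, hn⟩ : ∃ n, N = n + 1 := ⟨N - 1, by have := NeZero.ne N; omega⟩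
  have h0 : g (n + 1) = g 0 := by
    rw [← h 0, hn]; push_cast; ring_nf
  rw [Fin.prod_univ_eq_prod_range (fun i : ℕ => g (i + 1)) N,
    Fin.prod_univ_eq_prod_range (fun i : ℕ => g i) N, hn, Finset.prod_range_succ,
    Finset.prod_range_succ', h0]
  simp

@[to_additive]
theorem prod_shift_left {M : Type*} [CommMonoid M] {g : ℤ → ℤ → M}
    (h : ∀ a b, g (a + N) b = g a b) :
    ∏ β : Fin N × Fin N, g (β.1 + 1) β.2 = ∏ β : Fin N × Fin N, g β.1 β.2 := by
  rw [Fintype.prod_prod_type_right, Fintype.prod_prod_type_right]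
  exact Finset.prod_congr rfl fun b _ => prod_shift (g := fun a => g a ((b : ℕ) : ℤ)) (fun a => h a _)

@[to_additive]
theorem prod_shift_right {M : Type*} [CommMonoid M] {g : ℤ → ℤ → M}
    (h : ∀ a b, g a (b + N) = g a b) :
    ∏ β : Fin N × Fin N, g β.1 (β.2 + 1) = ∏ β : Fin N × Fin N, g β.1 β.2 := by
  rw [Fintype.prod_prod_type, Fintype.prod_prod_type]
  exact Finset.prod_congr rfl fun a _ => prod_shift (g := fun b => g ((a : ℕ) : ℤ) b) (fun b => h _ b)

theorem periodic_fin_neg {X : Type*} {f : ℤ → X} (h : ∀ k, f (k + N) = f k) (x : Fin N) :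
    f ((-x : Fin N) : ℕ) = f (-x) := by
  have h1 := periodic_fin_add (N := N) (f := fun k => f (k - (x : ℕ)))
    (fun k => by rw [← h (k - (x : ℕ))]; ring_nf) (-x) x
  rw [neg_add_cancel] at h1
  simpa using h1.symm

theorem sum_om {k : ℤ} (hk : ¬ (N : ℤ) ∣ k) : ∑ i : Fin N, om N (k * i) = 0 := by
  have h1 := sum_shift (N := N) (g := fun i => om N (k * i)) (fun j => by
    rw [mul_add, mul_comm k N, om_add_mul])
  simp only [mul_add, om_add, mul_one, ← Finset.sum_mul] at h1
  have h2 : om N k ≠ 1 := fun h => hk ((om_eq_one_iff k).1 h)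
  have : (∑ i : Fin N, om N (k * i)) * (om N k - 1) = 0 := by linear_combination h1
  exact (mul_eq_zero.1 this).resolve_right (sub_ne_zero.2 h2)

theorem sum_om_pair {c d : ℤ} (h : ¬ ((N : ℤ) ∣ c ∧ (N : ℤ) ∣ d)) :
    ∑ β : Fin N × Fin N, om N (d * β.1 - c * β.2) = 0 := by
  have e : ∀ β : Fin N × Fin N, om N (d * β.1 - c * β.2) =
      om N (d * β.1) * om N (-c * β.2) := fun β => by rw [← om_add]; ring_nf
  simp_rw [e]
  rw [Fintype.sum_prod_type]
  simp only [← Finset.mul_sum, ← Finset.sum_mul]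
  by_cases hd : (N : ℤ) ∣ d
  · have hc : ¬ (N : ℤ) ∣ -c := fun hc => h ⟨(Int.dvd_neg).1 hc, hd⟩
    rw [sum_om hc, mul_zero]
  · rw [sum_om hd, zero_mul]

theorem norm_th_right_add (a b : ℤ) (v : ℂ) : ‖th N τ a (b + N) v‖ = ‖th N τ a b v‖ := by
  rw [th_right_add, norm_mul, norm_neg, norm_om, one_mul]

theorem norm_thProd_add_one (z : ℂ) : ‖thProd N τ (z + 1)‖ = ‖thProd N τ z‖ := by
  simp only [thProd, add_div, th_add_inv, norm_prod]
  exact prod_shift_right (g := fun a b => ‖th N τ a b (z / N)‖)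
    fun a b => norm_th_right_add a b _

theorem norm_thProd_add_tau (z : ℂ) :
    ‖thProd N τ (z + τ)‖ = ‖ex (-τ - 2 * z)‖ * ‖thProd N τ z‖ := by
  have hN : (N : ℂ) ≠ 0 := NeZero.ne _
  have hN' : (N : ℝ) ≠ 0 := NeZero.ne _
  have h1 : ∀ β : Fin N × Fin N,
      ‖ex (-(τ / N ^ 2) - 2 / N * (z / N + (1 / 2 + ((β.2 : ℕ) : ℤ) / N)))‖ =
        ‖ex ((-τ - 2 * z) / N ^ 2)‖ := by
    intro β
    have : (-(τ / N ^ 2) - 2 / N * (z / N + (1 / 2 + (((β.2 : ℕ) : ℤ) : ℂ) / N)) : ℂ) =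
        (-τ - 2 * z) / N ^ 2 + ((- (2 / N * (1 / 2 + ((β.2 : ℕ) : ℝ) / N)) : ℝ) : ℂ) := by
      push_cast; field_simp; ring
    rw [this, ex_add, norm_mul, norm_ex_eq_one (Complex.ofReal_im _), mul_one]
  simp only [thProd, add_div, th_add_tau_div, norm_prod, norm_mul, Finset.prod_mul_distrib, h1,
    Finset.prod_const, Finset.card_univ, Fintype.card_prod, Fintype.card_fin]
  rw [prod_shift_left (g := fun a b => ‖th N τ a b (z / N)‖) fun a b => by rw [th_left_add],
    ← norm_pow, ← ex_nat_mul]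
  congr 2
  push_cast
  field_simp

theorem thProd_zero : thProd N τ 0 = 0 :=
  Finset.prod_eq_zero (Finset.mem_univ (0, 0)) (by simp [th_zero_zero, oddTheta_zero])

/-- The product over all torsion points is `ϑ[1/2, 1/2](z, τ)`, up to a constant. -/
theorem exists_thProd_eq (hτ : 0 < τ.im) :
    ∃ C : ℂ, C ≠ 0 ∧ ∀ z, thProd N τ z = C * oddTheta τ z := by
  obtain ⟨C, hC⟩ := exists_eq_const_mul hτ one_pos (differentiable_thProd (N := N) hτ)
    (differentiable_oddTheta hτ) (fun z hz => by
      obtain ⟨m, n, rfl⟩ := (oddTheta_eq_zero_iff hτ z).1 hz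
      refine lattice_induction (P := fun z => thProd N τ z = 0) thProd_zero (fun z => ?_)
        (fun z => ?_) m n
      · rw [← norm_eq_zero, norm_thProd_add_one, norm_eq_zero]
      · rw [← norm_eq_zero, norm_thProd_add_tau, mul_eq_zero, or_iff_right, norm_eq_zero]
        exact norm_ne_zero_iff.2 (ex_ne_zero _)) (oddTheta_simple hτ)
    (fun z h => by
      rw [Complex.ofReal_one, oddTheta_add_one, norm_thProd_add_one, norm_neg]
      exact ⟨neg_ne_zero.2 h, rfl⟩)
    (fun z h => by
      rw [Complex.ofReal_one, one_mul, oddTheta_add_tau, norm_thProd_add_tau, norm_mul, norm_neg]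
      exact ⟨mul_ne_zero (neg_ne_zero.2 (ex_ne_zero _)) h, by ring⟩)
  refine ⟨C, ?_, hC⟩
  rintro rfl
  obtain ⟨v, hv⟩ := exists_oddTheta_ne_zero hτ
  have h1 := hC v
  rw [zero_mul, thProd, Finset.prod_eq_zero_iff] at h1
  obtain ⟨β, _, hβ⟩ := h1
  exact th_div_ne_zero hτ hv _ _ hβ

end Torsion

/-! ### Kronecker functions at the torsion points -/

/-- The ratio `ϑ_{a,b}(ξ + z/N) / ϑ_{a,b}(z/N)`, which is `N W_{(a,b)}(ξ)` at `ζ = z`. It only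
depends on `a` and `b` modulo `N`. -/
noncomputable def phi (N : ℕ) (τ : ℂ) (a b : ℤ) (ξ z : ℂ) : ℂ :=
  th N τ a b (ξ + z / N) / th N τ a b (z / N)

section Phi

variable {N : ℕ} {τ : ℂ}

theorem phi_add_one (a b : ℤ) (ξ z : ℂ) :
    phi N τ a b (ξ + 1) z = -om N a * phi N τ a b ξ z := by
  rw [phi, add_right_comm, th_add_one, phi, mul_div_assoc]

theorem phi_add_tau (a b : ℤ) (ξ z : ℂ) : phi N τ a b (ξ + τ) z =
    -om N (-b) * ex (-τ - 2 * (ξ + z / N)) * phi N τ a b ξ z := by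
  rw [phi, add_right_comm, th_add_tau, phi, mul_div_assoc]

theorem phi_sub_one (a b : ℤ) (ξ z : ℂ) :
    phi N τ a b (ξ - 1) z = -om N (-a) * phi N τ a b ξ z := by
  have := phi_add_one (N := N) (τ := τ) a b (ξ - 1) z
  rw [sub_add_cancel] at this
  rw [this, om_neg]
  have := om_ne_zero N a
  field_simp

theorem phi_sub_tau (a b : ℤ) (ξ z : ℂ) : phi N τ a b (ξ - τ) z =
    -om N b * ex (-τ + 2 * (ξ + z / N)) * phi N τ a b ξ z := by
  have := phi_add_tau (N := N) (τ := τ) a b (ξ - τ) z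
  rw [sub_add_cancel] at this
  rw [this, om_neg, show -τ + 2 * (ξ + z / N) = -(-τ - 2 * (ξ - τ + z / N)) by ring,
    ex_neg (-τ - 2 * (ξ - τ + z / N))]
  have h1 := om_ne_zero N b
  have h2 := ex_ne_zero (-τ - 2 * (ξ - τ + z / N))
  field_simp

theorem phi_arg_add_one (a b : ℤ) (ξ z : ℂ) :
    phi N τ a b ξ (z + 1) = phi N τ a (b + 1) ξ z := by
  rw [phi, add_div, ← add_assoc, th_add_inv, th_add_inv, phi]

theorem phi_arg_add_tau (a b : ℤ) (ξ z : ℂ) :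
    phi N τ a b ξ (z + τ) = ex (-(2 / N * ξ)) * phi N τ (a + 1) b ξ z := by
  rw [phi, add_div, ← add_assoc, th_add_tau_div, th_add_tau_div, phi, mul_div_mul_comm, ← ex_sub]
  ring_nf

theorem phi_neg (a b : ℤ) (ξ z : ℂ) : phi N τ (-a) (-b) (-ξ) (-z) = phi N τ a b ξ z := by
  rw [phi, show -ξ + -z / N = -(ξ + z / N) by ring, show -z / N = -(z / N) by ring, th_neg, th_neg,
    phi, mul_div_mul_left _ _ (neg_ne_zero.2 (om_ne_zero _ _))]

theorem phi_zero {a b : ℤ} {z : ℂ} (h : th N τ a b (z / N) ≠ 0) : phi N τ a b 0 z = 1 := by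
  rw [phi, zero_add, div_self h]

theorem differentiable_phi (hτ : 0 < τ.im) (a b : ℤ) (z : ℂ) :
    Differentiable ℂ fun ξ => phi N τ a b ξ z := by
  unfold phi
  exact ((differentiable_th hτ a b).comp (by fun_prop)).div_const _

variable [NeZero N]

theorem phi_left_add (a b : ℤ) (ξ z : ℂ) : phi N τ (a + N) b ξ z = phi N τ a b ξ z := by
  rw [phi, th_left_add, th_left_add, phi]

theorem phi_right_add (a b : ℤ) (ξ z : ℂ) : phi N τ a (b + N) ξ z = phi N τ a b ξ z := by
  rw [phi, th_right_add, th_right_add, phi,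
    mul_div_mul_left _ _ (neg_ne_zero.2 (om_ne_zero _ _))]

theorem phi_fin_add (β γ : Fin N × Fin N) (ξ z : ℂ) :
    phi N τ ((β + γ).1 : ℕ) ((β + γ).2 : ℕ) ξ z = phi N τ (β.1 + γ.1) (β.2 + γ.2) ξ z := by
  rw [Prod.fst_add, Prod.snd_add, periodic_fin_add (N := N) (f := fun a => phi N τ a _ ξ z)
    (fun a => phi_left_add _ _ _ _), periodic_fin_add (N := N) (f := fun b => phi N τ _ b ξ z)
    (fun a => phi_right_add _ _ _ _)]

theorem phi_fin_neg (γ : Fin N × Fin N) (ξ z : ℂ) :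
    phi N τ ((-γ).1 : ℕ) ((-γ).2 : ℕ) ξ z = phi N τ (-γ.1) (-γ.2) ξ z := by
  rw [Prod.fst_neg, Prod.snd_neg, periodic_fin_neg (N := N) (f := fun a => phi N τ a _ ξ z)
    (fun a => phi_left_add _ _ _ _), periodic_fin_neg (N := N) (f := fun b => phi N τ _ b ξ z)
    (fun a => phi_right_add _ _ _ _)]

/-! ### The theta function identity behind unitarity, off the diagonal -/

/-- The sum `∑_β ω^{⟨β,γ⟩} φ_{β+γ}(ξ) φ_β(-ξ)` with `γ = (c, d)`. -/
noncomputable def unitSum (N : ℕ) (τ : ℂ) (c d : ℤ) (ξ z : ℂ) : ℂ :=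
  ∑ β : Fin N × Fin N, om N (d * β.1 - c * β.2) *
    (phi N τ (β.1 + c) (β.2 + d) ξ z * phi N τ β.1 β.2 (-ξ) z)

theorem unitSum_add_one (c d : ℤ) (ξ z : ℂ) :
    unitSum N τ c d ξ (z + 1) = om N c * unitSum N τ c d ξ z := by
  have h := sum_shift_right (N := N) (g := fun a b => om N (d * a - c * b) *
    (phi N τ (a + c) (b + d) ξ z * phi N τ a b (-ξ) z)) (fun a b => by
      rw [phi_right_add, add_right_comm, phi_right_add, show d * a - c * (b + N) =
        d * a - c * b + N * (-c) by ring, om_add_mul])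
  rw [unitSum, unitSum, ← h, Finset.mul_sum]
  refine Finset.sum_congr rfl fun β _ => ?_
  rw [phi_arg_add_one, phi_arg_add_one, ← mul_assoc (om N c), ← om_add]
  ring_nf

theorem unitSum_add_tau (c d : ℤ) (ξ z : ℂ) :
    unitSum N τ c d ξ (z + τ) = om N (-d) * unitSum N τ c d ξ z := by
  have h := sum_shift_left (N := N) (g := fun a b => om N (d * a - c * b) *
    (phi N τ (a + c) (b + d) ξ z * phi N τ a b (-ξ) z)) (fun a b => by
      rw [phi_left_add, add_right_comm, phi_left_add, show d * (a + N) - c * b =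
        d * a - c * b + N * d by ring, om_add_mul])
  rw [unitSum, unitSum, ← h, Finset.mul_sum]
  refine Finset.sum_congr rfl fun β _ => ?_
  have e : ex (-(2 / N * ξ)) * ex (-(2 / N * -ξ)) = 1 := by
    rw [← ex_add, ← ex_zero]; ring_nf
  have e2 : om N (d * (β.1 : ℕ) - c * (β.2 : ℕ)) =
      om N (-d) * om N (d * ((β.1 : ℕ) + 1) - c * (β.2 : ℕ)) := by rw [← om_add]; ring_nf
  rw [phi_arg_add_tau, phi_arg_add_tau, e2]
  rw [show (((β.1 : ℕ) : ℤ) + c + 1) = (β.1 : ℕ) + 1 + c by ring]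
  linear_combination om N (-d) * om N (d * ((β.1 : ℕ) + 1) - c * (β.2 : ℕ)) *
    phi N τ ((β.1 : ℕ) + 1 + c) ((β.2 : ℕ) + d) ξ z * phi N τ ((β.1 : ℕ) + 1) (β.2 : ℕ) (-ξ) z * e

/-- Off the diagonal the sum vanishes: as a function of `z` it is elliptic with a nontrivial
character, and its poles at the origin cancel by oddness. -/
theorem unitSum_eq_zero (hτ : 0 < τ.im) (γ : Fin N × Fin N) (hγ : γ ≠ 0) (ξ : ℂ) {z : ℂ}
    (hz : oddTheta τ z ≠ 0) : unitSum N τ (γ.1 : ℕ) (γ.2 : ℕ) ξ z = 0 := by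
  classical
  obtain ⟨C, hC, hprod⟩ := exists_thProd_eq (N := N) hτ
  set c : ℤ := ((γ.1 : ℕ) : ℤ) with hc
  set d : ℤ := ((γ.2 : ℕ) : ℤ) with hd
  let T : Fin N × Fin N → ℂ → ℂ := fun β v => th N τ (β.1 : ℕ) (β.2 : ℕ) v
  have hT : ∀ β, Differentiable ℂ (T β) := fun β => differentiable_th hτ _ _
  have hne : ∀ β : Fin N × Fin N, β + γ ≠ β := fun β h => hγ (by simpa using h)
  -- `A` is the sum multiplied by `∏_β ϑ_β(z/N)`, which clears all denominators
  let A : ℂ → ℂ := fun z => ∑ β : Fin N × Fin N, om N (d * (β.1 : ℕ) - c * (β.2 : ℕ)) *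
    (T (β + γ) (ξ + z / N) * T β (-ξ + z / N) *
      ∏ δ ∈ (Finset.univ.erase β).erase (β + γ), T δ (z / N))
  have hsplit : ∀ (β : Fin N × Fin N) (z : ℂ), thProd N τ z = T β (z / N) * (T (β + γ) (z / N) *
      ∏ δ ∈ (Finset.univ.erase β).erase (β + γ), T δ (z / N)) := by
    intro β z
    rw [Finset.mul_prod_erase _ (fun δ => T δ (z / N))
      (Finset.mem_erase.2 ⟨hne β, Finset.mem_univ _⟩),
      Finset.mul_prod_erase _ (fun δ => T δ (z / N)) (Finset.mem_univ _)]
    rfl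
  have hA : Differentiable ℂ A := by
    refine Differentiable.fun_sum fun β _ => Differentiable.const_mul ?_ _
    refine (((hT _).comp (by fun_prop)).mul ((hT _).comp (by fun_prop))).mul ?_
    exact Differentiable.fun_finsetProd fun δ _ => (hT δ).comp (by fun_prop)
  have hAU : ∀ z, oddTheta τ z ≠ 0 → A z = C * oddTheta τ z * unitSum N τ c d ξ z := by
    intro z hz
    rw [unitSum, Finset.mul_sum]
    refine Finset.sum_congr rfl fun β _ => ?_
    have h1 : T β (z / N) ≠ 0 := th_div_ne_zero hτ hz _ _
    have h2 : T (β + γ) (z / N) ≠ 0 := th_div_ne_zero hτ hz _ _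
    rw [← hprod, hsplit β z, ← phi_fin_add, phi, phi]
    change _ = _ * (_ * (T (β + γ) (ξ + z / N) / T (β + γ) (z / N) *
      (T β (-ξ + z / N) / T β (z / N))))
    field_simp
  have hA0 : A 0 = 0 := by
    -- at the origin only the terms `β = 0` and `β = -γ` do not vanish, and they are opposite
    have hγn : -γ ≠ 0 := neg_ne_zero.2 hγ
    have hT0 : T 0 0 = 0 := by
      change th N τ _ _ _ = _
      simp [th_zero_zero, oddTheta_zero]
    have g1 : T γ 0 ≠ 0 := th_zero_ne_zero hτ γ hγ
    have g2 : T (-γ) 0 ≠ 0 := th_zero_ne_zero hτ _ hγn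
    simp only [A]
    rw [Fintype.sum_eq_add 0 (-γ) hγn.symm]
    · have p1 : T γ 0 * ∏ δ ∈ (Finset.univ.erase 0).erase (0 + γ), T δ 0 =
          ∏ δ ∈ Finset.univ.erase 0, T δ 0 := by
        rw [zero_add]
        exact Finset.mul_prod_erase _ (fun δ => T δ 0) (Finset.mem_erase.2 ⟨hγ, Finset.mem_univ _⟩)
      have p2 : T (-γ) 0 * ∏ δ ∈ (Finset.univ.erase (-γ)).erase (-γ + γ), T δ 0 =
          ∏ δ ∈ Finset.univ.erase 0, T δ 0 := by
        rw [neg_add_cancel, Finset.erase_right_comm]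
        exact Finset.mul_prod_erase _ (fun δ => T δ 0) (Finset.mem_erase.2 ⟨hγn, Finset.mem_univ _⟩)
      have hphi : T (-γ) (-ξ) * T γ 0 = T γ ξ * T (-γ) 0 := by
        have h1 := phi_fin_neg (τ := τ) γ (-ξ) 0
        have h2 := phi_neg (N := N) (τ := τ) c d ξ 0
        rw [neg_zero] at h2
        rw [← hc, ← hd, h2, phi, phi, zero_div, add_zero, add_zero] at h1
        change T (-γ) (-ξ) / T (-γ) 0 = T γ ξ / T γ 0 at h1
        field_simp at h1
        linear_combination h1
      have hom : om N (d * ((-γ).1 : ℕ) - c * ((-γ).2 : ℕ)) = 1 := by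
        have e1 := periodic_fin_neg (N := N) (f := fun k => om N (d * k - c * ((-γ).2 : ℕ)))
          (fun k => by rw [show d * (k + N) - c * (((-γ).2 : ℕ) : ℤ) =
            d * k - c * (((-γ).2 : ℕ) : ℤ) + N * d by ring, om_add_mul]) γ.1
        have e2 := periodic_fin_neg (N := N) (f := fun k => om N (d * (-(γ.1 : ℕ)) - c * k))
          (fun k => by rw [show d * (-(γ.1 : ℕ)) - c * (k + N) =
            d * (-(γ.1 : ℕ)) - c * k + N * (-c) by ring, om_add_mul]) γ.2
        refine e1.trans (e2.trans ?_)
        rw [← hc, ← hd, show d * -c - c * -d = 0 by ring, om_zero]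
      have hodd : T 0 (-ξ) = -T 0 ξ := by
        change th N τ _ _ _ = -th N τ _ _ _
        simp [th_zero_zero, oddTheta_neg]
      have hom0 : om N (d * ((0 : Fin N × Fin N).1 : ℕ) - c * ((0 : Fin N × Fin N).2 : ℕ)) = 1 := by
        simp [om_zero]
      rw [hom, hom0]
      simp only [zero_add, neg_add_cancel, zero_div, add_zero] at p1 p2 ⊢
      rw [hodd]
      apply mul_right_cancel₀ (mul_ne_zero g1 g2)
      linear_combination (-T γ ξ * T 0 ξ * T (-γ) 0) * p1 + (T 0 ξ * T (-γ) (-ξ) * T γ 0) * p2 +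
        (T 0 ξ * ∏ δ ∈ Finset.univ.erase 0, T δ 0) * hphi
    · rintro β ⟨hβ0, hβ1⟩
      have : (0 : Fin N × Fin N) ∈ (Finset.univ.erase β).erase (β + γ) := by
        refine Finset.mem_erase.2 ⟨fun h => hβ1 (eq_neg_of_add_eq_zero_left h.symm),
          Finset.mem_erase.2 ⟨hβ0.symm, Finset.mem_univ _⟩⟩
      rw [Finset.prod_eq_zero this (by rw [zero_div]; exact hT0)]
      ring
  have hAz : A z = 0 := by
    refine eq_zero_of_nontrivial_character hτ (μ₁ := -om N c) (μ₂ := -om N (-d)) hA hA0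
      (by rw [norm_neg, norm_om]) (by rw [norm_neg, norm_om]) (fun z hz => ?_) (fun z hz => ?_) ?_ z
    · have hz1 : oddTheta τ (z + 1) ≠ 0 := by rw [oddTheta_add_one]; exact neg_ne_zero.2 hz
      rw [hAU _ hz1, hAU _ hz, oddTheta_add_one, unitSum_add_one]
      ring
    · have hz1 : oddTheta τ (z + τ) ≠ 0 := by
        rw [oddTheta_add_tau]; exact mul_ne_zero (neg_ne_zero.2 (ex_ne_zero _)) hz
      rw [hAU _ hz1, hAU _ hz, oddTheta_add_tau, unitSum_add_tau]
      ring
    · by_contra! h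
      have h1 := (om_eq_one_iff c).1 (neg_injective h.1)
      have h2 := (om_eq_one_iff (-d)).1 (neg_injective h.2)
      apply hγ
      have f1 := Nat.eq_zero_of_dvd_of_lt (Int.natCast_dvd_natCast.1 h1) γ.1.2
      have f2 := Nat.eq_zero_of_dvd_of_lt (Int.natCast_dvd_natCast.1 (Int.dvd_neg.1 h2)) γ.2.2
      exact Prod.ext (Fin.ext (by simpa using f1)) (Fin.ext (by simpa using f2))
  rw [hAU z hz] at hAz
  exact (mul_eq_zero.1 hAz).resolve_left (mul_ne_zero hC hz)

end Phi

/-! ### The theta function identity behind unitarity, on the diagonal -/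

section Diagonal

variable {τ : ℂ}

theorem oddTheta_sub_one (τ v : ℂ) : oddTheta τ (v - 1) = -oddTheta τ v := by
  have := oddTheta_add_one τ (v - 1)
  rw [sub_add_cancel] at this
  rw [this, neg_neg]

theorem oddTheta_sub_tau (τ v : ℂ) : oddTheta τ (v - τ) = -ex (-τ + 2 * v) * oddTheta τ v := by
  have := oddTheta_add_tau τ (v - τ)
  rw [sub_add_cancel] at this
  rw [this, show -τ - 2 * (v - τ) = -(-τ + 2 * v) by ring, ex_neg (-τ + 2 * v)]
  rw [neg_mul, neg_mul, mul_neg, neg_neg, mul_inv_cancel_left₀ (ex_ne_zero _)]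

theorem oddTheta_add_one_ne_zero {v : ℂ} (hv : oddTheta τ v ≠ 0) : oddTheta τ (v + 1) ≠ 0 := by
  rw [oddTheta_add_one]; exact neg_ne_zero.2 hv

theorem oddTheta_add_tau_ne_zero {v : ℂ} (hv : oddTheta τ v ≠ 0) : oddTheta τ (v + τ) ≠ 0 := by
  rw [oddTheta_add_tau]; exact mul_ne_zero (neg_ne_zero.2 (ex_ne_zero _)) hv

/-- The ratio `f(u + ξ) f(u - ξ) / f(u)²`, as a function of `ξ`. -/
noncomputable def reflectRatio (f : ℂ → ℂ) (u ξ : ℂ) : ℂ := f (u + ξ) * f (u - ξ) / f u ^ 2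

theorem differentiable_reflectRatio {f : ℂ → ℂ} (hf : Differentiable ℂ f) (u : ℂ) :
    Differentiable ℂ (reflectRatio f u) :=
  ((hf.comp (by fun_prop)).mul (hf.comp (by fun_prop))).div_const _

theorem reflectRatio_zero {f : ℂ → ℂ} {u : ℂ} (hu : f u ≠ 0) : reflectRatio f u 0 = 1 := by
  rw [reflectRatio, add_zero, sub_zero]
  field_simp

theorem reflectRatio_neg (f : ℂ → ℂ) (u ξ : ℂ) : reflectRatio f u (-ξ) = reflectRatio f u ξ := by
  rw [reflectRatio, reflectRatio, sub_neg_eq_add, ← sub_eq_add_neg, mul_comm]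

/-- The second derivative at the origin of `f(u + ξ) f(u - ξ) / f(u)²` is twice that of `log f` at
the point `u`. -/
theorem hasDerivAt_deriv_reflectRatio {f : ℂ → ℂ} (hf : Differentiable ℂ f) {u : ℂ}
    (hu : f u ≠ 0) :
    HasDerivAt (deriv (reflectRatio f u)) (2 * deriv (logDeriv f) u) 0 := by
  have hf' : Differentiable ℂ (deriv f) := fun z =>
    (hf.differentiableOn.deriv isOpen_univ).differentiableAt univ_mem
  have hadd : ∀ {g : ℂ → ℂ}, Differentiable ℂ g → ∀ ξ,
      HasDerivAt (fun ξ => g (u + ξ)) (deriv g (u + ξ)) ξ := fun hg ξ => by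
    simpa using (hg (u + ξ)).hasDerivAt.comp_const_add u ξ
  have hsub : ∀ {g : ℂ → ℂ}, Differentiable ℂ g → ∀ ξ,
      HasDerivAt (fun ξ => g (u - ξ)) (-deriv g (u - ξ)) ξ := fun hg ξ => by
    simpa using (hg (u - ξ)).hasDerivAt.comp_const_sub u ξ
  have h1 : deriv (reflectRatio f u) = fun ξ =>
      (deriv f (u + ξ) * f (u - ξ) + f (u + ξ) * -deriv f (u - ξ)) / f u ^ 2 := by
    funext ξ
    exact (((hadd hf ξ).mul (hsub hf ξ)).div_const _).deriv
  have h2 : deriv (logDeriv f) u = (deriv (deriv f) u * f u - deriv f u * deriv f u) / f u ^ 2 :=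
    ((hf' u).hasDerivAt.div (hf u).hasDerivAt hu).deriv
  rw [h1, h2]
  have h3 := ((((hadd hf' 0).mul (hsub hf 0)).add
    ((hadd hf 0).mul (hsub hf' 0).fun_neg)).div_const (f u ^ 2))
  refine h3.congr_deriv ?_
  simp only [add_zero, sub_zero]
  ring

variable {N : ℕ} [NeZero N]

/-- The logarithmic derivative of the product formula `∏_β ϑ_β(z/N) = C ϑ(z)`. -/
theorem sum_logDeriv_th (hτ : 0 < τ.im) {z : ℂ} (hz : oddTheta τ z ≠ 0) :
    ∑ β : Fin N × Fin N, logDeriv (th N τ (β.1 : ℕ) (β.2 : ℕ)) (z / N) =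
      N * logDeriv (oddTheta τ) z := by
  have hN : (N : ℂ) ≠ 0 := NeZero.ne _
  obtain ⟨C, hC, hprod⟩ := exists_thProd_eq (N := N) hτ
  have hdiv : ∀ z : ℂ, HasDerivAt (fun z : ℂ => z / N) (1 / N) z := fun z =>
    (hasDerivAt_id z).div_const _
  have h1 : logDeriv (thProd N τ) z = logDeriv (oddTheta τ) z := by
    rw [funext hprod, logDeriv_const_mul z C hC]
  have h2 : logDeriv (thProd N τ) z =
      ∑ β : Fin N × Fin N, logDeriv (th N τ (β.1 : ℕ) (β.2 : ℕ)) (z / N) * (1 / N) := by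
    have h3 := logDeriv_prod (s := Finset.univ)
      (f := fun (β : Fin N × Fin N) z => th N τ (β.1 : ℕ) (β.2 : ℕ) (z / N)) (x := z)
      (fun β _ => th_div_ne_zero hτ hz _ _)
      (fun β _ => ((differentiable_th hτ _ _) _).comp z (hdiv z).differentiableAt)
    have h4 : thProd N τ = ∏ β : Fin N × Fin N, fun z => th N τ (β.1 : ℕ) (β.2 : ℕ) (z / N) := by
      funext z; simp [thProd]
    rw [h4]
    simp only [Finset.prod_fn] at h3 ⊢
    rw [h3]
    refine Finset.sum_congr rfl fun β _ => ?_
    have := logDeriv_comp (f := th N τ (β.1 : ℕ) (β.2 : ℕ)) (g := fun z : ℂ => z / N) (x := z)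
      ((differentiable_th hτ _ _) _) (hdiv z).differentiableAt
    rw [(hdiv z).deriv] at this
    exact this
  rw [← h1, h2, ← Finset.sum_mul]
  field_simp

theorem differentiableAt_logDeriv {f : ℂ → ℂ} (hf : Differentiable ℂ f) {u : ℂ} (hu : f u ≠ 0) :
    DifferentiableAt ℂ (logDeriv f) u :=
  ((hf.differentiableOn.deriv isOpen_univ).differentiableAt univ_mem).div (hf u) hu

theorem sum_deriv_logDeriv_th (hτ : 0 < τ.im) {z : ℂ} (hz : oddTheta τ z ≠ 0) :
    ∑ β : Fin N × Fin N, deriv (logDeriv (th N τ (β.1 : ℕ) (β.2 : ℕ))) (z / N) =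
      N ^ 2 * deriv (logDeriv (oddTheta τ)) z := by
  have hN : (N : ℂ) ≠ 0 := NeZero.ne _
  have hs := differentiable_oddTheta hτ
  have hL : HasDerivAt (fun w : ℂ => ∑ β : Fin N × Fin N,
      logDeriv (th N τ (β.1 : ℕ) (β.2 : ℕ)) (w / N))
      (∑ β : Fin N × Fin N, deriv (logDeriv (th N τ (β.1 : ℕ) (β.2 : ℕ))) (z / N) * (1 / N)) z :=
    HasDerivAt.fun_sum fun β _ => HasDerivAt.comp z
      (differentiableAt_logDeriv (differentiable_th hτ _ _)
        (th_div_ne_zero hτ hz _ _)).hasDerivAt ((hasDerivAt_id z).div_const _)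
  have hR : HasDerivAt (fun w : ℂ => N * logDeriv (oddTheta τ) w)
      (N * deriv (logDeriv (oddTheta τ)) z) z :=
    (differentiableAt_logDeriv hs hz).hasDerivAt.const_mul _
  have hLR := hL.congr_of_eventuallyEq
    (((hs z).continuousAt.eventually_ne hz).mono fun w hw => (sum_logDeriv_th hτ hw).symm)
  have := hLR.unique hR
  rw [← Finset.sum_mul] at this
  field_simp at this
  linear_combination this

/-- The diagonal sum behind unitarity. Both sides are even theta functions of order two in `ξ` that
agree to second order at the origin, so they can only differ by a multiple of `ϑ(ξ)²`; the second
derivatives at the origin are compared by means of the product formula. -/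
theorem sum_phi_mul_phi_neg (hτ : 0 < τ.im) (ξ : ℂ) {z : ℂ} (hz : oddTheta τ z ≠ 0) :
    ∑ β : Fin N × Fin N, phi N τ (β.1 : ℕ) (β.2 : ℕ) ξ z * phi N τ (β.1 : ℕ) (β.2 : ℕ) (-ξ) z =
      N ^ 2 * (oddTheta τ (z + ξ) * oddTheta τ (z - ξ) / oddTheta τ z ^ 2) := by
  have hN : (N : ℂ) ≠ 0 := NeZero.ne _
  have hs := differentiable_oddTheta hτ
  set E : Fin N × Fin N → ℂ → ℂ := fun β => reflectRatio (th N τ (β.1 : ℕ) (β.2 : ℕ)) (z / N)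
    with hEdef
  set E₀ : ℂ → ℂ := reflectRatio (oddTheta τ) z with hE₀def
  have hE : ∀ β ξ, E β ξ =
      phi N τ (β.1 : ℕ) (β.2 : ℕ) ξ z * phi N τ (β.1 : ℕ) (β.2 : ℕ) (-ξ) z := by
    intro β ξ
    simp only [E, phi, reflectRatio]
    rw [div_mul_div_comm, ← sq, add_comm ξ, neg_add_eq_sub]
  obtain ⟨G, hG⟩ : ∃ G : ℂ → ℂ, G = fun ξ => ∑ β, E β ξ - N ^ 2 * E₀ ξ := ⟨_, rfl⟩
  have dE : ∀ β, Differentiable ℂ (E β) := fun β =>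
    differentiable_reflectRatio (differentiable_th hτ _ _) _
  have dE₀ : Differentiable ℂ E₀ := differentiable_reflectRatio hs z
  have dG : Differentiable ℂ G := by
    rw [hG]
    exact (Differentiable.fun_sum fun β _ => dE β).sub (dE₀.const_mul _)
  have hG0 : G 0 = 0 := by
    have h1 : ∀ β, E β 0 = 1 := fun β => reflectRatio_zero (th_div_ne_zero hτ hz _ _)
    have h2 : E₀ 0 = 1 := reflectRatio_zero hz
    simp only [hG, h1, h2]
    simp [sq]
  have hGeven : ∀ ξ, G (-ξ) = G ξ := by
    intro ξ
    simp only [hG, E, E₀, reflectRatio_neg]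
  have hG1 : ∀ ξ, G (ξ + 1) = G ξ := by
    intro ξ
    have e1 : ∀ β, E β (ξ + 1) = E β ξ := fun β => by
      rw [hE, hE, phi_add_one, show -(ξ + 1) = -ξ - 1 by ring, phi_sub_one, om_neg]
      have := om_ne_zero N (β.1 : ℕ)
      field_simp
    have e2 : E₀ (ξ + 1) = E₀ ξ := by
      simp only [E₀, reflectRatio]
      rw [← add_assoc, oddTheta_add_one, show z - (ξ + 1) = z - ξ - 1 by ring, oddTheta_sub_one]
      ring
    simp only [hG, e1, e2]
  have hG2 : ∀ ξ, G (ξ + τ) = ex (-τ - 2 * ξ) ^ 2 * G ξ := by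
    intro ξ
    have e1 : ∀ β, E β (ξ + τ) = ex (-τ - 2 * ξ) ^ 2 * E β ξ := fun β => by
      rw [hE, hE, phi_add_tau, show -(ξ + τ) = -ξ - τ by ring, phi_sub_tau, om_neg]
      have := om_ne_zero N (β.2 : ℕ)
      have e3 : ex (-τ - 2 * (ξ + z / N)) * ex (-τ + 2 * (-ξ + z / N)) = ex (-τ - 2 * ξ) ^ 2 := by
        rw [← ex_add, ← ex_two_mul]; ring_nf
      rw [← e3]
      field_simp
    have e2 : E₀ (ξ + τ) = ex (-τ - 2 * ξ) ^ 2 * E₀ ξ := by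
      simp only [E₀, reflectRatio]
      rw [← add_assoc, oddTheta_add_tau, show z - (ξ + τ) = z - ξ - τ by ring, oddTheta_sub_tau]
      have e3 : ex (-τ - 2 * (z + ξ)) * ex (-τ + 2 * (z - ξ)) = ex (-τ - 2 * ξ) ^ 2 := by
        rw [← ex_add, ← ex_two_mul]; ring_nf
      rw [← e3]
      ring
    simp only [hG, e1, e2, ← Finset.mul_sum]
    ring
  obtain ⟨H, dH, hH⟩ := exists_entire_quotient dG hs (fun ξ h => by
      obtain ⟨m, n, rfl⟩ := (oddTheta_eq_zero_iff hτ ξ).1 h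
      refine lattice_induction (P := fun ξ => G ξ = 0) hG0 (fun ξ => by rw [hG1]) (fun ξ => ?_) m n
      rw [hG2, mul_eq_zero, or_iff_right (pow_ne_zero 2 (ex_ne_zero _))]) (oddTheta_simple hτ)
  have hs0 : deriv (oddTheta τ) 0 ≠ 0 := oddTheta_simple hτ 0 (oddTheta_zero τ)
  have hH0 : H 0 = 0 := by
    have h1 : HasDerivAt G (deriv H 0 * oddTheta τ 0 + H 0 * deriv (oddTheta τ) 0) 0 := by
      rw [funext hH]; exact (dH 0).hasDerivAt.mul (hs 0).hasDerivAt
    have h2 : deriv G 0 = 0 := by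
      have h3 := deriv_comp_neg G 0
      rw [funext hGeven, neg_zero] at h3
      linear_combination (1 / 2 : ℂ) * h3
    rw [h1.deriv, oddTheta_zero, mul_zero, zero_add] at h2
    exact (mul_eq_zero.1 h2).resolve_right hs0
  obtain ⟨k, hk⟩ := exists_eq_const_mul_oddTheta hτ (μ₁ := -1) (μ₂ := -1) dH hH0 (by simp) (by simp)
    (fun ξ h => by
      have := hG1 ξ
      rw [hH, hH, oddTheta_add_one] at this
      apply mul_right_cancel₀ h
      linear_combination -this)
    (fun ξ h => by
      have := hG2 ξ
      rw [hH, hH, oddTheta_add_tau] at this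
      apply mul_right_cancel₀ h
      apply mul_left_cancel₀ (ex_ne_zero (-τ - 2 * ξ))
      linear_combination -this)
  have hGk : G = fun ξ => k * (oddTheta τ ξ * oddTheta τ ξ) := by
    funext ξ; rw [hH, hk]; ring
  have hd1 : HasDerivAt (deriv G) (k * (2 * deriv (oddTheta τ) 0 ^ 2)) 0 := by
    have hs' : DifferentiableAt ℂ (deriv (oddTheta τ)) 0 :=
      (hs.differentiableOn.deriv isOpen_univ).differentiableAt univ_mem
    have h1 : deriv G = fun ξ => k * (deriv (oddTheta τ) ξ * oddTheta τ ξ +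
        oddTheta τ ξ * deriv (oddTheta τ) ξ) := by
      rw [hGk]; funext ξ
      exact (((hs ξ).hasDerivAt.mul (hs ξ).hasDerivAt).const_mul k).deriv
    rw [h1]
    refine (((hs'.hasDerivAt.mul (hs 0).hasDerivAt).add
      ((hs 0).hasDerivAt.mul hs'.hasDerivAt)).const_mul k).congr_deriv ?_
    rw [oddTheta_zero]; ring
  have hd2 : HasDerivAt (deriv G) 0 0 := by
    have h1 : deriv G = fun ξ => ∑ β, deriv (E β) ξ - N ^ 2 * deriv E₀ ξ := by
      funext ξ
      rw [hG]
      exact ((HasDerivAt.fun_sum fun β _ => (dE β ξ).hasDerivAt).sub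
        ((dE₀ ξ).hasDerivAt.const_mul _)).deriv
    have h2 : HasDerivAt (fun ξ => ∑ β, deriv (E β) ξ)
        (∑ β : Fin N × Fin N, 2 * deriv (logDeriv (th N τ (β.1 : ℕ) (β.2 : ℕ))) (z / N)) 0 :=
      HasDerivAt.fun_sum fun β _ => hasDerivAt_deriv_reflectRatio (differentiable_th hτ _ _)
        (th_div_ne_zero hτ hz _ _)
    rw [h1]
    refine (h2.sub ((hasDerivAt_deriv_reflectRatio hs hz).const_mul ((N : ℂ) ^ 2))).congr_deriv ?_
    rw [← Finset.mul_sum, sum_deriv_logDeriv_th hτ hz]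
    ring
  have hk0 : k = 0 := by
    have := hd1.unique hd2
    simpa [hs0] using this
  have hfin : G ξ = 0 := by rw [hGk, hk0]; simp
  simp only [hG, sub_eq_zero, hE] at hfin
  exact hfin

end Diagonal

/-! ### The theta function identities behind crossing -/

theorem thetaChar_add_lattice (γ₁ γ₂ ξ τ : ℂ) (m n : ℤ) :
    thetaChar γ₁ γ₂ (ξ + (m + n * τ)) τ =
      ex (2 * γ₁ * m - n ^ 2 * τ - 2 * n * (ξ + γ₂)) * thetaChar γ₁ γ₂ ξ τ := by
  have hp : Function.Periodic (fun γ : ℂ => thetaChar γ γ₂ ξ τ) 1 :=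
    fun γ => thetaChar_left_add_one γ γ₂ ξ τ
  have h1 : thetaChar (γ₁ + n) γ₂ ξ τ = thetaChar γ₁ γ₂ ξ τ := by
    simpa using hp.int_mul n γ₁
  have h2 : ∀ ξ, thetaChar γ₁ γ₂ (ξ + m) τ = ex (2 * γ₁ * m) * thetaChar γ₁ γ₂ ξ τ := by
    intro ξ
    rw [thetaChar_eq_tsum, thetaChar_eq_tsum, ← tsum_mul_left]
    refine tsum_congr fun k => ?_
    rw [← ex_add, ex_eq_ex_iff]
    exact ⟨k * m, by push_cast; ring⟩
  rw [show ξ + (m + n * τ) = ξ + n * τ + m by ring, h2, thetaChar_add_mul, h1, ← mul_assoc, ← ex_add]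
  ring_nf

theorem oddTheta_add_lattice (τ v : ℂ) (m n : ℤ) : oddTheta τ (v + (m + n * τ)) =
    ex (m - n - n ^ 2 * τ - 2 * n * v) * oddTheta τ v := by
  rw [oddTheta, thetaChar_add_lattice, oddTheta]
  ring_nf

theorem th_add_lattice (N : ℕ) (τ v : ℂ) (a b m n : ℤ) : th N τ a b (v + (m + n * τ)) =
    ex (m - n - n ^ 2 * τ - 2 * n * v) * om N (a * m - b * n) * th N τ a b v := by
  rw [th, thetaChar_add_lattice, th, om, ← ex_add]
  push_cast
  ring_nf

theorem phi_add_lattice (N : ℕ) (τ ξ z : ℂ) (a b m n : ℤ) : phi N τ a b (ξ + (m + n * τ)) z =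
    ex (m - n - n ^ 2 * τ - 2 * n * (ξ + z / N)) * om N (a * m - b * n) * phi N τ a b ξ z := by
  rw [phi, add_right_comm, th_add_lattice, phi, mul_div_assoc]

section Crossing

variable {τ : ℂ}

theorem eventually_oddTheta_ne_zero (hτ : 0 < τ.im) (v₀ : ℂ) :
    ∀ᶠ v in 𝓝[≠] v₀, oddTheta τ v ≠ 0 := by
  have hs := differentiable_oddTheta hτ
  by_cases h : oddTheta τ v₀ = 0
  · exact (hs v₀).hasDerivAt.eventually_ne (oddTheta_simple hτ v₀ h)
  · exact ((hs v₀).continuousAt.eventually_ne h).filter_mono nhdsWithin_le_nhds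

theorem exists_oddTheta_ne_zero_pair (hτ : 0 < τ.im) (w : ℂ) :
    ∃ v, oddTheta τ v ≠ 0 ∧ oddTheta τ (v + w) ≠ 0 := by
  have h2 : Tendsto (fun v => v + w) (𝓝[≠] 0) (𝓝[≠] (0 + w)) :=
    tendsto_nhdsWithin_of_tendsto_nhds_of_eventually_within _
      ((continuous_id.add continuous_const).continuousAt.mono_left nhdsWithin_le_nhds)
      (eventually_nhdsWithin_of_forall fun v hv => by simpa using hv)
  exact ((eventually_oddTheta_ne_zero hτ 0).and
    (h2.eventually (eventually_oddTheta_ne_zero hτ (0 + w)))).exists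

variable {N : ℕ}

theorem oddTheta_ne_zero_of_mul (hτ : 0 < τ.im) {z : ℂ} (h : oddTheta τ (N * z) ≠ 0) :
    oddTheta τ z ≠ 0 := by
  intro hz
  obtain ⟨m, n, rfl⟩ := (oddTheta_eq_zero_iff hτ z).1 hz
  exact h ((oddTheta_eq_zero_iff hτ _).2 ⟨N * m, N * n, by push_cast; ring⟩)

/-- The product of the theta functions at all torsion points but `β`. -/
noncomputable def thErase (N : ℕ) (τ : ℂ) (β : Fin N × Fin N) (z : ℂ) : ℂ :=
  ∏ δ ∈ Finset.univ.erase β, th N τ (δ.1 : ℕ) (δ.2 : ℕ) (z / N)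

theorem differentiable_thErase (hτ : 0 < τ.im) (β : Fin N × Fin N) :
    Differentiable ℂ (thErase N τ β) := by
  unfold thErase
  exact Differentiable.fun_finsetProd fun δ _ => (differentiable_th hτ _ _).comp (by fun_prop)

theorem th_mul_thErase (β : Fin N × Fin N) (z : ℂ) :
    th N τ (β.1 : ℕ) (β.2 : ℕ) (z / N) * thErase N τ β z = thProd N τ z :=
  Finset.mul_prod_erase _ (fun δ : Fin N × Fin N => th N τ (δ.1 : ℕ) (δ.2 : ℕ) (z / N))
    (Finset.mem_univ _)

/-- The sum `∑_β φ_{β+γ}(ξ) φ_β(-ξ - Nz)` with `γ = (c, d)`. -/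
noncomputable def crossSum (N : ℕ) (τ : ℂ) (c d : ℤ) (ξ z : ℂ) : ℂ :=
  ∑ β : Fin N × Fin N, phi N τ (β.1 + c) (β.2 + d) ξ z * phi N τ β.1 β.2 (-ξ - N * z) z

theorem crossSum_add_lattice (c d : ℤ) (ξ z : ℂ) (m n : ℤ) :
    crossSum N τ c d (ξ + (m + n * τ)) z = ex (-(2 * n ^ 2 * τ) - 2 * n * (2 * ξ + N * z)) *
      om N (c * m - d * n) * crossSum N τ c d ξ z := by
  rw [crossSum, crossSum, Finset.mul_sum]
  refine Finset.sum_congr rfl fun β _ => ?_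
  have h2 := phi_add_lattice N τ (-ξ - N * z) z (β.1 : ℕ) (β.2 : ℕ) (-m) (-n)
  rw [show -(ξ + (m + n * τ)) - N * z = -ξ - N * z + (((-m : ℤ) : ℂ) + ((-n : ℤ) : ℂ) * τ) by
    push_cast; ring, h2, phi_add_lattice]
  have e1 : om N (c * m - d * n) = om N ((((β.1 : ℕ) : ℤ) + c) * m - ((β.2 : ℕ) + d) * n) *
      om N (((β.1 : ℕ) : ℤ) * -m - (β.2 : ℕ) * -n) := by rw [← om_add]; ring_nf
  have e2 : ex (-(2 * n ^ 2 * τ) - 2 * n * (2 * ξ + N * z)) =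
      ex (m - n - n ^ 2 * τ - 2 * n * (ξ + z / N)) * ex (((-m : ℤ) : ℂ) - ((-n : ℤ) : ℂ) -
        ((-n : ℤ) : ℂ) ^ 2 * τ - 2 * ((-n : ℤ) : ℂ) * (-ξ - N * z + z / N)) := by
    rw [← ex_add]; push_cast; ring_nf
  rw [e1, e2]
  ring

theorem differentiable_crossSum (hτ : 0 < τ.im) (c d : ℤ) (z : ℂ) :
    Differentiable ℂ fun ξ => crossSum N τ c d ξ z := by
  unfold crossSum
  refine Differentiable.fun_sum fun β _ => (differentiable_phi hτ _ _ z).mul ?_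
  exact (differentiable_phi hτ _ _ z).comp (f := fun ξ => -ξ - N * z) (by fun_prop)

variable [NeZero N]

theorem thErase_zero {β : Fin N × Fin N} (hβ : β ≠ 0) : thErase N τ β 0 = 0 :=
  Finset.prod_eq_zero (Finset.mem_erase.2 ⟨hβ.symm, Finset.mem_univ (0 : Fin N × Fin N)⟩)
    (by simp [th_zero_zero, oddTheta_zero])

theorem thErase_zero_zero (hτ : 0 < τ.im) {C : ℂ} (hC : ∀ z, thProd N τ z = C * oddTheta τ z) :
    thErase N τ 0 0 = N * C := by
  have hN : (N : ℂ) ≠ 0 := NeZero.ne _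
  have hs := differentiable_oddTheta hτ
  have hs0 : deriv (oddTheta τ) 0 ≠ 0 := oddTheta_simple hτ 0 (oddTheta_zero τ)
  have h0 : HasDerivAt (fun z : ℂ => oddTheta τ (z / N)) (deriv (oddTheta τ) 0 * (1 / N)) 0 := by
    have := HasDerivAt.comp (0 : ℂ) (h := fun z : ℂ => z / N) (h₂ := oddTheta τ)
      (hs _).hasDerivAt ((hasDerivAt_id _).div_const (N : ℂ))
    simpa [Function.comp_def] using this
  have h1 : HasDerivAt (fun z => C * oddTheta τ z) (C * deriv (oddTheta τ) 0) 0 := (hs 0).hasDerivAt.const_mul C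
  have h2 := h0.mul ((differentiable_thErase (N := N) hτ 0) 0).hasDerivAt
  have h3 : ((fun z : ℂ => oddTheta τ (z / N)) * thErase N τ 0) = fun z => C * oddTheta τ z := by
    funext z
    rw [← hC, ← th_mul_thErase 0 z]
    simp [th_zero_zero]
  rw [h3] at h2
  have := h2.unique h1
  simp only [zero_div, oddTheta_zero, zero_mul, add_zero] at this
  field_simp at this
  exact this

/-- The sum `∑_β φ_β(-Nz, z)`, evaluated at the crossing point. -/
noncomputable def crossPoint (N : ℕ) (τ z : ℂ) : ℂ :=
  ∑ β : Fin N × Fin N, phi N τ (β.1 : ℕ) (β.2 : ℕ) (-(N * z)) z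

theorem crossPoint_add_one (z : ℂ) : crossPoint N τ (z + 1) = ex (-N) * crossPoint N τ z := by
  rw [crossPoint, crossPoint, ← sum_shift_right (N := N)
    (g := fun a b => phi N τ a b (-(N * z)) z) (fun a b => phi_right_add _ _ _ _), Finset.mul_sum]
  refine Finset.sum_congr rfl fun β _ => ?_
  have := phi_add_lattice N τ (-(N * z)) z (β.1 : ℕ) ((β.2 : ℕ) + 1) (-N) 0
  have h2 : om N (((β.1 : ℕ) : ℤ) * -N - ((β.2 : ℕ) + 1) * 0) = 1 :=
    (om_eq_one_iff _).2 ⟨-(β.1 : ℕ), by ring⟩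
  rw [h2] at this
  rw [phi_arg_add_one, show -(N * (z + 1)) = -(N * z) + (((-N : ℤ) : ℂ) + ((0 : ℤ) : ℂ) * τ) by
    push_cast; ring, this]
  push_cast
  ring_nf

theorem crossPoint_add_tau (z : ℂ) : crossPoint N τ (z + τ) =
    ex (2 * τ + 4 * z + N - N ^ 2 * τ - 2 * N ^ 2 * z) * crossPoint N τ z := by
  have hN : (N : ℂ) ≠ 0 := NeZero.ne _
  rw [crossPoint, crossPoint, ← sum_shift_left (N := N)
    (g := fun a b => phi N τ a b (-(N * z)) z) (fun a b => phi_left_add _ _ _ _), Finset.mul_sum]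
  refine Finset.sum_congr rfl fun β _ => ?_
  have := phi_add_lattice N τ (-(N * z)) z ((β.1 : ℕ) + 1) (β.2 : ℕ) 0 (-N)
  have h2 : om N ((((β.1 : ℕ) : ℤ) + 1) * 0 - (β.2 : ℕ) * -N) = 1 :=
    (om_eq_one_iff _).2 ⟨(β.2 : ℕ), by ring⟩
  rw [h2] at this
  rw [phi_arg_add_tau, show -(N * (z + τ)) = -(N * z) + (((0 : ℤ) : ℂ) + ((-N : ℤ) : ℂ) * τ) by
    push_cast; ring, this, mul_one, ← mul_assoc, ← ex_add]
  congr 2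
  push_cast
  field_simp
  ring

/-- The sum vanishes: in the variable `v = Nz` it has more zeros, namely at the points of the finer
lattice, than its degree allows. -/
theorem crossPoint_eq_zero (hτ : 0 < τ.im) {z : ℂ} (hz : oddTheta τ z ≠ 0) :
    crossPoint N τ z = 0 := by
  have hN : (N : ℂ) ≠ 0 := NeZero.ne _
  have hs := differentiable_oddTheta hτ
  obtain ⟨C, hC, hprod⟩ := exists_thProd_eq (N := N) hτ
  let A : ℂ → ℂ := fun z => ∑ β : Fin N × Fin N,
    th N τ (β.1 : ℕ) (β.2 : ℕ) (-(N * z) + z / N) * thErase N τ β z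
  have hA : Differentiable ℂ A := Differentiable.fun_sum fun β _ =>
    ((differentiable_th hτ _ _).comp (by fun_prop)).mul (differentiable_thErase hτ β)
  have hAS : ∀ z, oddTheta τ z ≠ 0 → A z = C * oddTheta τ z * crossPoint N τ z := by
    intro z hz
    rw [crossPoint, Finset.mul_sum]
    refine Finset.sum_congr rfl fun β _ => ?_
    have h1 := th_div_ne_zero (N := N) hτ hz (β.1 : ℕ) (β.2 : ℕ)
    rw [← hprod, ← th_mul_thErase β z, phi]
    field_simp
  have hA0 : A 0 = 0 := Finset.sum_eq_zero fun β _ => by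
    by_cases hβ : β = 0
    · subst hβ
      simp [th_zero_zero, oddTheta_zero]
    · rw [thErase_zero hβ, mul_zero]
  let D : ℂ → ℂ := fun v => A (v / N) * oddTheta τ (v / N)
  have hD : Differentiable ℂ D := (hA.comp (by fun_prop)).mul (hs.comp (by fun_prop))
  have hdiv : ∀ v, oddTheta τ v ≠ 0 → oddTheta τ (v / N) ≠ 0 := fun v hv =>
    oddTheta_ne_zero_of_mul (N := N) hτ (by rwa [mul_div_cancel₀ _ hN])
  obtain ⟨K, hK⟩ := exists_eq_const_mul hτ (L := N) (by exact_mod_cast NeZero.pos N) hD hs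
    (fun v hv => by
      by_cases hv' : oddTheta τ (v / N) = 0
      · simp only [D, hv', mul_zero]
      obtain ⟨m, n, rfl⟩ := (oddTheta_eq_zero_iff hτ v).1 hv
      have hS : crossPoint N τ ((m + n * τ) / N) = 0 := by
        have hmn : ¬ ((N : ℤ) ∣ -n ∧ (N : ℤ) ∣ -m) := by
          rintro ⟨h2, h1⟩
          obtain ⟨m', rfl⟩ := Int.dvd_neg.1 h1
          obtain ⟨n', rfl⟩ := Int.dvd_neg.1 h2
          apply hv'
          rw [oddTheta_eq_zero_iff hτ]
          exact ⟨m', n', by push_cast; field_simp⟩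
        have h0 := sum_om_pair (N := N) hmn
        rw [crossPoint]
        calc _ = ∑ β : Fin N × Fin N, ex ((-m : ℤ) - (-n : ℤ) - (-n : ℤ) ^ 2 * τ -
              2 * (-n : ℤ) * (0 + (m + n * τ) / N / N)) *
              om N (-m * (β.1 : ℕ) - -n * (β.2 : ℕ)) := by
              refine Finset.sum_congr rfl fun β _ => ?_
              have h1 := phi_add_lattice N τ 0 ((m + n * τ) / N) (β.1 : ℕ) (β.2 : ℕ) (-m) (-n)
              rw [phi_zero (th_div_ne_zero hτ hv' _ _), mul_one] at h1
              rw [mul_comm (-m), mul_comm (-n), ← h1]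
              congr 1
              push_cast
              field_simp
              ring
          _ = 0 := by rw [← Finset.mul_sum, h0, mul_zero]
      simp only [D]
      rw [hAS _ hv', hS]
      ring) (oddTheta_simple hτ)
    (fun v hv => by
      have hv' := hdiv v hv
      have e : (v + ((N : ℝ) : ℂ)) / N = v / N + 1 := by push_cast; field_simp
      have h1 := oddTheta_add_lattice τ v N 0
      have h2 : v + (((N : ℤ) : ℂ) + ((0 : ℤ) : ℂ) * τ) = v + ((N : ℝ) : ℂ) := by push_cast; ring
      rw [h2] at h1
      refine ⟨by rw [h1]; exact mul_ne_zero (ex_ne_zero _) hv, ?_⟩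
      simp only [D]
      rw [e, hAS _ hv', hAS _ (oddTheta_add_one_ne_zero hv'), oddTheta_add_one, crossPoint_add_one,
        h1]
      have n1 : ‖ex (-N : ℂ)‖ = 1 := norm_ex_eq_one (by simp)
      have n2 : ‖ex (((N : ℤ) : ℂ) - ((0 : ℤ) : ℂ) - ((0 : ℤ) : ℂ) ^ 2 * τ -
          2 * ((0 : ℤ) : ℂ) * v)‖ = 1 := norm_ex_eq_one (by simp)
      simp only [norm_mul, norm_neg, n1, n2]
      ring)
    (fun v hv => by
      have hv' := hdiv v hv
      have e : (v + ((N : ℝ) : ℂ) * τ) / N = v / N + τ := by push_cast; field_simp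
      have h1 := oddTheta_add_lattice τ v 0 N
      have h2 : v + (((0 : ℤ) : ℂ) + ((N : ℤ) : ℂ) * τ) = v + ((N : ℝ) : ℂ) * τ := by
        push_cast; ring
      rw [h2] at h1
      refine ⟨by rw [h1]; exact mul_ne_zero (ex_ne_zero _) hv, ?_⟩
      simp only [D]
      rw [e, hAS _ hv', hAS _ (oddTheta_add_tau_ne_zero hv'), oddTheta_add_tau, crossPoint_add_tau,
        h1, ← norm_mul, ← norm_mul]
      congr 1
      have e2 : ex (((0 : ℤ) : ℂ) - ((N : ℤ) : ℂ) - ((N : ℤ) : ℂ) ^ 2 * τ - 2 * ((N : ℤ) : ℂ) * v)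
          = ex (-τ - 2 * (v / N)) * ex (-τ - 2 * (v / N)) *
            ex (2 * τ + 4 * (v / N) + N - N ^ 2 * τ - 2 * N ^ 2 * (v / N)) := by
        rw [← ex_add, ← ex_add, ex_eq_ex_iff]
        exact ⟨-N, by push_cast; field_simp; ring⟩
      rw [e2]
      ring)
  have hs0 : deriv (oddTheta τ) 0 ≠ 0 := oddTheta_simple hτ 0 (oddTheta_zero τ)
  -- `D` has a double zero at the origin, while the odd theta function has a simple one
  have hK0 : K = 0 := by
    have d1 : HasDerivAt D (K * deriv (oddTheta τ) 0) 0 := by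
      rw [funext hK]; exact (hs 0).hasDerivAt.const_mul K
    have hA' : DifferentiableAt ℂ (fun v : ℂ => A (v / N)) 0 := (hA.comp (by fun_prop)) 0
    have hs' : DifferentiableAt ℂ (fun v : ℂ => oddTheta τ (v / N)) 0 := (hs.comp (by fun_prop)) 0
    have d2 : HasDerivAt D 0 0 := by
      refine (hA'.hasDerivAt.mul hs'.hasDerivAt).congr_deriv ?_
      simp [hA0, oddTheta_zero]
    exact (mul_eq_zero.1 (d1.unique d2)).resolve_right hs0
  have h1 := hK (N * z)
  simp only [D] at h1
  rw [mul_div_cancel_left₀ _ hN, hK0, zero_mul, hAS z hz] at h1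
  simpa [hC, hz] using h1

theorem crossSum_zero (hτ : 0 < τ.im) (c d : ℤ) {z : ℂ} (hz : oddTheta τ z ≠ 0) :
    crossSum N τ c d 0 z = 0 := by
  refine Eq.trans ?_ (crossPoint_eq_zero (N := N) hτ hz)
  rw [crossSum, crossPoint]
  refine Finset.sum_congr rfl fun β _ => ?_
  rw [phi_zero (th_div_ne_zero hτ hz _ _), one_mul, neg_zero, zero_sub]

theorem crossSum_neg (hτ : 0 < τ.im) (γ : Fin N × Fin N) {z : ℂ} (hz : oddTheta τ z ≠ 0) :
    crossSum N τ (γ.1 : ℕ) (γ.2 : ℕ) (-(N * z)) z = 0 := by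
  refine Eq.trans ?_ (crossPoint_eq_zero (N := N) hτ hz)
  rw [crossSum, crossPoint, ← Equiv.sum_comp (Equiv.addRight γ)
    (fun β : Fin N × Fin N => phi N τ (β.1 : ℕ) (β.2 : ℕ) (-(N * z)) z)]
  refine Finset.sum_congr rfl fun β _ => ?_
  rw [Equiv.coe_addRight, phi_fin_add, neg_neg, sub_self, phi_zero (th_div_ne_zero hτ hz _ _),
    mul_one]

/-- As a function of `ξ` the sum is a theta function of order two with zeros at `0` and `-Nz`. -/
theorem exists_crossSum_eq (hτ : 0 < τ.im) (γ : Fin N × Fin N) {z : ℂ}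
    (hz : oddTheta τ (N * z) ≠ 0) :
    ∃ K, ∀ ξ, crossSum N τ (γ.1 : ℕ) (γ.2 : ℕ) ξ z =
      K * (oddTheta τ ξ * oddTheta τ (ξ + N * z)) := by
  have hs := differentiable_oddTheta hτ
  have hz' := oddTheta_ne_zero_of_mul (N := N) hτ hz
  have hs1 : Differentiable ℂ fun ξ => oddTheta τ (ξ + N * z) := hs.comp (by fun_prop)
  have hd1 : ∀ ξ, deriv (fun ξ => oddTheta τ (ξ + N * z)) ξ = deriv (oddTheta τ) (ξ + N * z) :=
    fun ξ => deriv_comp_add_const _ _ _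
  have hex : ∀ ξ, oddTheta τ ξ = 0 → oddTheta τ (ξ + N * z) ≠ 0 := by
    intro ξ h
    obtain ⟨m, n, rfl⟩ := (oddTheta_eq_zero_iff hτ ξ).1 h
    rw [add_comm, oddTheta_add_lattice]
    exact mul_ne_zero (ex_ne_zero _) hz
  have hdB : ∀ ξ, deriv (fun ξ => oddTheta τ ξ * oddTheta τ (ξ + N * z)) ξ =
      deriv (oddTheta τ) ξ * oddTheta τ (ξ + N * z) +
        oddTheta τ ξ * deriv (oddTheta τ) (ξ + N * z) := by
    intro ξ
    rw [deriv_fun_mul (hs ξ) (hs1 ξ), hd1]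
  refine exists_eq_const_mul hτ one_pos (differentiable_crossSum hτ _ _ z) (hs.mul hs1) ?_ ?_ ?_ ?_
  · intro ξ h
    rcases mul_eq_zero.1 h with h | h
    · obtain ⟨m, n, rfl⟩ := (oddTheta_eq_zero_iff hτ ξ).1 h
      have := crossSum_add_lattice (N := N) (τ := τ) (γ.1 : ℕ) (γ.2 : ℕ) 0 z m n
      rwa [crossSum_zero hτ _ _ hz', mul_zero, zero_add] at this
    · obtain ⟨m, n, h⟩ := (oddTheta_eq_zero_iff hτ _).1 h
      have := crossSum_add_lattice (N := N) (τ := τ) (γ.1 : ℕ) (γ.2 : ℕ) (-(N * z)) z m n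
      rwa [crossSum_neg hτ _ hz', mul_zero, ← h, neg_add_cancel_comm_assoc] at this
  · intro ξ h
    rw [hdB]
    rcases mul_eq_zero.1 h with h | h
    · rw [h, zero_mul, add_zero]
      exact mul_ne_zero (oddTheta_simple hτ _ h) (hex ξ h)
    · rw [h, mul_zero, zero_add]
      exact mul_ne_zero (fun h0 => hex ξ h0 h) (oddTheta_simple hτ _ h)
  · intro ξ h
    have h1 := crossSum_add_lattice (N := N) (τ := τ) (γ.1 : ℕ) (γ.2 : ℕ) ξ z 1 0
    have e : ξ + (((1 : ℤ) : ℂ) + ((0 : ℤ) : ℂ) * τ) = ξ + 1 := by push_cast; ring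
    rw [e] at h1
    simp only [Complex.ofReal_one] at h ⊢
    rw [h1, add_right_comm, oddTheta_add_one, oddTheta_add_one, neg_mul_neg]
    refine ⟨h, ?_⟩
    simp [norm_om, ex_zero]
  · intro ξ h
    have h1 := crossSum_add_lattice (N := N) (τ := τ) (γ.1 : ℕ) (γ.2 : ℕ) ξ z 0 1
    have e : ξ + (((0 : ℤ) : ℂ) + ((1 : ℤ) : ℂ) * τ) = ξ + τ := by push_cast; ring
    rw [e] at h1
    simp only [Complex.ofReal_one, one_mul] at h ⊢
    have e2 : oddTheta τ (ξ + τ) * oddTheta τ (ξ + τ + N * z) =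
        ex (-(2 * ((1 : ℤ) : ℂ) ^ 2 * τ) - 2 * ((1 : ℤ) : ℂ) * (2 * ξ + N * z)) *
          (oddTheta τ ξ * oddTheta τ (ξ + N * z)) := by
      rw [add_right_comm, oddTheta_add_tau, oddTheta_add_tau, mul_mul_mul_comm, neg_mul_neg,
        ← ex_add]
      push_cast
      ring_nf
    rw [h1, e2]
    refine ⟨mul_ne_zero (ex_ne_zero _) h, ?_⟩
    simp only [norm_mul, norm_om]
    ring

/-- The sum multiplied by the square of `∏_β ϑ_β(z/N)`, which is entire in `z`. -/
noncomputable def crossNum (N : ℕ) (τ : ℂ) [NeZero N] (γ : Fin N × Fin N) (ξ z : ℂ) : ℂ :=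
  ∑ β : Fin N × Fin N, th N τ ((β + γ).1 : ℕ) ((β + γ).2 : ℕ) (ξ + z / N) *
    th N τ (β.1 : ℕ) (β.2 : ℕ) (-ξ - N * z + z / N) * (thErase N τ (β + γ) z * thErase N τ β z)

theorem differentiable_crossNum (hτ : 0 < τ.im) (γ : Fin N × Fin N) (ξ : ℂ) :
    Differentiable ℂ (crossNum N τ γ ξ) := by
  unfold crossNum
  refine Differentiable.fun_sum fun β _ => ?_
  exact (((differentiable_th hτ _ _).comp (by fun_prop)).mul
    ((differentiable_th hτ _ _).comp (by fun_prop))).mul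
    ((differentiable_thErase hτ _).mul (differentiable_thErase hτ _))

theorem crossNum_eq (hτ : 0 < τ.im) {C : ℂ} (hC : ∀ z, thProd N τ z = C * oddTheta τ z)
    (γ : Fin N × Fin N) (ξ : ℂ) {z : ℂ} (hz : oddTheta τ z ≠ 0) :
    crossNum N τ γ ξ z = (C * oddTheta τ z) ^ 2 * crossSum N τ (γ.1 : ℕ) (γ.2 : ℕ) ξ z := by
  rw [crossNum, crossSum, Finset.mul_sum]
  refine Finset.sum_congr rfl fun β _ => ?_
  have h1 := th_div_ne_zero (N := N) hτ hz (β.1 : ℕ) (β.2 : ℕ)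
  have h2 := th_div_ne_zero (N := N) hτ hz ((β + γ).1 : ℕ) ((β + γ).2 : ℕ)
  rw [← phi_fin_add, sq, ← hC]
  nth_rw 1 [← th_mul_thErase (β + γ) z]
  rw [← th_mul_thErase β z, phi, phi]
  field_simp

/-- Off the diagonal the characters of the sum under `ξ ↦ ξ + 1` and `ξ ↦ ξ + τ` are not those of
`ϑ(ξ) ϑ(ξ + Nz)`, so the constant in `exists_crossSum_eq` has to vanish. -/
theorem crossSum_eq_zero (hτ : 0 < τ.im) {γ : Fin N × Fin N} (hγ : γ ≠ 0) (ξ : ℂ) {z : ℂ}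
    (hz : oddTheta τ z ≠ 0) : crossSum N τ (γ.1 : ℕ) (γ.2 : ℕ) ξ z = 0 := by
  have hN : (N : ℂ) ≠ 0 := NeZero.ne _
  have hs := differentiable_oddTheta hτ
  obtain ⟨C, hC0, hC⟩ := exists_thProd_eq (N := N) hτ
  have hgen : ∀ z, oddTheta τ (N * z) ≠ 0 → crossSum N τ (γ.1 : ℕ) (γ.2 : ℕ) ξ z = 0 := by
    intro z hz
    obtain ⟨K, hK⟩ := exists_crossSum_eq hτ γ hz
    obtain ⟨v, hv1, hv2⟩ := exists_oddTheta_ne_zero_pair hτ (N * z)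
    have hB := mul_ne_zero hv1 hv2
    suffices K = 0 by rw [hK, this, zero_mul]
    by_contra hK0
    have hX : crossSum N τ (γ.1 : ℕ) (γ.2 : ℕ) v z ≠ 0 := by rw [hK]; exact mul_ne_zero hK0 hB
    apply hγ
    have key1 : om N (γ.1 : ℕ) = 1 := by
      have h1 := crossSum_add_lattice (N := N) (τ := τ) (γ.1 : ℕ) (γ.2 : ℕ) v z 1 0
      have e : v + (((1 : ℤ) : ℂ) + ((0 : ℤ) : ℂ) * τ) = v + 1 := by push_cast; ring
      rw [e, hK, add_right_comm, oddTheta_add_one, oddTheta_add_one, neg_mul_neg, ← hK] at h1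
      apply mul_right_cancel₀ hX
      simpa [ex_zero] using h1.symm
    have key2 : om N (-(γ.2 : ℕ)) = 1 := by
      have h1 := crossSum_add_lattice (N := N) (τ := τ) (γ.1 : ℕ) (γ.2 : ℕ) v z 0 1
      have e : v + (((0 : ℤ) : ℂ) + ((1 : ℤ) : ℂ) * τ) = v + τ := by push_cast; ring
      rw [e, hK, add_right_comm, oddTheta_add_tau, oddTheta_add_tau, mul_mul_mul_comm, neg_mul_neg,
        ← ex_add, mul_left_comm, ← hK] at h1
      have e3 : -τ - 2 * v + (-τ - 2 * (v + N * z)) =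
        -(2 * ((1 : ℤ) : ℂ) ^ 2 * τ) - 2 * ((1 : ℤ) : ℂ) * (2 * v + N * z) := by push_cast; ring
      rw [e3, mul_assoc (ex _)] at h1
      have h2 := mul_left_cancel₀ (ex_ne_zero _) h1
      apply mul_right_cancel₀ hX
      simpa using h2.symm
    have h1 := (om_eq_one_iff _).1 key1
    have h2 := Int.dvd_neg.1 ((om_eq_one_iff _).1 key2)
    have f1 := Nat.eq_zero_of_dvd_of_lt (Int.natCast_dvd_natCast.1 h1) γ.1.2
    have f2 := Nat.eq_zero_of_dvd_of_lt (Int.natCast_dvd_natCast.1 h2) γ.2.2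
    exact Prod.ext (Fin.ext (by simpa using f1)) (Fin.ext (by simpa using f2))
  -- the values of `z` with `Nz` in the lattice are reached by continuity
  have hall : crossNum N τ γ ξ z = 0 := by
    refine eq_of_eq_of_simple_zeros (B := fun z => oddTheta τ (N * z)) (G := fun _ => 0)
      (hs.comp (by fun_prop)) (fun z hz => ?_) (differentiable_crossNum hτ γ ξ).continuous
      continuous_const (fun z hz => ?_) z
    · rw [deriv_comp_mul_left (N : ℂ) (oddTheta τ) z, smul_eq_mul]
      exact mul_ne_zero hN (oddTheta_simple hτ _ hz)
    · rw [crossNum_eq hτ hC γ ξ (oddTheta_ne_zero_of_mul hτ hz), hgen z hz, mul_zero]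
  rw [crossNum_eq hτ hC γ ξ hz] at hall
  exact (mul_eq_zero.1 hall).resolve_left (pow_ne_zero 2 (mul_ne_zero hC0 hz))

theorem crossSum_arg_add_one (ξ z : ℂ) :
    crossSum N τ 0 0 ξ (z + 1) = ex (-N) * crossSum N τ 0 0 ξ z := by
  rw [crossSum, crossSum, ← sum_shift_right (N := N)
    (g := fun a b => phi N τ (a + 0) (b + 0) ξ z * phi N τ a b (-ξ - N * z) z)
    (fun a b => by rw [add_zero, add_zero, add_zero, phi_right_add, phi_right_add]),
    Finset.mul_sum]
  refine Finset.sum_congr rfl fun β _ => ?_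
  have := phi_add_lattice N τ (-ξ - N * z) z (β.1 : ℕ) ((β.2 : ℕ) + 1) (-N) 0
  have h2 : om N (((β.1 : ℕ) : ℤ) * -N - ((β.2 : ℕ) + 1) * 0) = 1 :=
    (om_eq_one_iff _).2 ⟨-(β.1 : ℕ), by ring⟩
  rw [h2] at this
  rw [phi_arg_add_one, phi_arg_add_one, show -ξ - N * (z + 1) =
    -ξ - N * z + (((-N : ℤ) : ℂ) + ((0 : ℤ) : ℂ) * τ) by push_cast; ring, this]
  push_cast
  ring_nf

theorem crossSum_arg_add_tau (ξ z : ℂ) : crossSum N τ 0 0 ξ (z + τ) =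
    ex (2 * τ + 4 * z + N - N ^ 2 * τ - 2 * N * ξ - 2 * N ^ 2 * z) * crossSum N τ 0 0 ξ z := by
  have hN : (N : ℂ) ≠ 0 := NeZero.ne _
  rw [crossSum, crossSum, ← sum_shift_left (N := N)
    (g := fun a b => phi N τ (a + 0) (b + 0) ξ z * phi N τ a b (-ξ - N * z) z)
    (fun a b => by rw [add_zero, add_zero, add_zero, phi_left_add, phi_left_add]),
    Finset.mul_sum]
  refine Finset.sum_congr rfl fun β _ => ?_
  have := phi_add_lattice N τ (-ξ - N * z) z ((β.1 : ℕ) + 1) (β.2 : ℕ) 0 (-N)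
  have h2 : om N ((((β.1 : ℕ) : ℤ) + 1) * 0 - (β.2 : ℕ) * -N) = 1 :=
    (om_eq_one_iff _).2 ⟨(β.2 : ℕ), by ring⟩
  rw [h2] at this
  rw [phi_arg_add_tau, phi_arg_add_tau, show -ξ - N * (z + τ) =
    -ξ - N * z + (((0 : ℤ) : ℂ) + ((-N : ℤ) : ℂ) * τ) by push_cast; ring, this]
  have e : ex (2 * τ + 4 * z + N - N ^ 2 * τ - 2 * N * ξ - 2 * N ^ 2 * z) =
      ex (-(2 / N * ξ)) * (ex (-(2 / N * (-ξ - N * z + (((0 : ℤ) : ℂ) + ((-N : ℤ) : ℂ) * τ)))) *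
        ex (((0 : ℤ) : ℂ) - ((-N : ℤ) : ℂ) - ((-N : ℤ) : ℂ) ^ 2 * τ -
          2 * ((-N : ℤ) : ℂ) * (-ξ - N * z + z / N))) := by
    rw [← ex_add, ← ex_add]
    congr 1
    push_cast
    field_simp
    ring
  rw [e]
  simp only [add_zero]
  ring

/-- The diagonal sum behind crossing. For fixed `ξ` the sum, multiplied by the square of
`∏_β ϑ_β(z/N)`, is a constant multiple of `ϑ(ξ + Nz)` as a function of `z`. The constant is read off
at `z = 0`, where only the term `β = 0` survives. -/
theorem crossSum_zero_zero (hτ : 0 < τ.im) (ξ : ℂ) {z : ℂ} (hz : oddTheta τ z ≠ 0) :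
    oddTheta τ z ^ 2 * crossSum N τ 0 0 ξ z =
      -(N ^ 2 * (oddTheta τ ξ * oddTheta τ (ξ + N * z))) := by
  have hN : (N : ℂ) ≠ 0 := NeZero.ne _
  have hs := differentiable_oddTheta hτ
  obtain ⟨C, hC0, hC⟩ := exists_thProd_eq (N := N) hτ
  have hnum : ∀ ξ {z}, oddTheta τ z ≠ 0 →
      crossNum N τ 0 ξ z = (C * oddTheta τ z) ^ 2 * crossSum N τ 0 0 ξ z := by
    intro ξ z hz
    simpa using crossNum_eq hτ hC 0 ξ hz
  refine eq_of_eq_of_simple_zeros (B := oddTheta τ) hs (oddTheta_simple hτ)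
    (F := fun ξ => oddTheta τ z ^ 2 * crossSum N τ 0 0 ξ z)
    (G := fun ξ => -(N ^ 2 * (oddTheta τ ξ * oddTheta τ (ξ + N * z))))
    ((differentiable_crossSum hτ 0 0 z).continuous.const_mul _)
    ((((hs.mul (hs.comp (by fun_prop))).const_mul _).neg).continuous) (fun ξ hξ => ?_) ξ
  have hE := differentiable_crossNum (N := N) hτ 0 ξ
  have hE1 : ∀ z, crossNum N τ 0 ξ (z + 1) = ex (-N) * crossNum N τ 0 ξ z :=
    eq_of_eq_of_simple_zeros hs (oddTheta_simple hτ) (hE.continuous.comp (by fun_prop))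
      (hE.continuous.const_mul _) (fun z hz => by
        rw [hnum ξ hz, hnum ξ (oddTheta_add_one_ne_zero hz), oddTheta_add_one,
          crossSum_arg_add_one]
        ring)
  have hE2 : ∀ z, crossNum N τ 0 ξ (z + τ) =
      ex (N - N ^ 2 * τ - 2 * N * ξ - 2 * N ^ 2 * z) * crossNum N τ 0 ξ z :=
    eq_of_eq_of_simple_zeros hs (oddTheta_simple hτ) (hE.continuous.comp (by fun_prop))
      ((differentiable_ex.continuous.comp (by fun_prop)).mul hE.continuous) (fun z hz => by
        rw [hnum ξ hz, hnum ξ (oddTheta_add_tau_ne_zero hz), oddTheta_add_tau,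
          crossSum_arg_add_tau]
        have e : ex (N - N ^ 2 * τ - 2 * N * ξ - 2 * N ^ 2 * z) =
            ex (-τ - 2 * z) * ex (-τ - 2 * z) *
              ex (2 * τ + 4 * z + N - N ^ 2 * τ - 2 * N * ξ - 2 * N ^ 2 * z) := by
          rw [← ex_add, ← ex_add]; ring_nf
        rw [e]
        ring)
  have hNz : ∀ z, oddTheta τ (N * z) = 0 → oddTheta τ (ξ + N * z) ≠ 0 := by
    intro z h
    obtain ⟨m, n, h⟩ := (oddTheta_eq_zero_iff hτ _).1 h
    rw [h, oddTheta_add_lattice]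
    exact mul_ne_zero (ex_ne_zero _) hξ
  obtain ⟨K, hK⟩ := exists_eq_const_mul hτ one_pos hE
    (B := fun z => oddTheta τ (ξ + N * z)) (hs.comp (by fun_prop))
    (fun z h => by
      by_cases h0 : oddTheta τ (N * z) = 0
      · exact absurd h (hNz z h0)
      obtain ⟨k, hk⟩ := exists_crossSum_eq hτ 0 h0
      have := hk ξ
      rw [h, mul_zero, mul_zero] at this
      rw [hnum ξ (oddTheta_ne_zero_of_mul hτ h0)]
      simp only [Prod.fst_zero, Prod.snd_zero, Fin.val_zero, Nat.cast_zero] at this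
      rw [this, mul_zero])
    (fun z h => by
      have h1 := deriv_comp_mul_left (N : ℂ) (fun w => oddTheta τ (ξ + w)) z
      rw [h1, deriv_comp_const_add, smul_eq_mul]
      exact mul_ne_zero hN (oddTheta_simple hτ _ h))
    (fun z h => by
      have h1 := oddTheta_add_lattice τ (ξ + N * z) N 0
      have h2 : ξ + N * z + (((N : ℤ) : ℂ) + ((0 : ℤ) : ℂ) * τ) = ξ + N * (z + ((1 : ℝ) : ℂ)) := by
        push_cast; ring
      rw [h2] at h1
      refine ⟨by rw [h1]; exact mul_ne_zero (ex_ne_zero _) h, ?_⟩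
      rw [h1, Complex.ofReal_one, hE1]
      have n1 : ‖ex (-N : ℂ)‖ = 1 := norm_ex_eq_one (by simp)
      have n2 : ‖ex (((N : ℤ) : ℂ) - ((0 : ℤ) : ℂ) - ((0 : ℤ) : ℂ) ^ 2 * τ -
          2 * ((0 : ℤ) : ℂ) * (ξ + N * z))‖ = 1 := norm_ex_eq_one (by simp)
      simp only [norm_mul, n1, n2]
      ring)
    (fun z h => by
      have h1 := oddTheta_add_lattice τ (ξ + N * z) 0 N
      have h2 : ξ + N * z + (((0 : ℤ) : ℂ) + ((N : ℤ) : ℂ) * τ) =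
          ξ + N * (z + ((1 : ℝ) : ℂ) * τ) := by push_cast; ring
      rw [h2] at h1
      refine ⟨by rw [h1]; exact mul_ne_zero (ex_ne_zero _) h, ?_⟩
      rw [h1, Complex.ofReal_one, one_mul, hE2, ← norm_mul, ← norm_mul]
      congr 1
      have e2 : ex (((0 : ℤ) : ℂ) - ((N : ℤ) : ℂ) - ((N : ℤ) : ℂ) ^ 2 * τ -
          2 * ((N : ℤ) : ℂ) * (ξ + N * z)) = ex (N - N ^ 2 * τ - 2 * N * ξ - 2 * N ^ 2 * z) := by
        rw [ex_eq_ex_iff]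
        exact ⟨-N, by push_cast; ring⟩
      rw [e2]
      ring)
  have hK0 : K = -(N * C) ^ 2 * oddTheta τ ξ := by
    have h1 := hK 0
    rw [mul_zero, add_zero, crossNum, Fintype.sum_eq_single 0 (fun β hβ => by
      simp [thErase_zero hβ])] at h1
    simp only [add_zero, zero_div, mul_zero, sub_zero, Prod.fst_zero, Prod.snd_zero, Fin.val_zero,
      Nat.cast_zero, th_zero_zero, oddTheta_neg, thErase_zero_zero hτ hC] at h1
    apply mul_right_cancel₀ hξ
    linear_combination -h1
  have h1 := hK z
  rw [hnum ξ hz, hK0] at h1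
  apply mul_left_cancel₀ (pow_ne_zero 2 hC0)
  linear_combination h1

end Crossing

/-! ### The basis `I_α ⊗ I_α⁻¹` -/

section Basis

variable {N : ℕ}

/-- The bicharacter `ω^{bi}` of `ℤ/Nℤ`. -/
noncomputable def omB (N : ℕ) (b i : Fin N) : ℂ := om N ((b : ℕ) * (i : ℕ))

theorem omB_ne_zero (b i : Fin N) : omB N b i ≠ 0 := om_ne_zero _ _

theorem omB_comm (b i : Fin N) : omB N b i = omB N i b := by rw [omB, omB, mul_comm]

theorem tens_apply {A : Type*} [Mul A] (X Y : Matrix (Fin N) (Fin N) A) (p q : Fin N × Fin N) :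
    tens X Y p q = X p.1 q.1 * Y p.2 q.2 := rfl

theorem flip₁₂_apply {A : Type*} (M : Mat₂ N A) (p q : Fin N × Fin N) :
    flip₁₂ M p q = M (p.2, p.1) (q.2, q.1) := rfl

theorem pt₂_apply {A : Type*} (M : Mat₂ N A) (p q : Fin N × Fin N) :
    pt₂ M p q = M (p.1, q.2) (q.1, p.2) := rfl

theorem pt₂_one : pt₂ (1 : Mat₂ N ℂ) = 1 := by
  ext p q
  simp only [pt₂_apply, Matrix.one_apply, Prod.ext_iff, eq_comm (a := q.2)]

theorem gMat_pow_apply (b : ℕ) (i k : Fin N) :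
    (gMat N ^ b) i k = if i = k then om N (b * ((i : ℕ) + 1)) else 0 := by
  rw [gMat, Matrix.diagonal_pow, Matrix.diagonal_apply]
  congr 1
  rw [Pi.pow_apply, ← ex_nat_mul, om]
  push_cast
  ring_nf

/-- The matrix `I_α ⊗ I_α⁻¹`. -/
noncomputable def tensI (N : ℕ) (α : Fin N × Fin N) : Mat₂ N ℂ := tens (Imat N α) (Imat N α)⁻¹

/-- The matrix `∑_α w_α I_α ⊗ I_α⁻¹`. -/
noncomputable def tensISum (N : ℕ) (w : Fin N × Fin N → ℂ) : Mat₂ N ℂ := ∑ α, w α • tensI N α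

theorem sum_sum_smul_mul {X Y : Fin N × Fin N → Mat₂ N ℂ} (w w' : Fin N × Fin N → ℂ) :
    (∑ α, w α • X α) * (∑ β, w' β • Y β) = ∑ α, ∑ β, (w α * w' β) • (X α * Y β) := by
  rw [Finset.sum_mul]
  refine Finset.sum_congr rfl fun α _ => ?_
  rw [Finset.mul_sum]
  refine Finset.sum_congr rfl fun β _ => ?_
  rw [Matrix.smul_mul, Matrix.mul_smul, smul_smul]

theorem flip₁₂_tensISum (w : Fin N × Fin N → ℂ) :
    flip₁₂ (tensISum N w) = ∑ α, w α • flip₁₂ (tensI N α) := by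
  ext p q
  simp [tensISum, flip₁₂_apply, Matrix.sum_apply]

theorem pt₂_tensISum (w : Fin N × Fin N → ℂ) :
    pt₂ (tensISum N w) = ∑ α, w α • pt₂ (tensI N α) := by
  ext p q
  simp [tensISum, pt₂_apply, Matrix.sum_apply]

variable [NeZero N]

theorem omB_add_left (b b' i : Fin N) : omB N (b + b') i = omB N b i * omB N b' i := by
  rw [omB, periodic_fin_add (N := N) (f := fun k => om N (k * (i : ℕ)))
    (fun k => by rw [add_mul, om_add_mul]), add_mul, om_add, omB, omB]

theorem omB_add_right (b i i' : Fin N) : omB N b (i + i') = omB N b i * omB N b i' := by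
  rw [omB_comm, omB_add_left, omB_comm i, omB_comm i']

theorem omB_neg_right (b i : Fin N) : omB N b (-i) = (omB N b i)⁻¹ := by
  refine eq_inv_of_mul_eq_one_left ?_
  rw [← omB_add_right, neg_add_cancel]
  simp [omB, om_zero]

theorem omB_sub_right (b i i' : Fin N) : omB N b (i - i') = omB N b i / omB N b i' := by
  rw [sub_eq_add_neg, omB_add_right, omB_neg_right, div_eq_mul_inv]

theorem hMat_apply (i j : Fin N) : hMat N i j = if j = i + 1 then 1 else 0 := by
  rw [hMat, Matrix.of_apply]
  congr 1
  rw [eq_iff_iff, Fin.ext_iff, Fin.val_add, Fin.val_one', Nat.add_mod_mod]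

theorem hMat_pow_apply (a : ℕ) (i j : Fin N) :
    (hMat N ^ a) i j = if j = i + Fin.ofNat N a then 1 else 0 := by
  induction a generalizing i j with
  | zero => simp [Matrix.one_apply, eq_comm]
  | succ a ih =>
    rw [pow_succ, Matrix.mul_apply]
    simp only [ih, hMat_apply, ite_mul, one_mul, zero_mul, Finset.sum_ite_eq', Finset.mem_univ,
      if_true]
    congr 1
    rw [add_assoc]
    congr 2
    ext
    simp [Fin.val_add]

theorem Imat_apply (α : Fin N × Fin N) (i k : Fin N) :
    Imat N α i k = if k = i + α.1 then om N ((α.2 : ℕ) * ((i : ℕ) + 1)) else 0 := by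
  rw [Imat, Matrix.mul_apply, Fintype.sum_eq_single i fun j hj => by
    rw [gMat_pow_apply, if_neg hj.symm, zero_mul]]
  simp [gMat_pow_apply, hMat_pow_apply]

theorem Imat_inv_apply (α : Fin N × Fin N) (j l : Fin N) :
    (Imat N α)⁻¹ j l = if l = j - α.1 then om N (-((α.2 : ℕ) * ((l : ℕ) + 1))) else 0 := by
  have h : (Imat N α)⁻¹ = Matrix.of fun j l : Fin N =>
      if l = j - α.1 then om N (-((α.2 : ℕ) * ((l : ℕ) + 1))) else 0 := by
    apply Matrix.inv_eq_right_inv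
    ext i l
    rw [Matrix.mul_apply, Fintype.sum_eq_single (i + α.1) fun j hj => by
      rw [Imat_apply, if_neg hj, zero_mul]]
    rw [Imat_apply, if_pos rfl, Matrix.of_apply, add_sub_cancel_right, Matrix.one_apply, mul_ite,
      mul_zero]
    simp only [eq_comm (a := l)]
    split_ifs with h
    · subst h
      rw [← om_add, add_neg_cancel, om_zero]
    · rfl
  rw [h, Matrix.of_apply]

theorem tensI_apply (α p q : Fin N × Fin N) : tensI N α p q =
    if q = (p.1 + α.1, p.2 - α.1) then omB N α.2 p.1 / omB N α.2 q.2 else 0 := by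
  rw [tensI, tens_apply, Imat_apply, Imat_inv_apply]
  simp only [Prod.ext_iff]
  by_cases h1 : q.1 = p.1 + α.1 <;> by_cases h2 : q.2 = p.2 - α.1 <;>
    simp only [h1, h2, if_true, if_false, and_true, and_false, and_self, mul_zero, zero_mul]
  rw [div_eq_mul_inv, omB, omB, ← om_neg, ← om_add, ← om_add]
  ring_nf

theorem flip₁₂_tensI_apply (α p q : Fin N × Fin N) : flip₁₂ (tensI N α) p q =
    if q = (p.1 - α.1, p.2 + α.1) then omB N α.2 p.2 / omB N α.2 q.1 else 0 := by
  rw [flip₁₂_apply, tensI_apply]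
  simp only [Prod.ext_iff, and_comm]

theorem pt₂_tensI_apply (α p q : Fin N × Fin N) : pt₂ (tensI N α) p q =
    if q = (p.1 + α.1, p.2 + α.1) then omB N α.2 p.1 / omB N α.2 p.2 else 0 := by
  rw [pt₂_apply, tensI_apply]
  simp only [Prod.ext_iff, eq_sub_iff_add_eq, eq_comm (a := q.2)]

theorem pt₂_flip₁₂_tensI_apply (α p q : Fin N × Fin N) : pt₂ (flip₁₂ (tensI N α)) p q =
    if q = (p.1 - α.1, p.2 - α.1) then omB N α.2 q.2 / omB N α.2 q.1 else 0 := by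
  rw [pt₂_apply, flip₁₂_tensI_apply]
  simp only [Prod.ext_iff, eq_sub_iff_add_eq, eq_comm (a := p.2)]

/-- The flip of `I_β ⊗ I_β⁻¹` is its inverse; the root of unity comes from the commutation relations of
the matrices `I_α`. -/
theorem tensI_mul_flip (β γ : Fin N × Fin N) : tensI N (β + γ) * flip₁₂ (tensI N β) =
    om N ((γ.2 : ℕ) * (β.1 : ℕ) - (γ.1 : ℕ) * (β.2 : ℕ)) • tensI N γ := by
  ext p q
  rw [Matrix.mul_apply, Matrix.smul_apply, smul_eq_mul, tensI_apply,
    Fintype.sum_eq_single (p.1 + (β + γ).1, p.2 - (β + γ).1) fun r hr => by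
      rw [tensI_apply, if_neg hr, zero_mul]]
  simp only [tensI_apply (β + γ), flip₁₂_tensI_apply, if_true, mul_ite, mul_zero, Prod.fst_add,
    Prod.snd_add]
  have e : (p.1 + (β.1 + γ.1) - β.1, p.2 - (β.1 + γ.1) + β.1) = (p.1 + γ.1, p.2 - γ.1) := by
    ext1 <;> simp only <;> abel
  rw [e]
  split_ifs with h
  · subst h
    have e' : om N ((γ.2 : ℕ) * (β.1 : ℕ) - (γ.1 : ℕ) * (β.2 : ℕ)) =
        omB N γ.2 β.1 / omB N γ.1 β.2 := by
      rw [sub_eq_add_neg, om_add, om_neg, omB, omB, div_eq_mul_inv]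
    rw [e']
    simp only [omB_add_left, omB_add_right, omB_sub_right, omB_comm γ.1 β.2]
    have := omB_ne_zero (N := N)
    field_simp [this]
  · rfl

/-- After partial transposition the root of unity of `tensI_mul_flip` disappears. -/
theorem pt₂_tensI_mul (β γ : Fin N × Fin N) :
    pt₂ (tensI N (β + γ)) * pt₂ (flip₁₂ (tensI N β)) = pt₂ (tensI N γ) := by
  ext p q
  rw [Matrix.mul_apply, pt₂_tensI_apply,
    Fintype.sum_eq_single (p.1 + (β + γ).1, p.2 + (β + γ).1) fun r hr => by
      rw [pt₂_tensI_apply, if_neg hr, zero_mul]]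
  simp only [pt₂_tensI_apply (β + γ), pt₂_flip₁₂_tensI_apply, if_true, mul_ite, mul_zero,
    Prod.fst_add, Prod.snd_add]
  have e : (p.1 + (β.1 + γ.1) - β.1, p.2 + (β.1 + γ.1) - β.1) = (p.1 + γ.1, p.2 + γ.1) := by
    ext1 <;> simp only <;> abel
  rw [e]
  split_ifs with h
  · subst h
    simp only [omB_add_left, omB_add_right]
    have := omB_ne_zero (N := N)
    field_simp [this]
  · rfl

theorem tensI_zero : tensI N 0 = 1 := by
  ext p q
  rw [tensI_apply, Matrix.one_apply]
  simp [omB, om_zero, eq_comm]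

theorem sum_sum_shift {M : Type*} [AddCommMonoid M] (f : Fin N × Fin N → Fin N × Fin N → M) :
    ∑ α, ∑ β, f α β = ∑ γ, ∑ β, f (β + γ) β := by
  rw [Finset.sum_comm, Finset.sum_comm (f := fun γ β => f (β + γ) β)]
  refine Finset.sum_congr rfl fun β _ => ?_
  exact (Equiv.sum_comp (Equiv.addLeft β) (fun α => f α β)).symm

/-- The product of `R`-type matrices in unitarity is a twisted convolution of the coefficients. -/
theorem tensISum_mul_flip (w w' : Fin N × Fin N → ℂ) :
    tensISum N w * flip₁₂ (tensISum N w') = ∑ γ : Fin N × Fin N,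
      (∑ β : Fin N × Fin N, om N ((γ.2 : ℕ) * (β.1 : ℕ) - (γ.1 : ℕ) * (β.2 : ℕ)) *
        (w (β + γ) * w' β)) • tensI N γ := by
  rw [flip₁₂_tensISum, tensISum, sum_sum_smul_mul, sum_sum_shift]
  refine Finset.sum_congr rfl fun γ _ => ?_
  rw [Finset.sum_smul]
  refine Finset.sum_congr rfl fun β _ => ?_
  rw [tensI_mul_flip, smul_smul, mul_comm]

/-- The product of `R`-type matrices in crossing unitarity is a plain convolution of the
coefficients. -/
theorem pt₂_tensISum_mul (w w' : Fin N × Fin N → ℂ) :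
    pt₂ (tensISum N w) * pt₂ (flip₁₂ (tensISum N w')) = ∑ γ : Fin N × Fin N,
      (∑ β : Fin N × Fin N, w (β + γ) * w' β) • pt₂ (tensI N γ) := by
  have h : pt₂ (flip₁₂ (tensISum N w')) = ∑ α, w' α • pt₂ (flip₁₂ (tensI N α)) := by
    ext p q
    simp [flip₁₂_tensISum, pt₂_apply, Matrix.sum_apply]
  rw [h, pt₂_tensISum, sum_sum_smul_mul, sum_sum_shift]
  refine Finset.sum_congr rfl fun γ _ => ?_
  rw [Finset.sum_smul]
  refine Finset.sum_congr rfl fun β _ => ?_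
  rw [pt₂_tensI_mul]

end Basis

/-! ### Infinite products in additive variables and the normalization factor -/

section Scalars

/-- The point `ξ` is not in `ℤ + ℤτ + ℤζ`. This is genericity at the level `c = -N`, where the shift by
`cζ` is an integer multiple of `ζ`; outside this set no factor of the `R`-matrix has a zero or a
pole. -/
def Regular (ζ τ ξ : ℂ) : Prop := ∀ k l m : ℤ, ξ ≠ k + l * τ + m * ζ

theorem Regular.neg {ζ τ ξ : ℂ} (h : Regular ζ τ ξ) : Regular ζ τ (-ξ) := fun k l m e =>
  h (-k) (-l) (-m) (by push_cast; linear_combination -e)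

theorem Regular.add {ζ τ ξ : ℂ} (h : Regular ζ τ ξ) (k l m : ℤ) :
    Regular ζ τ (ξ + (k + l * τ + m * ζ)) := fun k' l' m' e =>
  h (k' - k) (l' - l) (m' - m) (by push_cast; linear_combination e)

/-- `(e^{2πiv}; e^{2πiσ})_∞`. -/
noncomputable def pochE (σ v : ℂ) : ℂ := poch (ex (2 * v)) (ex (2 * σ))

/-- `(e^{2πiv}; e^{2πiτ}, e^{2πiσ})_∞`. -/
noncomputable def pochE₂ (τ σ v : ℂ) : ℂ := poch₂ (ex (2 * v)) (ex (2 * τ)) (ex (2 * σ))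

/-- The multiplicative theta function `(e^{2πiv}; p)_∞ (p e^{-2πiv}; p)_∞`, `p = e^{2πiσ}`. -/
noncomputable def thetaE (σ v : ℂ) : ℂ := pochE σ v * pochE σ (σ - v)

variable {σ τ : ℂ}

theorem ex_two_mul_add_int (v : ℂ) (k : ℤ) : ex (2 * (v + k)) = ex (2 * v) :=
  (ex_eq_ex_iff _ _).2 ⟨k, by ring⟩

theorem pochE_add_int (v : ℂ) (k : ℤ) : pochE σ (v + k) = pochE σ v := by
  rw [pochE, ex_two_mul_add_int, pochE]

theorem pochE₂_add_int (v : ℂ) (k : ℤ) : pochE₂ τ σ (v + k) = pochE₂ τ σ v := by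
  rw [pochE₂, ex_two_mul_add_int, pochE₂]

theorem thetaE_add_int (v : ℂ) (k : ℤ) : thetaE σ (v + k) = thetaE σ v := by
  rw [thetaE, pochE_add_int, show σ - (v + k) = σ - v + (-k : ℤ) by push_cast; ring, pochE_add_int,
    thetaE]

theorem pochE_ne_zero (hσ : 0 < σ.im) {v : ℂ} (hv : ∀ k l : ℤ, v ≠ k + l * σ) :
    pochE σ v ≠ 0 := by
  rw [pochE, Ne, poch_eq_zero_iff (norm_ex_lt_one (im_two_mul_pos hσ))]
  rintro ⟨n, hn⟩
  rw [sub_eq_zero, eq_comm, ← ex_nat_mul, ← ex_add, ex_eq_one_iff] at hn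
  obtain ⟨k, hk⟩ := hn
  exact hv k (-n) (by push_cast; linear_combination hk / 2)

theorem thetaE_ne_zero (hσ : 0 < σ.im) {v : ℂ} (hv : ∀ k l : ℤ, v ≠ k + l * σ) :
    thetaE σ v ≠ 0 :=
  mul_ne_zero (pochE_ne_zero hσ hv) (pochE_ne_zero hσ fun k l e =>
    hv (-k) (1 - l) (by push_cast; linear_combination -e))

theorem pochE_self_ne_zero (hσ : 0 < σ.im) : pochE σ σ ≠ 0 := by
  rw [pochE, Ne, poch_eq_zero_iff (norm_ex_lt_one (im_two_mul_pos hσ))]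
  rintro ⟨n, hn⟩
  rw [sub_eq_zero, eq_comm, ← ex_nat_mul, ← ex_add, ex_eq_one_iff] at hn
  obtain ⟨k, hk⟩ := hn
  have := congrArg Complex.im hk
  rw [show 2 * σ + n * (2 * σ) = ((2 + 2 * n : ℝ) : ℂ) * σ by push_cast; ring,
    Complex.im_ofReal_mul] at this
  have h0 : (2 * (k : ℂ)).im = 0 := by simp
  rw [h0] at this
  exact absurd this (by positivity)

theorem pochE₂_ne_zero (hτ : 0 < τ.im) (hσ : 0 < σ.im) {v : ℂ}
    (hv : ∀ k l m : ℤ, v ≠ k + l * τ + m * σ) : pochE₂ τ σ v ≠ 0 := by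
  rw [pochE₂, Ne, poch₂_eq_zero_iff (norm_ex_lt_one (im_two_mul_pos hτ))
    (norm_ex_lt_one (im_two_mul_pos hσ))]
  rintro ⟨m, n, hn⟩
  rw [sub_eq_zero, eq_comm, ← ex_nat_mul, ← ex_nat_mul, ← ex_add, ← ex_add, ex_eq_one_iff] at hn
  obtain ⟨k, hk⟩ := hn
  exact hv k (-m) (-n) (by push_cast; linear_combination hk / 2)

theorem pochE₂_step_left (hτ : 0 < τ.im) (hσ : 0 < σ.im) (v : ℂ) :
    pochE₂ τ σ v = pochE σ v * pochE₂ τ σ (v + τ) := by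
  rw [pochE₂, poch₂_step_left (norm_ex_lt_one (im_two_mul_pos hτ))
    (norm_ex_lt_one (im_two_mul_pos hσ)), pochE, pochE₂, ← ex_add, mul_add 2 v τ, add_comm (2 * τ)]

theorem pochE₂_step_right (hτ : 0 < τ.im) (hσ : 0 < σ.im) (v : ℂ) :
    pochE₂ τ σ v = pochE τ v * pochE₂ τ σ (v + σ) := by
  rw [pochE₂, poch₂_step_right (norm_ex_lt_one (im_two_mul_pos hτ))
    (norm_ex_lt_one (im_two_mul_pos hσ)), pochE, pochE₂, ← ex_add, mul_add 2 v σ, add_comm (2 * σ)]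

theorem differentiable_pochE (hσ : 0 < σ.im) : Differentiable ℂ (pochE σ) :=
  (differentiable_poch (norm_ex_lt_one (im_two_mul_pos hσ))).comp
    (differentiable_ex.comp (by fun_prop))

theorem differentiable_thetaE (hσ : 0 < σ.im) : Differentiable ℂ (thetaE σ) :=
  (differentiable_pochE hσ).mul ((differentiable_pochE hσ).comp (by fun_prop))

theorem differentiable_pochE₂ (hτ : 0 < τ.im) (hσ : 0 < σ.im) :
    Differentiable ℂ (pochE₂ τ σ) :=
  (differentiable_poch₂ (norm_ex_lt_one (im_two_mul_pos hτ))
    (norm_ex_lt_one (im_two_mul_pos hσ))).comp (differentiable_ex.comp (by fun_prop))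

theorem bigTheta_ex (v : ℂ) :
    bigTheta (ex (2 * σ)) (ex (2 * v)) = thetaE σ v * pochE σ σ := by
  rw [bigTheta, thetaE, pochE, pochE, pochE, ← ex_neg, ← ex_add, ← sub_eq_add_neg, ← mul_sub]

theorem thetaE_add (hσ : 0 < σ.im) (v : ℂ) : thetaE σ (v + σ) = -ex (-(2 * v)) * thetaE σ v := by
  refine mul_right_cancel₀ (pochE_self_ne_zero hσ) ?_
  rw [← bigTheta_ex, mul_assoc, ← bigTheta_ex, mul_add, add_comm, ex_add,
    bigTheta_mul (norm_ex_lt_one (im_two_mul_pos hσ)) (ex_ne_zero _) (ex_ne_zero _), ex_neg]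

/-- The odd theta function is `C e^{-iπv} (e^{2πiv}; p)_∞ (p e^{-2πiv}; p)_∞`. -/
theorem exists_oddTheta_eq_thetaE (hτ : 0 < τ.im) :
    ∃ C : ℂ, C ≠ 0 ∧ ∀ v, thetaE τ v = C * ex v * oddTheta τ v := by
  obtain ⟨C, hC, h⟩ := exists_oddTheta_eq_prodTheta hτ
  have h0 := pochE_self_ne_zero hτ
  refine ⟨(C * pochE τ τ)⁻¹, inv_ne_zero (mul_ne_zero hC h0), fun v => ?_⟩
  rw [h, prodTheta, ← ex_two_mul, bigTheta_ex, ex_neg]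
  have := ex_ne_zero v
  field_simp

variable {N : ℕ} {ζ : ℂ}

theorem ex_pow_two_mul (N : ℕ) (ζ : ℂ) : ex ζ ^ (2 * N) = ex (2 * (N * ζ)) := by
  rw [← ex_nat_mul]
  push_cast
  ring_nf

/-- The numerator of `1/κ(z²)` at `z = e^{iπξ}`. -/
noncomputable def kapNum (N : ℕ) (ζ τ ξ : ℂ) : ℂ :=
  pochE₂ τ (N * ζ) (N * ζ - ξ) * pochE₂ τ (N * ζ) (ζ + ξ) * pochE₂ τ (N * ζ) (τ - ξ) *
    pochE₂ τ (N * ζ) (τ + (N - 1) * ζ + ξ)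

theorem kapNum_add_one (ξ : ℂ) : kapNum N ζ τ (ξ + 1) = kapNum N ζ τ ξ := by
  have h : ∀ v, pochE₂ τ (N * ζ) (v + 1) = pochE₂ τ (N * ζ) v := fun v => by
    simpa using pochE₂_add_int (τ := τ) (σ := N * ζ) v 1
  rw [kapNum, kapNum, ← h (N * ζ - ξ), ← h (ζ + ξ), ← h (τ - ξ), ← h (τ + (N - 1) * ζ + ξ),
    ← h (N * ζ - (ξ + 1)), ← h (τ - (ξ + 1)), ← h (N * ζ - (ξ + 1) + 1), ← h (τ - (ξ + 1) + 1)]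
  ring_nf

section

variable [NeZero N]

theorem im_nat_mul_pos (hζ : 0 < ζ.im) : 0 < ((N : ℂ) * ζ).im := by
  have : 0 < (N : ℝ) := by exact_mod_cast NeZero.pos N
  rw [← Complex.ofReal_natCast, Complex.im_ofReal_mul]
  positivity

theorem Regular.oddTheta_ne_zero (hτ : 0 < τ.im) {ξ : ℂ} (h : Regular ζ τ ξ) :
    oddTheta τ ξ ≠ 0 := by
  rw [Ne, oddTheta_eq_zero_iff hτ]
  rintro ⟨m, n, hmn⟩
  exact h m n 0 (by rw [hmn]; simp)

theorem Regular.thetaE_ne_zero (hζ : 0 < ζ.im) {ξ : ℂ} (h : Regular ζ τ ξ) :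
    thetaE (N * ζ) ξ ≠ 0 :=
  EllipticW.thetaE_ne_zero (im_nat_mul_pos hζ) fun k l e =>
    h k 0 (l * N) (by rw [e]; push_cast; ring)

theorem Regular.pochE₂_ne_zero (hζ : 0 < ζ.im) (hτ : 0 < τ.im) {ξ : ℂ} (h : Regular ζ τ ξ) :
    pochE₂ τ (N * ζ) ξ ≠ 0 :=
  EllipticW.pochE₂_ne_zero hτ (im_nat_mul_pos hζ) fun k l m e =>
    h k l (m * N) (by rw [e]; push_cast; ring)

theorem Regular.kapNum_ne_zero (hζ : 0 < ζ.im) (hτ : 0 < τ.im) {ξ : ℂ} (h : Regular ζ τ ξ) :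
    kapNum N ζ τ ξ ≠ 0 := by
  have h1 : Regular ζ τ (N * ζ - ξ) := by
    have := h.neg.add 0 0 N; push_cast at this; convert this using 1; ring
  have h2 : Regular ζ τ (ζ + ξ) := by
    have := h.add 0 0 1; push_cast at this; convert this using 1; ring
  have h3 : Regular ζ τ (τ - ξ) := by
    have := h.neg.add 0 1 0; push_cast at this; convert this using 1; ring
  have h4 : Regular ζ τ (τ + (N - 1) * ζ + ξ) := by
    have := h.add 0 1 (N - 1); push_cast at this; convert this using 1; ring
  exact mul_ne_zero (mul_ne_zero (mul_ne_zero (h1.pochE₂_ne_zero hζ hτ) (h2.pochE₂_ne_zero hζ hτ))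
    (h3.pochE₂_ne_zero hζ hτ)) (h4.pochE₂_ne_zero hζ hτ)

theorem differentiable_kapNum (hζ : 0 < ζ.im) (hτ : 0 < τ.im) :
    Differentiable ℂ (kapNum N ζ τ) := by
  have h := differentiable_pochE₂ hτ (im_nat_mul_pos (N := N) hζ)
  exact (((h.comp (by fun_prop)).mul (h.comp (by fun_prop))).mul (h.comp (by fun_prop))).mul
    (h.comp (by fun_prop))

/-- Under `z² ↦ q^{2N} z²` the double products telescope to simple products of base `p`. -/
theorem kapNum_add_nat_mul (hζ : 0 < ζ.im) (hτ : 0 < τ.im) (ξ : ℂ) :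
    kapNum N ζ τ (ξ + N * ζ) * (pochE τ (ζ + ξ) * pochE τ (τ + (N - 1) * ζ + ξ)) =
      kapNum N ζ τ ξ * (pochE τ (-ξ) * pochE τ (τ - ξ - N * ζ)) := by
  have h := pochE₂_step_right hτ (im_nat_mul_pos (N := N) hζ)
  rw [kapNum, kapNum, h (ζ + ξ), h (τ + (N - 1) * ζ + ξ), show N * ζ - (ξ + N * ζ) = -ξ by ring,
    h (-ξ), show τ - (ξ + N * ζ) = τ - ξ - N * ζ by ring, h (τ - ξ - N * ζ)]
  ring_nf

/-- Under `z² ↦ p z²` the double products telescope to simple products of base `q^{2N}`. -/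
theorem kapNum_add_tau (hζ : 0 < ζ.im) (hτ : 0 < τ.im) (ξ : ℂ) :
    kapNum N ζ τ (ξ + τ) * (pochE (N * ζ) (ζ + ξ) * pochE (N * ζ) (τ + (N - 1) * ζ + ξ)) =
      kapNum N ζ τ ξ * (pochE (N * ζ) (N * ζ - ξ - τ) * pochE (N * ζ) (-ξ)) := by
  have h := pochE₂_step_left hτ (im_nat_mul_pos (N := N) hζ)
  rw [kapNum, kapNum, h (ζ + ξ), h (τ + (N - 1) * ζ + ξ),
    show N * ζ - (ξ + τ) = N * ζ - ξ - τ by ring, h (N * ζ - ξ - τ),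
    show τ - (ξ + τ) = -ξ by ring, h (-ξ)]
  ring_nf

theorem invKappa_eq (ξ : ℂ) :
    invKappa N ζ τ ξ = kapNum N ζ τ ξ / kapNum N ζ τ (-ξ) := by
  have hN : 1 ≤ N := NeZero.one_le
  have e1 : ex ζ ^ (2 * N - 2) = ex (2 * ((N - 1) * ζ)) := by
    rw [← ex_nat_mul, Nat.cast_sub (by omega)]
    push_cast
    ring_nf
  simp only [invKappa, kapNum, pochE₂, ex_pow_two_mul, e1, ← ex_two_mul, ← ex_neg, ← ex_add]
  ring_nf

theorem invKappa_mul_neg (hζ : 0 < ζ.im) (hτ : 0 < τ.im) {ξ : ℂ} (h : Regular ζ τ ξ) :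
    invKappa N ζ τ ξ * invKappa N ζ τ (-ξ) = 1 := by
  have h1 := h.kapNum_ne_zero (N := N) hζ hτ
  have h2 := h.neg.kapNum_ne_zero (N := N) hζ hτ
  rw [invKappa_eq, invKappa_eq, neg_neg]
  field_simp

/-- The normalization factor makes up for the theta functions left over by the crossing sum
`crossSum_zero_zero`. -/
theorem invKappa_mul_cross (hζ : 0 < ζ.im) (hτ : 0 < τ.im) {ξ : ℂ} (h : Regular ζ τ ξ) :
    invKappa N ζ τ ξ * invKappa N ζ τ (-ξ - N * ζ) *
        (ex (2 * (N - 1) * ζ) * (-(oddTheta τ ξ * oddTheta τ (ξ + N * ζ)))) =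
      oddTheta τ (ξ + ζ) * oddTheta τ (-ξ - N * ζ + ζ) := by
  obtain ⟨C, hC, hs⟩ := exists_oddTheta_eq_thetaE hτ
  have hshift : ∀ l m : ℤ, Regular ζ τ (ξ + (l * τ + m * ζ)) := fun l m => by
    have := h.add 0 l m
    push_cast at this; convert this using 1; ring
  have a1 := kapNum_add_nat_mul (N := N) hζ hτ ξ
  have a2 := kapNum_add_nat_mul (N := N) hζ hτ (-ξ - N * ζ)
  have n1 : Regular ζ τ (ξ + N * ζ) := by have := h.add 0 0 N; push_cast at this; simpa using this
  have n2 : Regular ζ τ (-ξ - N * ζ) := by have := n1.neg; convert this using 1; ring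
  have k1 := n1.kapNum_ne_zero (N := N) hζ hτ
  have k2 := h.neg.kapNum_ne_zero (N := N) hζ hτ
  have t1 := hs (ζ + ξ)
  have t2 := hs (ζ - ξ - N * ζ)
  have t3 := hs (-ξ)
  have t4 := hs (ξ + N * ζ)
  rw [thetaE] at t1 t2 t3 t4
  rw [show ζ + (-ξ - N * ζ) = ζ - ξ - N * ζ by ring,
    show τ + (N - 1) * ζ + (-ξ - N * ζ) = τ - (ζ + ξ) by ring,
    show -(-ξ - N * ζ) = ξ + N * ζ by ring, show τ - (-ξ - N * ζ) - N * ζ = τ - -ξ by ring,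
    show -ξ - N * ζ + N * ζ = -ξ by ring] at a2
  rw [show τ + (N - 1) * ζ + ξ = τ - (ζ - ξ - N * ζ) by ring,
    show τ - ξ - N * ζ = τ - (ξ + N * ζ) by ring] at a1
  have key : kapNum N ζ τ (ξ + N * ζ) * kapNum N ζ τ (-ξ) *
        ((C * ex (ζ + ξ) * oddTheta τ (ζ + ξ)) *
          (C * ex (ζ - ξ - N * ζ) * oddTheta τ (ζ - ξ - N * ζ))) =
      kapNum N ζ τ ξ * kapNum N ζ τ (-ξ - N * ζ) *
        ((C * ex (-ξ) * oddTheta τ (-ξ)) * (C * ex (ξ + N * ζ) * oddTheta τ (ξ + N * ζ))) := by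
    rw [← t1, ← t2, ← t3, ← t4]
    linear_combination (congrArg₂ (· * ·) a1 a2)
  rw [invKappa_eq, invKappa_eq, show -(-ξ - N * ζ) = ξ + N * ζ by ring, add_comm ξ ζ,
    show -ξ - N * ζ + ζ = ζ - ξ - N * ζ by ring]
  have e1 : ex (ζ + ξ) * ex (ζ - ξ - N * ζ) * ex (2 * (N - 1) * ζ) = ex (-ξ) * ex (ξ + N * ζ) := by
    rw [← ex_add, ← ex_add, ← ex_add]; ring_nf
  rw [oddTheta_neg] at key
  have e0 := ex_ne_zero (ζ + ξ)
  have e2 := ex_ne_zero (ζ - ξ - N * ζ)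
  have key2 : kapNum N ζ τ ξ * kapNum N ζ τ (-ξ - N * ζ) *
      (ex (2 * (N - 1) * ζ) * (-(oddTheta τ ξ * oddTheta τ (ξ + N * ζ)))) =
      kapNum N ζ τ (ξ + N * ζ) * kapNum N ζ τ (-ξ) *
        (oddTheta τ (ζ + ξ) * oddTheta τ (ζ - ξ - N * ζ)) := by
    refine mul_left_cancel₀ (mul_ne_zero (pow_ne_zero 2 hC) (mul_ne_zero e0 e2)) ?_
    linear_combination -key - C ^ 2 * kapNum N ζ τ ξ * kapNum N ζ τ (-ξ - N * ζ) *
      oddTheta τ ξ * oddTheta τ (ξ + N * ζ) * e1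
  rw [div_mul_div_comm, div_mul_eq_mul_div, key2]
  field_simp

theorem tauN_eq (hζ : 0 < ζ.im) (u : ℂ) : tauN N ζ (ζ / 2 + u) =
    ex ((2 / N - 2) * (ζ / 2 + u)) * thetaE (N * ζ) (ζ + u) / thetaE (N * ζ) (-u) := by
  have h0 := pochE_self_ne_zero (im_nat_mul_pos (N := N) hζ)
  rw [tauN, ex_pow_two_mul, ← ex_two_mul, ← ex_neg, ← ex_add, ← ex_add,
    show ζ + 2 * (ζ / 2 + u) = 2 * (ζ + u) by ring, show ζ + -(2 * (ζ / 2 + u)) = 2 * -u by ring,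
    bigTheta_ex, bigTheta_ex, ← mul_assoc, mul_div_mul_right _ _ h0]

/-- The quasi-periodicity factor of `1/κ` is a ratio of theta functions of base `q^{2N}`, as in
`τ_N`. -/
theorem invKappa_add_tau (hζ : 0 < ζ.im) (hτ : 0 < τ.im) {ξ : ℂ} (h : Regular ζ τ ξ) :
    invKappa N ζ τ (ξ + τ + 1) * (thetaE (N * ζ) (ζ + ξ) * thetaE (N * ζ) (ζ - ξ - τ)) =
      invKappa N ζ τ ξ * (thetaE (N * ζ) (ξ + τ) * thetaE (N * ζ) (-ξ)) := by
  have a1 := kapNum_add_tau (N := N) hζ hτ ξ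
  have a2 := kapNum_add_tau (N := N) hζ hτ (-ξ - τ)
  have n1 : Regular ζ τ (ξ + τ) := by have := h.add 0 1 0; push_cast at this; simpa using this
  have k1 := n1.neg.kapNum_ne_zero (N := N) hζ hτ
  have k2 := h.neg.kapNum_ne_zero (N := N) hζ hτ
  have e : kapNum N ζ τ (-(ξ + τ + 1)) = kapNum N ζ τ (-(ξ + τ)) := by
    rw [← kapNum_add_one, show -(ξ + τ + 1) + 1 = -(ξ + τ) by ring]
  rw [invKappa_eq, invKappa_eq, kapNum_add_one, e, thetaE, thetaE, thetaE, thetaE,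
    div_mul_eq_mul_div, div_mul_eq_mul_div, div_eq_div_iff k1 k2]
  rw [show -ξ - τ + τ = -ξ by ring, show -ξ - τ = -(ξ + τ) by ring,
    show ζ + -(ξ + τ) = ζ - ξ - τ by ring,
    show τ + (N - 1) * ζ + -(ξ + τ) = N * ζ - (ζ + ξ) by ring,
    show N * ζ - -(ξ + τ) - τ = N * ζ - -ξ by ring, show - -(ξ + τ) = ξ + τ by ring] at a2
  rw [show τ + (N - 1) * ζ + ξ = N * ζ - (ζ - ξ - τ) by ring,
    show N * ζ - ξ - τ = N * ζ - (ξ + τ) by ring] at a1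
  linear_combination (congrArg₂ (· * ·) a1 a2)

/-- The function `τ_N` is invariant under `z ↦ q^N z`. -/
theorem tauN_add (hζ : 0 < ζ.im) (u : ℂ) :
    tauN N ζ (ζ / 2 + (u + N * ζ)) = tauN N ζ (ζ / 2 + u) := by
  have hN : (N : ℂ) ≠ 0 := NeZero.ne _
  have hσ := im_nat_mul_pos (N := N) hζ
  have h1 := thetaE_add hσ (ζ + u)
  have h2 := thetaE_add hσ (-u - N * ζ)
  rw [sub_add_cancel] at h2
  have e : ex ((2 / N - 2) * (ζ / 2 + (u + N * ζ))) * ex (-(2 * (ζ + u))) *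
      ex (-(2 * (-u - N * ζ))) = ex ((2 / N - 2) * (ζ / 2 + u)) := by
    rw [← ex_add, ← ex_add]
    congr 1
    field_simp
    ring
  have := ex_ne_zero (-(2 * (-u - N * ζ)))
  rw [tauN_eq hζ, tauN_eq hζ, ← add_assoc ζ u, h1, h2, show -(u + N * ζ) = -u - N * ζ by ring, ← e]
  by_cases h : thetaE (N * ζ) (-u - N * ζ) = 0
  · simp [h]
  · field_simp

theorem tauN_sub (hζ : 0 < ζ.im) (u : ℂ) :
    tauN N ζ (ζ / 2 + (u - N * ζ)) = tauN N ζ (ζ / 2 + u) := by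
  rw [← tauN_add hζ, sub_add_cancel]

theorem Regular.tauN_ne_zero (hζ : 0 < ζ.im) {u : ℂ} (h : Regular ζ τ u) :
    tauN N ζ (ζ / 2 + u) ≠ 0 := by
  have h2 : Regular ζ τ (ζ + u) := by
    have := h.add 0 0 1; push_cast at this; convert this using 1; ring
  rw [tauN_eq hζ]
  exact div_ne_zero (mul_ne_zero (ex_ne_zero _) (h2.thetaE_ne_zero hζ)) (h.neg.thetaE_ne_zero hζ)

end

end Scalars

/-! ### Unitarity, crossing unitarity and quasi-periodicity of the `R`-matrix -/

section RMatrix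

variable {N : ℕ} {ζ τ : ℂ}

/-- Conjugation of a matrix by a diagonal matrix. -/
noncomputable def diagConj {n : Type*} (d : n → ℂ) (M : Matrix n n ℂ) : Matrix n n ℂ :=
  Matrix.of fun p q => d p * M p q * (d q)⁻¹

theorem diagConj_apply {n : Type*} (d : n → ℂ) (M : Matrix n n ℂ) (p q : n) :
    diagConj d M p q = d p * M p q * (d q)⁻¹ := rfl

theorem diagConj_mul {n : Type*} [Fintype n] {d : n → ℂ} (hd : ∀ i, d i ≠ 0) (M M' : Matrix n n ℂ) :
    diagConj d M * diagConj d M' = diagConj d (M * M') := by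
  ext p q
  rw [Matrix.mul_apply, diagConj_apply, Matrix.mul_apply, Finset.mul_sum, Finset.sum_mul]
  refine Finset.sum_congr rfl fun r _ => ?_
  rw [diagConj_apply, diagConj_apply]
  have := hd r
  field_simp

theorem diagConj_smul_one {n : Type*} [DecidableEq n] {d : n → ℂ} (hd : ∀ i, d i ≠ 0) (c : ℂ) :
    diagConj d (c • 1) = c • 1 := by
  ext p q
  rw [diagConj_apply, Matrix.smul_apply, Matrix.one_apply]
  have := hd p
  split_ifs with h
  · subst h
    field_simp
  · simp

theorem diagConj_smul {n : Type*} (d : n → ℂ) (c : ℂ) (M : Matrix n n ℂ) :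
    diagConj d (c • M) = c • diagConj d M := by
  ext p q
  simp only [diagConj_apply, Matrix.smul_apply, smul_eq_mul]
  ring

/-- The entries of `g^{1/2}`, with indices shifted to start at `0`. -/
noncomputable def gEntry (N : ℕ) (i : Fin N) : ℂ := ex (((i : ℂ) + 1) / N)

theorem gEntry_ne_zero (i : Fin N) : gEntry N i ≠ 0 := ex_ne_zero _

theorem gEntry_sq (i : Fin N) : gEntry N i ^ 2 = om N (((i : ℕ) : ℤ) + 1) := by
  rw [gEntry, ← ex_two_mul, om]
  push_cast
  ring_nf

theorem gHalf_inv : (gHalf N)⁻¹ = Matrix.diagonal fun i => (gEntry N i)⁻¹ := by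
  apply Matrix.inv_eq_right_inv
  have h : gHalf N = Matrix.diagonal (gEntry N) := rfl
  rw [h, Matrix.diagonal_mul_diagonal, ← Matrix.diagonal_one]
  congr 1
  funext i
  exact mul_inv_cancel₀ (gEntry_ne_zero i)

/-- The scalar factor of the `R`-matrix. -/
noncomputable def pref (N : ℕ) (ζ τ ξ : ℂ) : ℂ :=
  ex ((2 / (N : ℂ) - 2) * ξ) * invKappa N ζ τ ξ * (oddTheta τ ζ / oddTheta τ (ξ + ζ)) / N

/-- The theta-function part of the `R`-matrix. -/
noncomputable def phiMat (N : ℕ) (ζ τ ξ : ℂ) : Mat₂ N ℂ :=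
  tensISum N fun α => phi N τ (α.1 : ℕ) (α.2 : ℕ) ξ ζ

theorem Rtilde_eq (ξ : ℂ) : Rtilde N ζ τ ξ = pref N ζ τ ξ • phiMat N ζ τ ξ := by
  rw [Rtilde, pref, phiMat, tensISum, div_eq_mul_inv (_ * _) (N : ℂ), mul_smul _ (N : ℂ)⁻¹]
  refine congrArg _ ?_
  rw [Finset.smul_sum]
  refine Finset.sum_congr rfl fun α _ => ?_
  rw [smul_smul, tensI, Wfun, phi, th, th]
  congr 1
  push_cast
  ring

theorem R_eq (ξ : ℂ) : R N ζ τ ξ =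
    pref N ζ τ ξ • diagConj (fun p => gEntry N p.1 * gEntry N p.2) (phiMat N ζ τ ξ) := by
  have h1 : tens (gHalf N) (gHalf N) =
      Matrix.diagonal fun p : Fin N × Fin N => gEntry N p.1 * gEntry N p.2 :=
    Matrix.diagonal_kronecker_diagonal _ _
  have h2 : tens (gHalf N)⁻¹ (gHalf N)⁻¹ =
      Matrix.diagonal fun p : Fin N × Fin N => (gEntry N p.1)⁻¹ * (gEntry N p.2)⁻¹ := by
    rw [gHalf_inv]
    exact Matrix.diagonal_kronecker_diagonal _ _
  rw [R, h1, h2, Rtilde_eq, ← diagConj_smul]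
  ext p q
  rw [Matrix.mul_diagonal, Matrix.diagonal_mul, diagConj_apply, mul_inv]

theorem flip₁₂_diagConj (d : Fin N → ℂ) (M : Mat₂ N ℂ) :
    flip₁₂ (diagConj (fun p => d p.1 * d p.2) M) =
      diagConj (fun p => d p.1 * d p.2) (flip₁₂ M) := by
  ext p q
  rw [flip₁₂_apply, diagConj_apply, diagConj_apply, flip₁₂_apply, mul_comm (d p.2),
    mul_comm (d q.2)]

theorem pt₂_diagConj (d : Fin N → ℂ) (M : Mat₂ N ℂ) :
    pt₂ (diagConj (fun p => d p.1 * d p.2) M) = diagConj (fun p => d p.1 * (d p.2)⁻¹) (pt₂ M) := by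
  ext p q
  rw [pt₂_apply, diagConj_apply, diagConj_apply, pt₂_apply, mul_inv, mul_inv, inv_inv]
  ring

theorem flip₁₂_smul (c : ℂ) (M : Mat₂ N ℂ) : flip₁₂ (c • M) = c • flip₁₂ M := rfl

theorem pt₂_smul (c : ℂ) (M : Mat₂ N ℂ) : pt₂ (c • M) = c • pt₂ M := rfl

variable [NeZero N]

theorem phiMat_mul_flip (hτ : 0 < τ.im) (hζ : oddTheta τ ζ ≠ 0) (ξ : ℂ) :
    phiMat N ζ τ ξ * flip₁₂ (phiMat N ζ τ (-ξ)) =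
      ((N : ℂ) ^ 2 * (oddTheta τ (ξ + ζ) * oddTheta τ (-ξ + ζ) / oddTheta τ ζ ^ 2)) • 1 := by
  have h : ∀ γ : Fin N × Fin N, ∑ β : Fin N × Fin N,
      om N ((γ.2 : ℕ) * (β.1 : ℕ) - (γ.1 : ℕ) * (β.2 : ℕ)) *
        (phi N τ ((β + γ).1 : ℕ) ((β + γ).2 : ℕ) ξ ζ * phi N τ (β.1 : ℕ) (β.2 : ℕ) (-ξ) ζ) =
      unitSum N τ (γ.1 : ℕ) (γ.2 : ℕ) ξ ζ := fun γ => by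
    rw [unitSum]
    exact Finset.sum_congr rfl fun β _ => by rw [phi_fin_add]
  rw [phiMat, phiMat, tensISum_mul_flip, Fintype.sum_eq_single 0 fun γ hγ => by
    rw [h, unitSum_eq_zero hτ γ hγ ξ hζ, zero_smul], tensI_zero]
  congr 1
  rw [add_comm ξ, neg_add_eq_sub, ← sum_phi_mul_phi_neg hτ ξ hζ]
  refine Finset.sum_congr rfl fun β _ => ?_
  simp [om_zero]

theorem pt₂_phiMat_mul (hτ : 0 < τ.im) (hζ : oddTheta τ ζ ≠ 0) (ξ : ℂ) :
    pt₂ (phiMat N ζ τ ξ) * pt₂ (flip₁₂ (phiMat N ζ τ (-ξ - N * ζ))) =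
      (-(N ^ 2 * (oddTheta τ ξ * oddTheta τ (ξ + N * ζ))) / oddTheta τ ζ ^ 2) • 1 := by
  have h : ∀ γ : Fin N × Fin N, ∑ β : Fin N × Fin N,
      phi N τ ((β + γ).1 : ℕ) ((β + γ).2 : ℕ) ξ ζ *
        phi N τ (β.1 : ℕ) (β.2 : ℕ) (-ξ - N * ζ) ζ =
      crossSum N τ (γ.1 : ℕ) (γ.2 : ℕ) ξ ζ := fun γ => by
    rw [crossSum]
    exact Finset.sum_congr rfl fun β _ => by rw [phi_fin_add]
  rw [phiMat, phiMat, pt₂_tensISum_mul, Fintype.sum_eq_single 0 fun γ hγ => by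
    rw [h, crossSum_eq_zero hτ hγ ξ hζ, zero_smul], tensI_zero, pt₂_one, h]
  congr 1
  rw [eq_div_iff (pow_ne_zero 2 hζ), ← crossSum_zero_zero hτ ξ hζ, mul_comm]
  simp

variable (hζ : 0 < ζ.im) (hτ : 0 < τ.im) (hs : oddTheta τ ζ ≠ 0)
include hζ hτ hs

/-- Unitarity of the `R`-matrix. -/
theorem R_mul_flip {ξ : ℂ} (h : Regular ζ τ ξ) :
    R N ζ τ ξ * flip₁₂ (R N ζ τ (-ξ)) = 1 := by
  have hN : (N : ℂ) ≠ 0 := NeZero.ne _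
  have hd : ∀ p : Fin N × Fin N, gEntry N p.1 * gEntry N p.2 ≠ 0 := fun p =>
    mul_ne_zero (gEntry_ne_zero _) (gEntry_ne_zero _)
  rw [R_eq, R_eq, flip₁₂_smul, flip₁₂_diagConj, Matrix.smul_mul, Matrix.mul_smul, smul_smul,
    diagConj_mul hd, phiMat_mul_flip hτ hs, diagConj_smul_one hd, smul_smul]
  have h1 : oddTheta τ (ξ + ζ) ≠ 0 := by
    have := h.add 0 0 1; push_cast at this; simpa using this.oddTheta_ne_zero hτ
  have h2 : oddTheta τ (-ξ + ζ) ≠ 0 := by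
    have := h.neg.add 0 0 1; push_cast at this; simpa using this.oddTheta_ne_zero hτ
  have e1 : ex ((2 / (N : ℂ) - 2) * -ξ) * ex ((2 / (N : ℂ) - 2) * ξ) = 1 := by
    rw [← ex_add, ← ex_zero]; ring_nf
  have e2 := invKappa_mul_neg (N := N) hζ hτ h
  convert one_smul ℂ (1 : Mat₂ N ℂ) using 2
  rw [pref, pref]
  generalize ex ((2 / (N : ℂ) - 2) * -ξ) = E, ex ((2 / (N : ℂ) - 2) * ξ) = E' at e1 ⊢
  field_simp
  linear_combination E' * E * e2 + e1

/-- Crossing unitarity of the `R`-matrix. -/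
theorem pt₂_R_mul {ξ : ℂ} (h : Regular ζ τ ξ) :
    pt₂ (R N ζ τ ξ) * pt₂ (flip₁₂ (R N ζ τ (-ξ - N * ζ))) = 1 := by
  have hN : (N : ℂ) ≠ 0 := NeZero.ne _
  have hd : ∀ p : Fin N × Fin N, gEntry N p.1 * (gEntry N p.2)⁻¹ ≠ 0 := fun p =>
    mul_ne_zero (gEntry_ne_zero _) (inv_ne_zero (gEntry_ne_zero _))
  rw [R_eq, R_eq, flip₁₂_smul, flip₁₂_diagConj, pt₂_smul, pt₂_smul, pt₂_diagConj, pt₂_diagConj,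
    Matrix.smul_mul, Matrix.mul_smul, smul_smul,
    diagConj_mul hd, pt₂_phiMat_mul hτ hs, diagConj_smul_one hd, smul_smul]
  have h1 : oddTheta τ (ξ + ζ) ≠ 0 := by
    have := h.add 0 0 1; push_cast at this; simpa using this.oddTheta_ne_zero hτ
  have h2 : oddTheta τ (-ξ - N * ζ + ζ) ≠ 0 := by
    have := h.neg.add 0 0 (1 - N)
    push_cast at this
    rw [show -ξ - N * ζ + ζ = -ξ + (0 + 0 * τ + (1 - N) * ζ) by ring]
    exact this.oddTheta_ne_zero hτ
  have e1 : ex ((2 / (N : ℂ) - 2) * ξ) * ex ((2 / (N : ℂ) - 2) * (-ξ - N * ζ)) =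
      ex (2 * (N - 1) * ζ) := by
    rw [← ex_add]
    congr 1
    field_simp
    ring
  have e2 := invKappa_mul_cross (N := N) hζ hτ h
  convert one_smul ℂ (1 : Mat₂ N ℂ) using 2
  rw [← e1] at e2
  rw [pref, pref]
  generalize ex ((2 / (N : ℂ) - 2) * ξ) = E, ex ((2 / (N : ℂ) - 2) * (-ξ - N * ζ)) = E' at e2 ⊢
  generalize -ξ - N * ζ = ξ', ξ + N * ζ = ξ'' at e2 h2 ⊢
  field_simp
  linear_combination e2

theorem isUnit_R {ξ : ℂ} (h : Regular ζ τ ξ) : IsUnit (R N ζ τ ξ) :=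
  IsUnit.of_mul_eq_one _ (R_mul_flip hζ hτ hs h)

theorem R_inv {ξ : ℂ} (h : Regular ζ τ ξ) : (R N ζ τ ξ)⁻¹ = flip₁₂ (R N ζ τ (-ξ)) :=
  Matrix.inv_eq_right_inv (R_mul_flip hζ hτ hs h)

end RMatrix

section QuasiPeriod

variable {N : ℕ} [NeZero N] {ζ τ : ℂ}

theorem omB_one_right (b : Fin N) : omB N b 1 = om N (b : ℕ) := by
  have h := periodic_emod (N := N) (f := fun k => om N ((b : ℕ) * k))
    (fun k => by rw [mul_add, mul_comm _ (N : ℤ), om_add_mul]) 1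
  rw [mul_one] at h
  rw [omB, Fin.val_one', ← h]
  push_cast
  rfl

theorem gEntry_add_sq (i a : Fin N) : gEntry N (i + a) ^ 2 = om N (a : ℕ) * gEntry N i ^ 2 := by
  have h := periodic_fin_add (N := N) (f := fun k => om N (k + 1)) (fun k => by
    rw [← om_add_mul (N := N) (k + 1) 1]; ring_nf) i a
  rw [gEntry_sq, gEntry_sq, h, ← om_add]
  ring_nf

theorem Gmat_apply (i j : Fin N) :
    Gmat N i j = if j = i + 1 then gEntry N i * gEntry N j else 0 := by
  have h : gHalf N = Matrix.diagonal (gEntry N) := rfl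
  rw [Gmat, h, Matrix.mul_diagonal, Matrix.diagonal_mul, hMat_apply]
  simp [mul_ite, ite_mul]

theorem tens_Gmat_mul_tensI (α : Fin N × Fin N) :
    tens (Gmat N) 1 * diagConj (fun p => gEntry N p.1 * gEntry N p.2) (tensI N α) =
      om N ((α.2 : ℕ) - (α.1 : ℕ)) •
        (diagConj (fun p => gEntry N p.1 * gEntry N p.2) (tensI N α) * tens (Gmat N) 1) := by
  ext p q
  rw [Matrix.smul_apply, smul_eq_mul, Matrix.mul_apply, Matrix.mul_apply,
    Fintype.sum_eq_single (p.1 + 1, p.2), Fintype.sum_eq_single (q.1 - 1, q.2)]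
  · rw [tens_apply, tens_apply, Gmat_apply, Gmat_apply, if_pos rfl, if_pos (sub_add_cancel _ _).symm,
      Matrix.one_apply_eq, Matrix.one_apply_eq, diagConj_apply, diagConj_apply, tensI_apply,
      tensI_apply]
    have e : q = (p.1 + 1 + α.1, p.2 - α.1) ↔ (q.1 - 1, q.2) = (p.1 + α.1, p.2 - α.1) := by
      rw [Prod.ext_iff, Prod.ext_iff, sub_eq_iff_eq_add, add_right_comm]
    simp only [e]
    split_ifs with h
    · have h1 : q.1 = p.1 + 1 + α.1 := congrArg Prod.fst (e.2 h)
      have h2 := gEntry_add_sq (p.1 + 1) α.1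
      have h3 := gEntry_ne_zero (N := N)
      have h4 := omB_ne_zero (N := N)
      have h5 := om_ne_zero N
      rw [← h1] at h2
      rw [omB_add_right, omB_one_right, sub_eq_add_neg, om_add, om_neg]
      have := h3 q.1
      have := h3 q.2
      have := h3 (q.1 - 1)
      have := h4 α.2 q.2
      have := h5 (α.1 : ℕ)
      field_simp
      rw [h2]
      ring
    · simp
  · intro r hr
    rw [tens_apply, Gmat_apply]
    by_cases h1 : q.1 = r.1 + 1
    · rw [Matrix.one_apply_ne fun h2 => hr (Prod.ext (by simp [h1]) h2), mul_zero, mul_zero]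
    · rw [if_neg h1, zero_mul, mul_zero]
  · intro r hr
    rw [tens_apply, Gmat_apply]
    by_cases h1 : r.1 = p.1 + 1
    · rw [Matrix.one_apply_ne fun h2 => hr (Prod.ext h1 h2.symm), mul_zero, zero_mul]
    · rw [if_neg h1, zero_mul, zero_mul]

theorem tens_Gmat_mul_phiMat (ξ : ℂ) :
    tens (Gmat N) 1 * diagConj (fun p => gEntry N p.1 * gEntry N p.2) (phiMat N ζ τ (ξ + τ + 1)) =
      ex (-τ - 2 * (ξ + ζ / N)) •
        (diagConj (fun p => gEntry N p.1 * gEntry N p.2) (phiMat N ζ τ ξ) * tens (Gmat N) 1) := by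
  have hsum : ∀ (d : Fin N × Fin N → ℂ) (w : Fin N × Fin N → ℂ),
      diagConj d (tensISum N w) = ∑ α, w α • diagConj d (tensI N α) := fun d w => by
    ext p q
    simp only [tensISum, diagConj_apply, Matrix.sum_apply, Matrix.smul_apply, smul_eq_mul,
      Finset.mul_sum, Finset.sum_mul]
    exact Finset.sum_congr rfl fun α _ => by ring
  rw [phiMat, phiMat, hsum, hsum, Finset.mul_sum, Finset.sum_mul, Finset.smul_sum]
  refine Finset.sum_congr rfl fun α _ => ?_
  have h := phi_add_lattice N τ ξ ζ (α.1 : ℕ) (α.2 : ℕ) 1 1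
  have e : om N ((α.1 : ℕ) * 1 - (α.2 : ℕ) * 1) * om N ((α.2 : ℕ) - (α.1 : ℕ)) = 1 := by
    rw [← om_add, ← om_zero N]; ring_nf
  rw [Matrix.mul_smul, tens_Gmat_mul_tensI, Matrix.smul_mul, smul_smul, smul_smul,
    show ξ + τ + 1 = ξ + ((1 : ℤ) + (1 : ℤ) * τ) by push_cast; ring, h]
  congr 1
  rw [show ((1 : ℤ) : ℂ) - (1 : ℤ) - (1 : ℤ) ^ 2 * τ - 2 * (1 : ℤ) * (ξ + ζ / N) =
    -τ - 2 * (ξ + ζ / N) by push_cast; ring]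
  linear_combination (ex (-τ - 2 * (ξ + ζ / N)) * phi N τ (α.1 : ℕ) (α.2 : ℕ) ξ ζ) * e

/-- The scalar part of the quasi-periodicity of `R̂`; on the left the exponential is the
quasi-periodicity factor of the theta functions in the matrix part. -/
theorem pref_add_tau (hζ : 0 < ζ.im) (hτ : 0 < τ.im) {ξ : ℂ} (h : Regular ζ τ ξ) :
    tauN N ζ (ζ / 2 - (ξ + τ + 1)) * (pref N ζ τ (ξ + τ + 1) * ex (-τ - 2 * (ξ + ζ / N))) =
      (tauN N ζ (ζ / 2 + ξ))⁻¹ * pref N ζ τ ξ := by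
  have hN : (N : ℂ) ≠ 0 := NeZero.ne _
  have r1 : Regular ζ τ (ξ + τ) := by
    have := h.add 0 1 0; push_cast at this; convert this using 1; ring
  have r2 : Regular ζ τ (ζ + ξ) := by
    have := h.add 0 0 1; push_cast at this; convert this using 1; ring
  have r3 : Regular ζ τ (ζ - ξ - τ) := by
    have := h.neg.add 0 (-1) 1; push_cast at this; convert this using 1; ring
  have t1 := r1.thetaE_ne_zero (N := N) hζ
  have t2 := r2.thetaE_ne_zero (N := N) hζ
  have t3 := r3.thetaE_ne_zero (N := N) hζ
  have t4 := h.neg.thetaE_ne_zero (N := N) hζ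
  have s1 : oddTheta τ (ξ + ζ) ≠ 0 := add_comm ζ ξ ▸ r2.oddTheta_ne_zero hτ
  have hk := invKappa_add_tau (N := N) hζ hτ h
  have hq : oddTheta τ (ξ + τ + 1 + ζ) = ex (-τ - 2 * (ξ + ζ)) * oddTheta τ (ξ + ζ) := by
    have := oddTheta_add_lattice τ (ξ + ζ) 1 1
    push_cast at this
    convert this using 2 <;> ring_nf
  have hA : thetaE (N * ζ) (ζ + (-(ξ + τ) + (-1 : ℤ))) = thetaE (N * ζ) (ζ - ξ - τ) := by
    rw [← add_assoc, thetaE_add_int]; ring_nf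
  have hB : thetaE (N * ζ) (-(-(ξ + τ) + (-1 : ℤ))) = thetaE (N * ζ) (ξ + τ) := by
    rw [neg_add, neg_neg, ← Int.cast_neg, thetaE_add_int]
  rw [show ζ / 2 - (ξ + τ + 1) = ζ / 2 + (-(ξ + τ) + (-1 : ℤ)) by push_cast; ring, tauN_eq hζ,
    tauN_eq hζ, hA, hB, pref, pref, hq]
  have e : ex ((2 / N - 2) * (ζ / 2 + (-(ξ + τ) + (-1 : ℤ)))) * ex ((2 / N - 2) * (ξ + τ + 1)) *
      ex (-τ - 2 * (ξ + ζ / N)) * ex ((2 / N - 2) * (ζ / 2 + ξ)) =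
      ex ((2 / N - 2) * ξ) * ex (-τ - 2 * (ξ + ζ)) := by
    rw [← ex_add, ← ex_add, ← ex_add, ← ex_add]
    congr 1
    push_cast
    field_simp
    ring
  have x1 := ex_ne_zero ((2 / N - 2) * (ζ / 2 + ξ))
  have x2 := ex_ne_zero (-τ - 2 * (ξ + ζ))
  generalize ex ((2 / N - 2) * (ζ / 2 + (-(ξ + τ) + (-1 : ℤ)))) = E1,
    ex ((2 / N - 2) * (ξ + τ + 1)) = E2, ex (-τ - 2 * (ξ + ζ / N)) = E3,
    ex ((2 / N - 2) * (ζ / 2 + ξ)) = E4, ex ((2 / N - 2) * ξ) = E5,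
    ex (-τ - 2 * (ξ + ζ)) = E6 at e x1 x2 ⊢
  field_simp
  linear_combination (oddTheta τ ζ * E1 * E2 * E3 * E4) * hk + oddTheta τ ζ *
    (invKappa N ζ τ ξ * (thetaE (N * ζ) (ξ + τ) * thetaE (N * ζ) (-ξ))) * e

/-- Quasi-periodicity: under `z ↦ -p^{1/2} z` the matrix `R̂(z)` becomes the conjugate of `R(z)` by
`G ⊗ 𝟙`, up to the factor `1/τ_N(q^{1/2} z)`. This factor does not depend on `p`, hence is the same
for the two `R`-matrices of an exchange relation. -/
theorem Gmat_mul_Rhat (hζ : 0 < ζ.im) (hτ : 0 < τ.im) {ξ : ℂ} (h : Regular ζ τ ξ) :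
    tens (Gmat N) 1 * Rhat N ζ τ (ξ + τ + 1) =
      (tauN N ζ (ζ / 2 + ξ))⁻¹ • (R N ζ τ ξ * tens (Gmat N) 1) := by
  rw [Rhat, R_eq, R_eq, Matrix.mul_smul, Matrix.mul_smul, tens_Gmat_mul_phiMat, Matrix.smul_mul,
    smul_smul, smul_smul, smul_smul, mul_assoc, pref_add_tau hζ hτ h]

end QuasiPeriod

/-! ### The central elements `t(z)` -/

section Algebra

variable {N : ℕ} {A : Type*} [Ring A]

theorem inFst_apply (X : Matrix (Fin N) (Fin N) A) (p q : Fin N × Fin N) :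
    inFst X p q = if p.2 = q.2 then X p.1 q.1 else 0 := by
  rw [inFst, tens_apply, Matrix.one_apply, mul_ite, mul_one, mul_zero]

theorem inSnd_apply (X : Matrix (Fin N) (Fin N) A) (p q : Fin N × Fin N) :
    inSnd X p q = if p.1 = q.1 then X p.2 q.2 else 0 := by
  rw [inSnd, tens_apply, Matrix.one_apply, ite_mul, one_mul, zero_mul]

theorem mul_inFst_apply (M : Mat₂ N A) (X : Matrix (Fin N) (Fin N) A) (p q : Fin N × Fin N) :
    (M * inFst X) p q = ∑ k, M p (k, q.2) * X k q.1 := by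
  rw [Matrix.mul_apply, Fintype.sum_prod_type]
  simp only [inFst_apply, mul_ite, mul_zero, Finset.sum_ite_eq', Finset.mem_univ, if_true]

theorem inFst_mul_apply (M : Mat₂ N A) (X : Matrix (Fin N) (Fin N) A) (p q : Fin N × Fin N) :
    (inFst X * M) p q = ∑ k, X p.1 k * M (k, p.2) q := by
  rw [Matrix.mul_apply, Fintype.sum_prod_type]
  simp only [inFst_apply, ite_mul, zero_mul, Finset.sum_ite_eq, Finset.mem_univ, if_true]

theorem mul_inSnd_apply (M : Mat₂ N A) (X : Matrix (Fin N) (Fin N) A) (p q : Fin N × Fin N) :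
    (M * inSnd X) p q = ∑ k, M p (q.1, k) * X k q.2 := by
  rw [Matrix.mul_apply, Fintype.sum_prod_type_right]
  simp only [inSnd_apply, mul_ite, mul_zero, Finset.sum_ite_eq', Finset.mem_univ, if_true]

theorem inSnd_mul_apply (M : Mat₂ N A) (X : Matrix (Fin N) (Fin N) A) (p q : Fin N × Fin N) :
    (inSnd X * M) p q = ∑ k, X p.2 k * M (p.1, k) q := by
  rw [Matrix.mul_apply, Fintype.sum_prod_type_right]
  simp only [inSnd_apply, ite_mul, zero_mul, Finset.sum_ite_eq, Finset.mem_univ, if_true]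

theorem inFst_mul (X Y : Matrix (Fin N) (Fin N) A) : inFst (X * Y) = inFst X * inFst Y := by
  ext p q
  rw [mul_inFst_apply, inFst_apply, Matrix.mul_apply]
  simp only [inFst_apply]
  split_ifs with h <;> simp

theorem inFst_one : inFst (1 : Matrix (Fin N) (Fin N) A) = 1 := by
  ext p q
  simp only [inFst_apply, Matrix.one_apply, Prod.ext_iff, ← ite_and, and_comm]

/-- The partial trace over the first tensor factor. -/
def ptr₁ (M : Mat₂ N A) : Matrix (Fin N) (Fin N) A := Matrix.of fun i j => ∑ k, M (k, i) (k, j)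

theorem ptr₁_apply (M : Mat₂ N A) (i j : Fin N) : ptr₁ M i j = ∑ k, M (k, i) (k, j) := rfl

theorem ptr₁_mul_inSnd (M : Mat₂ N A) (Y : Matrix (Fin N) (Fin N) A) :
    ptr₁ (M * inSnd Y) = ptr₁ M * Y := by
  ext i j
  rw [ptr₁_apply, Matrix.mul_apply]
  simp only [mul_inSnd_apply, ptr₁_apply, Finset.sum_mul]
  exact Finset.sum_comm

theorem ptr₁_inSnd_mul (M : Mat₂ N A) (Y : Matrix (Fin N) (Fin N) A) :
    ptr₁ (inSnd Y * M) = Y * ptr₁ M := by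
  ext i j
  rw [ptr₁_apply, Matrix.mul_apply]
  simp only [inSnd_mul_apply, ptr₁_apply, Finset.mul_sum]
  exact Finset.sum_comm

theorem ptr₁_inFst (X : Matrix (Fin N) (Fin N) A) :
    ptr₁ (inFst X) = Matrix.scalar (Fin N) X.trace := by
  ext i j
  simp only [ptr₁_apply, inFst_apply, Matrix.scalar_apply, Matrix.diagonal_apply, Matrix.trace,
    Matrix.diag_apply]
  split_ifs <;> simp

/-- An element commutes with the entries of a matrix iff the scalar matrix commutes with it. -/
theorem commute_scalar_iff {a : A} {Y : Matrix (Fin N) (Fin N) A} :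
    Commute (Matrix.scalar (Fin N) a) Y ↔ ∀ i j, Commute a (Y i j) := by
  simp only [commute_iff_eq, ← Matrix.ext_iff, Matrix.scalar_apply, Matrix.diagonal_mul,
    Matrix.mul_diagonal]

theorem commute_entry_mul {a : A} {X Y : Matrix (Fin N) (Fin N) A}
    (hX : ∀ i j, Commute a (X i j)) (hY : ∀ i j, Commute a (Y i j)) (i j : Fin N) :
    Commute a ((X * Y) i j) :=
  commute_scalar_iff.1 ((commute_scalar_iff.2 hX).mul_right (commute_scalar_iff.2 hY)) i j

theorem commute_entry_inverse {a : A} {X : Matrix (Fin N) (Fin N) A}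
    (hX : ∀ i j, Commute a (X i j)) (i j : Fin N) :
    Commute a ((Ring.inverse X) i j) := by
  refine commute_scalar_iff.1 ?_ i j
  have h := commute_scalar_iff.2 hX
  by_cases hu : IsUnit X
  · obtain ⟨u, rfl⟩ := hu
    rw [Ring.inverse_unit]
    exact h.units_inv_right
  · rw [Ring.inverse_non_unit _ hu]
    exact Commute.zero_right _

variable [Algebra ℂ A]

theorem scal_apply {n : Type*} (X : Matrix n n ℂ) (i j : n) :
    (scal X : Matrix n n A) i j = algebraMap ℂ A (X i j) := rfl

theorem scal_mul {n : Type*} [Fintype n] (X Y : Matrix n n ℂ) :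
    (scal (X * Y) : Matrix n n A) = scal X * scal Y :=
  Matrix.map_mul (f := algebraMap ℂ A)

theorem scal_one {n : Type*} [DecidableEq n] : (scal (1 : Matrix n n ℂ) : Matrix n n A) = 1 :=
  Matrix.map_one _ (map_zero _) (map_one _)

theorem scal_smul {n : Type*} (c : ℂ) (X : Matrix n n ℂ) :
    (scal (c • X) : Matrix n n A) = c • scal X := by
  ext i j
  rw [Matrix.smul_apply, scal_apply, Matrix.smul_apply, scal_apply, smul_eq_mul, map_mul,
    Algebra.smul_def]

theorem isUnit_scal {n : Type*} [Fintype n] [DecidableEq n] {X : Matrix n n ℂ} (h : IsUnit X) :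
    IsUnit (scal X : Matrix n n A) :=
  h.map (algebraMap ℂ A).mapMatrix

theorem inFst_scal (X : Matrix (Fin N) (Fin N) ℂ) :
    inFst (scal X : Matrix (Fin N) (Fin N) A) = scal (tens X 1) := by
  ext p q
  rw [scal_apply, inFst_apply, tens_apply, scal_apply, Matrix.one_apply]
  split_ifs <;> simp

theorem inFst_scal_comm (X : Matrix (Fin N) (Fin N) ℂ) (Y : Matrix (Fin N) (Fin N) A) :
    inFst (scal X) * inSnd Y = inSnd Y * inFst (scal X) := by
  ext p q
  rw [inFst_mul_apply, mul_inFst_apply]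
  simp only [inSnd_apply, scal_apply, mul_ite, ite_mul, mul_zero, zero_mul, Finset.sum_ite_eq,
    Finset.sum_ite_eq', Finset.mem_univ, if_true]
  exact Algebra.commutes _ _

/-- If the partial transposes of `ρ` and `σ` are inverse to each other, then the partial trace of
`ρ X₁ σ` is that of `X₁`. -/
theorem ptr₁_conj (ρ σ : Mat₂ N ℂ) (h : pt₂ σ * pt₂ ρ = 1) (X : Matrix (Fin N) (Fin N) A) :
    ptr₁ (scal ρ * inFst X * scal σ) = Matrix.scalar (Fin N) X.trace := by
  ext i j
  have h' : ∀ k l : Fin N, ∑ a : Fin N, ∑ m : Fin N, ρ (a, i) (k, m) * σ (l, m) (a, j) =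
      if (l, j) = (k, i) then 1 else 0 := fun k l => by
    have := congrFun (congrFun h (l, j)) (k, i)
    rw [Matrix.mul_apply, Fintype.sum_prod_type, Matrix.one_apply] at this
    rw [← this]
    refine Finset.sum_congr rfl fun a _ => Finset.sum_congr rfl fun m _ => ?_
    rw [pt₂_apply, pt₂_apply, mul_comm]
  have h2 : ptr₁ (scal ρ * inFst X * scal σ) i j = ∑ k : Fin N, ∑ l : Fin N,
      (∑ a : Fin N, ∑ m : Fin N, ρ (a, i) (k, m) * σ (l, m) (a, j)) • X k l := by
    have e : ∀ a : Fin N, (scal ρ * inFst X * scal σ : Mat₂ N A) (a, i) (a, j) = ∑ k : Fin N, ∑ l : Fin N,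
        ∑ m : Fin N, (ρ (a, i) (k, m) * σ (l, m) (a, j)) • X k l := fun a => by
      rw [Matrix.mul_apply, Fintype.sum_prod_type]
      simp only [mul_inFst_apply, Finset.sum_mul, scal_apply]
      have : ∀ k l m : Fin N, algebraMap ℂ A (ρ (a, i) (k, m)) * X k l *
          algebraMap ℂ A (σ (l, m) (a, j)) = (ρ (a, i) (k, m) * σ (l, m) (a, j)) • X k l := by
        intro k l m
        rw [mul_assoc, ← Algebra.commutes, ← mul_assoc, ← map_mul, Algebra.smul_def]
      simp only [this]
      rw [Finset.sum_congr rfl fun l _ => Finset.sum_comm, Finset.sum_comm]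
    rw [ptr₁_apply, Finset.sum_congr rfl fun a _ => e a, Finset.sum_comm]
    refine Finset.sum_congr rfl fun k _ => ?_
    rw [Finset.sum_comm]
    refine Finset.sum_congr rfl fun l _ => ?_
    rw [Finset.sum_smul]
    exact Finset.sum_congr rfl fun a _ => (Finset.sum_smul ..).symm
  rw [h2]
  simp only [h', Matrix.scalar_apply, Matrix.diagonal_apply, Matrix.trace, Matrix.diag_apply,
    Prod.ext_iff, ite_smul, one_smul, zero_smul, eq_comm (a := j)]
  by_cases hij : i = j <;> simp [hij]

/-- The exchange relation of `X₁ Z₁⁻¹` with `Y₂`, from those of `X₁` and of `Z₁`. -/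
theorem inSnd_mul_inFst_mul {ρ ρ' ρs : Mat₂ N ℂ} (hρ : IsUnit ρ) (hρs : IsUnit ρs)
    {X Y Z Zi : Matrix (Fin N) (Fin N) A} (hZ : Z * Zi = 1) (hZ' : Zi * Z = 1)
    (h1 : scal ρ * inFst Z * inSnd Y = inSnd Y * inFst Z * scal ρs)
    (h2 : scal ρ' * inFst X * inSnd Y = inSnd Y * inFst X * scal ρs) :
    inSnd Y * inFst (X * Zi) = scal ρ' * inFst (X * Zi) * scal ρ⁻¹ * inSnd Y := by
  have hd := (Matrix.isUnit_iff_isUnit_det _).1 hρ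
  have hds := (Matrix.isUnit_iff_isUnit_det _).1 hρs
  have r1 : (scal ρ⁻¹ * scal ρ : Mat₂ N A) = 1 := by
    rw [← scal_mul, Matrix.nonsing_inv_mul _ hd, scal_one]
  have r2 : (scal ρs * scal ρs⁻¹ : Mat₂ N A) = 1 := by
    rw [← scal_mul, Matrix.mul_nonsing_inv _ hds, scal_one]
  have z1 : inFst Z * inFst Zi = 1 := by rw [← inFst_mul, hZ, inFst_one]
  have z2 : inFst Zi * inFst Z = 1 := by rw [← inFst_mul, hZ', inFst_one]
  have h3 : inSnd Y * scal ρs⁻¹ * inFst Zi = inFst Zi * scal ρ⁻¹ * inSnd Y := by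
    calc inSnd Y * scal ρs⁻¹ * inFst Zi
        = inFst Zi * (scal ρ⁻¹ * scal ρ) * inFst Z * (inSnd Y * scal ρs⁻¹ * inFst Zi) := by
          rw [r1, mul_one, z2, one_mul]
      _ = inFst Zi * scal ρ⁻¹ * (scal ρ * inFst Z * inSnd Y) * scal ρs⁻¹ * inFst Zi := by
          simp only [mul_assoc]
      _ = inFst Zi * scal ρ⁻¹ * inSnd Y * (inFst Z * (scal ρs * scal ρs⁻¹) * inFst Zi) := by
          rw [h1]; simp only [mul_assoc]
      _ = inFst Zi * scal ρ⁻¹ * inSnd Y := by rw [r2, mul_one, z1, mul_one]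
  calc inSnd Y * inFst (X * Zi)
      = inSnd Y * inFst X * (scal ρs * scal ρs⁻¹) * inFst Zi := by
        rw [r2, mul_one, inFst_mul, mul_assoc]
    _ = (inSnd Y * inFst X * scal ρs) * scal ρs⁻¹ * inFst Zi := by simp only [mul_assoc]
    _ = scal ρ' * inFst X * (inSnd Y * scal ρs⁻¹ * inFst Zi) := by rw [← h2]; simp only [mul_assoc]
    _ = scal ρ' * inFst (X * Zi) * scal ρ⁻¹ * inSnd Y := by
        rw [h3, inFst_mul]; simp only [mul_assoc]

/-- Exchange relations are preserved by conjugation with a matrix of numbers. -/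
theorem exchange_conj {ρ ρs ρ' ρs' : Mat₂ N ℂ} {c : ℂ} (hc : c ≠ 0)
    {G : Matrix (Fin N) (Fin N) ℂ} (hG : IsUnit G)
    (hρ : tens G 1 * ρ = c • (ρ' * tens G 1)) (hρs : tens G 1 * ρs = c • (ρs' * tens G 1))
    {X Y : Matrix (Fin N) (Fin N) A}
    (h : scal ρ * inFst X * inSnd Y = inSnd Y * inFst X * scal ρs) :
    scal ρ' * inFst (scal G * X * scal G⁻¹) * inSnd Y =
      inSnd Y * inFst (scal G * X * scal G⁻¹) * scal ρs' := by
  have hd := (Matrix.isUnit_iff_isUnit_det _).1 hG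
  have g1 : inFst (scal G : Matrix (Fin N) (Fin N) A) * inFst (scal G⁻¹) = 1 := by
    rw [← inFst_mul, ← scal_mul, Matrix.mul_nonsing_inv _ hd, scal_one, inFst_one]
  have g2 : inFst (scal G⁻¹ : Matrix (Fin N) (Fin N) A) * inFst (scal G) = 1 := by
    rw [← inFst_mul, ← scal_mul, Matrix.nonsing_inv_mul _ hd, scal_one, inFst_one]
  have k1 : inFst (scal G) * scal ρ = c • (scal ρ' * inFst (scal G) : Mat₂ N A) := by
    rw [inFst_scal, ← scal_mul, hρ, scal_smul, scal_mul]
  have k2 : inFst (scal G) * scal ρs = c • (scal ρs' * inFst (scal G) : Mat₂ N A) := by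
    rw [inFst_scal, ← scal_mul, hρs, scal_smul, scal_mul]
  have key : c • (scal ρ' * inFst (scal G) * inFst X * inSnd Y) =
      c • (inSnd Y * inFst (scal G) * inFst X * inFst (scal G⁻¹) * scal ρs' *
        inFst (scal G)) := by
    calc c • (scal ρ' * inFst (scal G) * inFst X * inSnd Y)
        = inFst (scal G) * (scal ρ * inFst X * inSnd Y) := by
          rw [mul_assoc, ← smul_mul_assoc, ← k1]; simp only [mul_assoc]
      _ = inFst (scal G) * inSnd Y * inFst X * (inFst (scal G⁻¹) * inFst (scal G)) * scal ρs := by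
          rw [h, g2, mul_one]; simp only [mul_assoc]
      _ = inSnd Y * inFst (scal G) * inFst X * inFst (scal G⁻¹) * (inFst (scal G) * scal ρs) := by
          rw [inFst_scal_comm]; simp only [mul_assoc]
      _ = _ := by rw [k2, mul_smul_comm]; simp only [mul_assoc]
  have key' := smul_right_injective (Mat₂ N A) hc key
  calc scal ρ' * inFst (scal G * X * scal G⁻¹) * inSnd Y
      = (scal ρ' * inFst (scal G) * inFst X * inSnd Y) * inFst (scal G⁻¹) := by
        rw [inFst_mul, inFst_mul]; simp only [mul_assoc]; rw [inFst_scal_comm]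
    _ = inSnd Y * inFst (scal G * X * scal G⁻¹) * scal ρs' := by
        rw [key', inFst_mul, inFst_mul]; simp only [mul_assoc]; rw [g1, mul_one]

theorem commute_entry_scal (a : A) (X : Matrix (Fin N) (Fin N) ℂ) (i j : Fin N) :
    Commute a ((scal X : Matrix (Fin N) (Fin N) A) i j) :=
  (Algebra.commutes _ _).symm

end Algebra

section Elliptic

theorem Regular.of_notMem {N : ℕ} {ζ τ ξ : ℂ} (h : ξ ∉ singular ζ τ (-(N : ℂ))) :
    Regular ζ τ ξ := fun k l m e => h ⟨k, l, m, 0, by rw [e]; simp⟩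

theorem Regular.notMem {ζ τ ξ : ℂ} (h : Regular ζ τ ξ) (N : ℕ) :
    ξ ∉ singular ζ τ (-(N : ℂ)) := by
  rintro ⟨k, l, m, n, e⟩
  exact h k l (m - n * N) (by rw [e]; push_cast; ring)

theorem Regular.shift {ζ τ ξ : ℂ} (h : Regular ζ τ ξ) (N : ℕ) : Regular ζ (τ + N * ζ) ξ :=
  fun k l m e => h k l (l * N + m) (by rw [e]; push_cast; ring)

variable (k : Kind) (N : ℕ) (ζ τ c : ℂ)

/-- The defining exchange relation, in the quotient algebra. -/
theorem Lop_exchange {ξ η : ℂ} (h : ξ - η ∉ singular ζ τ c) :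
    scal (Rhat N ζ τ (ξ - η)) * inFst (Lop k N ζ τ c ξ) * inSnd (Lop k N ζ τ c η) =
      inSnd (Lop k N ζ τ c η) * inFst (Lop k N ζ τ c ξ) *
        scal (Rhat N ζ (τ - c * ζ) (ξ - η)) := by
  have hs : ∀ X : Mat₂ N ℂ, (scal X : Mat₂ N (FreeAlgebra ℂ (Gen N))).map
      (RingQuot.mkAlgHom ℂ (Rel k N ζ τ c)) = scal X := fun X => by
    ext p q
    exact AlgHom.commutes _ _
  have h1 : ∀ ξ, (inFst (freeL N ξ)).map (RingQuot.mkAlgHom ℂ (Rel k N ζ τ c)) =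
      inFst (Lop k N ζ τ c ξ) := fun ξ => by
    ext p q
    rw [Matrix.map_apply, inFst_apply, inFst_apply, apply_ite (RingQuot.mkAlgHom _ _), map_zero]
    rfl
  have h2 : ∀ ξ, (inSnd (freeL N ξ)).map (RingQuot.mkAlgHom ℂ (Rel k N ζ τ c)) =
      inSnd (Lop k N ζ τ c ξ) := fun ξ => by
    ext p q
    rw [Matrix.map_apply, inSnd_apply, inSnd_apply, apply_ite (RingQuot.mkAlgHom _ _), map_zero]
    rfl
  ext a b
  have := RingQuot.mkAlgHom_rel ℂ (Rel.exchange (k := k) (N := N) ξ η h a b)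
  rw [← Matrix.map_apply (f := RingQuot.mkAlgHom ℂ (Rel k N ζ τ c)),
    ← Matrix.map_apply (f := RingQuot.mkAlgHom ℂ (Rel k N ζ τ c)), Matrix.map_mul, Matrix.map_mul,
    Matrix.map_mul, Matrix.map_mul, hs, hs, h1, h2] at this
  exact this

theorem isUnit_Lop (ξ : ℂ) : IsUnit (Lop k N ζ τ c ξ) := by
  have hone : ∀ M : Matrix (Fin N) (Fin N) (FreeAlgebra ℂ (Gen N)),
      (∀ i j, Rel k N ζ τ c (M i j) (if i = j then 1 else 0)) →
      M.map (RingQuot.mkAlgHom ℂ (Rel k N ζ τ c)) = 1 := fun M h => by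
    ext i j
    rw [Matrix.map_apply, RingQuot.mkAlgHom_rel ℂ (h i j), Matrix.one_apply,
      apply_ite (RingQuot.mkAlgHom _ _), map_one, map_zero]
  have h1 := hone _ (Rel.mul_inv (k := k) (ζ := ζ) (τ := τ) (c := c) ξ)
  have h2 := hone _ (Rel.inv_mul (k := k) (ζ := ζ) (τ := τ) (c := c) ξ)
  rw [Matrix.map_mul] at h1 h2
  exact ⟨⟨_, _, h1, h2⟩, rfl⟩

variable {N ζ τ}

theorem calL_eq {A : Type*} [Ring A] [Algebra ℂ A] (L : ℂ → Matrix (Fin N) (Fin N) A) (ξ : ℂ) :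
    calL ζ τ (-(N : ℂ)) L ξ = L (ξ - N * ζ) *
      Ring.inverse (scal (Gmat N) * L (ξ + τ + 1) * scal (Gmat N)⁻¹) := by
  rw [calL, Lplus, Lminus]
  ring_nf

theorem tBracket_eq {A : Type*} [Ring A] [Algebra ℂ A] (L : ℂ → Matrix (Fin N) (Fin N) A)
    {ξ η s : ℂ} (h : ∀ a b : Fin N × Fin N,
      deriv (fun c : ℂ => Ycal N ζ τ c (η - ξ) a b) (-(N : ℂ)) = s * (1 : Mat₂ N ℂ) a b) :
    tBracket ζ τ L ξ η =
      s • (tOp ζ τ (-(N : ℂ)) L η * tOp ζ τ (-(N : ℂ)) L ξ) := by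
  rw [tBracket, tOp, tOp, Matrix.trace, Matrix.trace, Finset.sum_mul_sum, Finset.smul_sum,
    Finset.sum_comm]
  refine Finset.sum_congr rfl fun i₂ _ => ?_
  rw [Finset.smul_sum]
  refine Finset.sum_congr rfl fun i₁ _ => ?_
  simp [h, Matrix.one_apply, Prod.ext_iff, ite_and]

variable [NeZero N]

theorem isUnit_Gmat : IsUnit (Gmat N) := by
  have h1 : IsUnit (gHalf N) := by
    refine IsUnit.of_mul_eq_one (Matrix.diagonal fun i => (gEntry N i)⁻¹) ?_
    have h : gHalf N = Matrix.diagonal (gEntry N) := rfl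
    rw [h, Matrix.diagonal_mul_diagonal, ← Matrix.diagonal_one]
    exact congrArg _ (funext fun i => mul_inv_cancel₀ (gEntry_ne_zero i))
  have h2 : hMat N ^ N = 1 := by
    ext i j
    rw [hMat_pow_apply, Matrix.one_apply]
    have : Fin.ofNat N N = 0 := by ext; simp
    rw [this, add_zero]
    simp [eq_comm]
  exact (h1.mul (IsUnit.of_pow_eq_one h2 (NeZero.ne N))).mul h1

section Critical

variable (hζ : 0 < ζ.im) (hτ : 0 < τ.im) (hs : oddTheta τ ζ ≠ 0)
  (hs' : oddTheta (τ + N * ζ) ζ ≠ 0)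
include hζ hτ hs hs'

/-- At the critical level the exchange relations give `L₂(w) 𝓛₁(z) = ρ' 𝓛₁(z) ρ⁻¹ L₂(w)` with
`ρ' = R(q^{-N} z/w)` and `ρ = R(z/w)`, and crossing unitarity removes `ρ'` and `ρ` from the trace
over the first factor. -/
theorem commute_tOp_Lop {ξ η : ℂ} (h : Regular ζ τ (ξ - η)) (i j : Fin N) :
    Commute (tOp ζ τ (-(N : ℂ)) (Lop k N ζ τ (-(N : ℂ))) ξ) (Lop k N ζ τ (-(N : ℂ)) η i j) := by
  have hτ' : 0 < (τ + N * ζ).im := add_pos hτ (im_nat_mul_pos hζ)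
  set u := ξ - η with hu
  set L := Lop k N ζ τ (-(N : ℂ)) with hL
  have c1 : τ - -(N : ℂ) * ζ = τ + N * ζ := by ring
  have r1 : Regular ζ τ (u - N * ζ) := by
    have := h.add 0 0 (-N); push_cast at this; convert this using 1; ring
  have r2 : Regular ζ τ (u + τ + 1) := by
    have := h.add 1 1 0; push_cast at this; convert this using 1; ring
  have r3 := r1.shift N
  have ht := h.tauN_ne_zero (N := N) hζ
  -- the exchange relations with `L(w)` of the two factors of `𝓛(z)`
  have x1 := Lop_exchange k N ζ τ (-(N : ℂ)) (ξ := ξ + τ + 1) (η := η)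
    (by rw [show ξ + τ + 1 - η = u + τ + 1 by rw [hu]; ring]; exact r2.notMem N)
  have x2 := Lop_exchange k N ζ τ (-(N : ℂ)) (ξ := ξ - N * ζ) (η := η)
    (by rw [show ξ - N * ζ - η = u - N * ζ by rw [hu]; ring]; exact r1.notMem N)
  rw [show ξ + τ + 1 - η = u + τ + 1 by rw [hu]; ring, c1] at x1
  rw [show ξ - N * ζ - η = u - N * ζ by rw [hu]; ring, c1] at x2
  -- since `-p^{1/2} z = -p*^{1/2} q^{-N} z` for `p* = p q^{2N}`, conjugation by `G` turns the first
  -- relation into one with the same matrix `R*(q^{-N} z/w)` on the right as the second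
  have q1 := Gmat_mul_Rhat (N := N) hζ hτ h
  have q2 := Gmat_mul_Rhat (N := N) hζ hτ' r3
  rw [show u - N * ζ + (τ + N * ζ) + 1 = u + τ + 1 by ring, tauN_sub hζ] at q2
  have y1 := exchange_conj (inv_ne_zero ht) isUnit_Gmat q1 q2 x1
  have y2 : scal (R N ζ τ (u - N * ζ)) * inFst (L (ξ - N * ζ)) * inSnd (L η) =
      inSnd (L η) * inFst (L (ξ - N * ζ)) * scal (R N ζ (τ + N * ζ) (u - N * ζ)) := by
    have ht' := r1.neg.tauN_ne_zero (N := N) hζ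
    rw [← sub_eq_add_neg] at ht'
    rw [Rhat, Rhat, scal_smul, scal_smul, smul_mul_assoc, smul_mul_assoc, mul_smul_comm] at x2
    exact smul_right_injective _ ht' x2
  have hZ : IsUnit (scal (Gmat N) * L (ξ + τ + 1) * scal (Gmat N)⁻¹) :=
    ((isUnit_scal isUnit_Gmat).mul (isUnit_Lop k N ζ τ _ _)).mul
      (isUnit_scal (Matrix.isUnit_nonsing_inv_iff.2 isUnit_Gmat))
  have key := inSnd_mul_inFst_mul (isUnit_R hζ hτ hs h) (isUnit_R hζ hτ' hs' r3)
    (Ring.mul_inverse_cancel _ hZ) (Ring.inverse_mul_cancel _ hZ) y1 y2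
  rw [← calL_eq L ξ] at key
  have cross : pt₂ (R N ζ τ u)⁻¹ * pt₂ (R N ζ τ (u - N * ζ)) = 1 := by
    have := pt₂_R_mul (N := N) hζ hτ hs r1
    rw [show -(u - N * ζ) - N * ζ = -u by ring, ← R_inv hζ hτ hs h] at this
    exact mul_eq_one_comm.1 this
  have key2 := congrArg ptr₁ key
  rw [ptr₁_inSnd_mul, ptr₁_mul_inSnd, ptr₁_inFst, ptr₁_conj _ _ cross] at key2
  exact commute_scalar_iff.1 key2.symm i j

theorem commute_tOp_calL {ξ η : ℂ} (h : Regular ζ τ (ξ - η)) (i j : Fin N) :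
    Commute (tOp ζ τ (-(N : ℂ)) (Lop k N ζ τ (-(N : ℂ))) ξ)
      (calL ζ τ (-(N : ℂ)) (Lop k N ζ τ (-(N : ℂ))) η i j) := by
  have r1 : Regular ζ τ (ξ - (η - N * ζ)) := by
    have := h.add 0 0 N; push_cast at this; convert this using 1; ring
  have r2 : Regular ζ τ (ξ - (η + τ + 1)) := by
    have := h.add (-1) (-1) 0; push_cast at this; convert this using 1; ring
  rw [calL_eq]
  exact commute_entry_mul (commute_tOp_Lop k hζ hτ hs hs' r1) (commute_entry_inverse
    (commute_entry_mul (commute_entry_mul (commute_entry_scal _ _)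
      (commute_tOp_Lop k hζ hτ hs hs' r2)) (commute_entry_scal _ _))) i j

theorem commute_tOp_tOp {ξ η : ℂ} (h : Regular ζ τ (ξ - η)) :
    Commute (tOp ζ τ (-(N : ℂ)) (Lop k N ζ τ (-(N : ℂ))) ξ)
      (tOp ζ τ (-(N : ℂ)) (Lop k N ζ τ (-(N : ℂ))) η) :=
  Commute.sum_right Finset.univ _ _ fun i _ => commute_tOp_calL k hζ hτ hs hs' h i i

end Critical

end Elliptic

/-! ### The logarithmic derivative of `τ_N` -/

section LogDeriv

/-- The general term `y a^n / (1 - y a^n)` of a Lambert series. -/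
noncomputable def lambertTerm (a y : ℂ) (n : ℕ) : ℂ := y * a ^ n / (1 - y * a ^ n)

theorem summable_lambertTerm {a : ℂ} (ha : ‖a‖ < 1) (y : ℂ) : Summable (lambertTerm a y) := by
  have h0 : Tendsto (fun n : ℕ => 1 - y * a ^ n) atTop (𝓝 1) := by
    simpa using ((tendsto_pow_atTop_nhds_zero_of_norm_lt_one ha).const_mul y).const_sub 1
  have h1 : (fun n : ℕ => y * (1 - y * a ^ n)⁻¹) =O[atTop] fun _ => (1 : ℝ) :=
    ((h0.inv₀ one_ne_zero).const_mul y).isBigO_one ℝ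
  refine summable_of_isBigO_nat (summable_norm_pow ha) ?_
  refine ((h1.mul (Asymptotics.isBigO_refl (fun n : ℕ => a ^ n) atTop).norm_right).congr
    (fun n => ?_) fun n => ?_)
  · rw [lambertTerm]; ring
  · rw [one_mul]

theorem tsum_lambertTerm {a : ℂ} (ha : ‖a‖ < 1) (y : ℂ) :
    ∑' n, lambertTerm a y n = y / (1 - y) + ∑' n, lambertTerm a (a * y) n := by
  rw [(summable_lambertTerm ha y).tsum_eq_zero_add]
  congr 1
  · simp [lambertTerm]
  · refine tsum_congr fun n => ?_
    rw [lambertTerm, lambertTerm]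
    ring_nf

theorem logDeriv_poch {a : ℂ} (ha : ‖a‖ < 1) {z : ℂ} (hz : poch z a ≠ 0) :
    z * logDeriv (fun z => poch z a) z = -∑' n, lambertTerm a z n := by
  have hne : ∀ n : ℕ, 1 - z * a ^ n ≠ 0 := fun n h => hz ((poch_eq_zero_iff ha z).2 ⟨n, h⟩)
  have hl : ∀ n : ℕ, logDeriv (fun z : ℂ => 1 - z * a ^ n) z = -a ^ n / (1 - z * a ^ n) := by
    intro n
    have : HasDerivAt (fun z : ℂ => 1 - z * a ^ n) (-a ^ n) z := by
      simpa using ((hasDerivAt_id z).mul_const (a ^ n)).const_sub 1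
    rw [logDeriv_apply, this.deriv]
  have hl' : ∀ n : ℕ, z * (-a ^ n / (1 - z * a ^ n)) = -lambertTerm a z n := fun n => by
    rw [lambertTerm]; ring
  have hsum : Summable fun n : ℕ => -a ^ n / (1 - z * a ^ n) := by
    by_cases h0 : z = 0
    · subst h0
      simpa using (summable_geometric_of_norm_lt_one ha).neg
    · have := (summable_lambertTerm ha z).neg.mul_left z⁻¹
      refine this.congr fun n => ?_
      rw [← hl' n, inv_mul_cancel_left₀ h0]
  have key := logDeriv_tprod_eq_tsum (f := fun (n : ℕ) (z : ℂ) => 1 - z * a ^ n)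
    (Metric.isOpen_ball (x := (0 : ℂ)) (ε := ‖z‖ + 1)) (x := z) (by simp) hne
    (fun n => by fun_prop) (by simpa only [hl] using hsum)
    (multipliableLocallyUniformlyOn_one_sub (summable_norm_pow ha) _) hz
  simp only [hl] at key
  rw [← tsum_neg]
  simp only [← hl']
  rw [tsum_mul_left, ← key]
  rfl

variable {σ : ℂ}

theorem logDeriv_pochE (hσ : 0 < σ.im) {v : ℂ} (hv : pochE σ v ≠ 0) :
    logDeriv (pochE σ) v =
      -(2 * (Complex.I * Real.pi)) * ∑' n, lambertTerm (ex (2 * σ)) (ex (2 * v)) n := by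
  have ha := norm_ex_lt_one (im_two_mul_pos hσ)
  have h1 := logDeriv_poch ha hv
  have hg : HasDerivAt (fun v => ex (2 * v)) (Complex.I * Real.pi * ex (2 * v) * 2) v := by
    have := (hasDerivAt_ex (2 * v)).comp v ((hasDerivAt_id v).const_mul 2)
    simpa [Function.comp_def] using this
  have h2 := logDeriv_comp (f := fun z => poch z (ex (2 * σ))) (g := fun v => ex (2 * v)) (x := v)
    (differentiable_poch ha _) hg.differentiableAt
  rw [hg.deriv] at h2
  refine h2.trans ?_
  linear_combination (2 * (Complex.I * Real.pi)) * h1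

theorem logDeriv_thetaE (hσ : 0 < σ.im) {v : ℂ} (hv : thetaE σ v ≠ 0) :
    logDeriv (thetaE σ) v = -(2 * (Complex.I * Real.pi)) *
      (∑' n, lambertTerm (ex (2 * σ)) (ex (2 * v)) n -
        ∑' n, lambertTerm (ex (2 * σ)) (ex (2 * -v)) n + ex (2 * -v) / (1 - ex (2 * -v))) := by
  have hd := differentiable_pochE hσ
  have h1 : pochE σ v ≠ 0 := left_ne_zero_of_mul hv
  have h2 : pochE σ (σ - v) ≠ 0 := right_ne_zero_of_mul hv
  have hg : HasDerivAt (fun v => σ - v) (-1) v := by simpa using (hasDerivAt_id v).const_sub σ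
  have h3 := logDeriv_comp (f := pochE σ) (g := fun v => σ - v) (x := v) (hd _)
    hg.differentiableAt
  have h4 : logDeriv (thetaE σ) v = logDeriv (pochE σ) v +
      logDeriv (pochE σ ∘ fun v => σ - v) v :=
    logDeriv_mul (f := pochE σ) (g := pochE σ ∘ fun v => σ - v) v h1 h2 (hd v)
      ((hd _).comp v hg.differentiableAt)
  have h5 := tsum_lambertTerm (norm_ex_lt_one (im_two_mul_pos hσ)) (ex (2 * -v))
  rw [← ex_add, show 2 * σ + 2 * -v = 2 * (σ - v) by ring] at h5
  rw [h4, h3, hg.deriv, logDeriv_pochE hσ h1, logDeriv_pochE hσ h2, h5]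
  ring

variable {N : ℕ} {ζ : ℂ}

theorem structureCoeff_neg (χ : ℂ) : structureCoeff N ζ (-χ) = -structureCoeff N ζ χ := by
  rw [structureCoeff, structureCoeff, neg_neg]
  ring

theorem fTerm_eq (q y : ℂ) (hq : q ≠ 0) (l : ℕ) : fTerm N q y l =
    2 * lambertTerm (q ^ (2 * N)) y l - lambertTerm (q ^ (2 * N)) (y * q ^ 2) l -
      lambertTerm (q ^ (2 * N)) (y * q ^ (-2 : ℤ)) l := by
  have e1 : q ^ (2 * N * l + 2) = q ^ 2 * (q ^ (2 * N)) ^ l := by rw [pow_add, pow_mul, mul_comm]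
  have e2 : q ^ (2 * (N : ℤ) * l - 2) = q ^ (-2 : ℤ) * (q ^ (2 * N)) ^ l := by
    rw [sub_eq_add_neg, zpow_add₀ hq, mul_comm, ← pow_mul, ← zpow_natCast q (2 * N * l)]
    push_cast
    rfl
  rw [fTerm, e1, e2, pow_mul]
  simp only [lambertTerm, mul_assoc, mul_div_assoc]

variable [NeZero N]

theorem differentiableAt_tauN (hζ : 0 < ζ.im) {s : ℂ} (h2 : thetaE (N * ζ) (-s) ≠ 0) :
    DifferentiableAt ℂ (fun u : ℂ => tauN N ζ (ζ / 2 + u)) s := by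
  have hd := differentiable_thetaE (im_nat_mul_pos (N := N) hζ)
  rw [funext fun u => tauN_eq (N := N) hζ u]
  exact (((differentiable_ex.comp (by fun_prop)).mul (hd.comp (by fun_prop))) s).div
    ((hd _).comp s (by fun_prop)) h2

theorem eulerLogTau_eq (hζ : 0 < ζ.im) {s : ℂ} (h1 : thetaE (N * ζ) (ζ + s) ≠ 0)
    (h2 : thetaE (N * ζ) (-s) ≠ 0) : eulerLogTau N ζ s = (2 / N - 2) +
      (logDeriv (thetaE (N * ζ)) (ζ + s) + logDeriv (thetaE (N * ζ)) (-s)) /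
        (Complex.I * Real.pi) := by
  have hd := differentiable_thetaE (im_nat_mul_pos (N := N) hζ)
  have hpi : Complex.I * (Real.pi : ℂ) ≠ 0 :=
    mul_ne_zero Complex.I_ne_zero (by exact_mod_cast Real.pi_ne_zero)
  have hE : HasDerivAt (fun u => ex ((2 / N - 2) * (ζ / 2 + u)))
      (Complex.I * Real.pi * ex ((2 / N - 2) * (ζ / 2 + s)) * (2 / N - 2)) s := by
    have := (hasDerivAt_ex ((2 / N - 2) * (ζ / 2 + s))).comp s
      (((hasDerivAt_id s).const_add (ζ / 2)).const_mul (2 / N - 2 : ℂ))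
    simpa [Function.comp_def] using this
  have hA : HasDerivAt (fun u => ζ + u) 1 s := (hasDerivAt_id s).const_add ζ
  have hB : HasDerivAt (fun u : ℂ => -u) (-1) s := (hasDerivAt_id s).neg
  have l1 : logDeriv (fun u => ex ((2 / N - 2) * (ζ / 2 + u))) s =
      Complex.I * Real.pi * (2 / N - 2) := by
    rw [logDeriv_apply, hE.deriv]
    rw [mul_right_comm, mul_div_cancel_right₀ _ (ex_ne_zero _)]
  have l2 := logDeriv_comp (f := thetaE (N * ζ)) (g := fun u => ζ + u) (x := s) (hd _)
    hA.differentiableAt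
  have l3 := logDeriv_comp (f := thetaE (N * ζ)) (g := fun u => -u) (x := s) (hd _)
    hB.differentiableAt
  have dA := (hd (ζ + s)).comp s hA.differentiableAt
  have dB := (hd (-s)).comp s hB.differentiableAt
  have l4 := logDeriv_mul (f := fun u => ex ((2 / N - 2) * (ζ / 2 + u)))
    (g := thetaE (N * ζ) ∘ fun u => ζ + u) s (ex_ne_zero _) h1 hE.differentiableAt dA
  have l5 := logDeriv_div (f := fun u => ex ((2 / N - 2) * (ζ / 2 + u)) *
    (thetaE (N * ζ) ∘ fun u => ζ + u) u) (g := thetaE (N * ζ) ∘ fun u => -u) s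
    (mul_ne_zero (ex_ne_zero _) h1) h2 (hE.differentiableAt.mul dA) dB
  rw [l4, l1, l2, l3, hA.deriv, hB.deriv] at l5
  rw [eulerLogTau, funext fun u => tauN_eq (N := N) hζ u]
  simp only [Function.comp_apply] at l5
  rw [l5]
  field_simp
  ring

theorem summable_fTerm (hζ : 0 < ζ.im) (y : ℂ) : Summable (fTerm N (ex ζ) y) := by
  have ha := norm_ex_lt_one (im_two_mul_pos (im_nat_mul_pos (N := N) hζ))
  rw [← ex_pow_two_mul] at ha
  rw [funext fun l => fTerm_eq (N := N) (ex ζ) y (ex_ne_zero _) l]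
  exact (((summable_lambertTerm ha _).mul_left 2).sub (summable_lambertTerm ha _)).sub
    (summable_lambertTerm ha _)

theorem tsum_fTerm (hζ : 0 < ζ.im) (v : ℂ) : ∑' l, fTerm N (ex ζ) (ex (2 * v)) l =
    2 * ∑' n, lambertTerm (ex (2 * (N * ζ))) (ex (2 * v)) n -
      ∑' n, lambertTerm (ex (2 * (N * ζ))) (ex (2 * (v + ζ))) n -
      ∑' n, lambertTerm (ex (2 * (N * ζ))) (ex (2 * (v - ζ))) n := by
  have ha := norm_ex_lt_one (im_two_mul_pos (im_nat_mul_pos (N := N) hζ))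
  have e1 : ex (2 * v) * ex ζ ^ 2 = ex (2 * (v + ζ)) := by
    rw [← ex_two_mul, ← ex_add, mul_add]
  have e2 : ex (2 * v) * ex ζ ^ (-2 : ℤ) = ex (2 * (v - ζ)) := by
    rw [← ex_int_mul, ← ex_add]; push_cast; ring_nf
  rw [funext fun l => fTerm_eq (N := N) (ex ζ) _ (ex_ne_zero _) l, ex_pow_two_mul, e1, e2,
    (((summable_lambertTerm ha _).mul_left 2).sub (summable_lambertTerm ha _)).tsum_sub
    (summable_lambertTerm ha _), ((summable_lambertTerm ha _).mul_left 2).tsum_sub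
    (summable_lambertTerm ha _), tsum_mul_left]

/-- Both sides are combinations of the logarithmic derivatives of `(x^{±2} q^{2k}; q^{2N})_∞`,
`k ∈ {-1, 0, 1}`. Their terms `ℓ = 0` differ by the rational functions outside the series. -/
theorem structureCoeff_eq_fStruct (hζ : 0 < ζ.im) {χ : ℂ} (h0 : thetaE (N * ζ) χ ≠ 0)
    (h0' : thetaE (N * ζ) (-χ) ≠ 0) (h1 : thetaE (N * ζ) (ζ + χ) ≠ 0)
    (h2 : thetaE (N * ζ) (ζ + -χ) ≠ 0) (hne : ex (2 * (χ + ζ)) ≠ 1) (hne' : ex (2 * (χ - ζ)) ≠ 1) :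
    structureCoeff N ζ χ = fStruct N ζ χ := by
  have hσ := im_nat_mul_pos (N := N) hζ
  have hpi : Complex.I * (Real.pi : ℂ) ≠ 0 :=
    mul_ne_zero Complex.I_ne_zero (by exact_mod_cast Real.pi_ne_zero)
  -- `y⁻¹ / (1 - y⁻¹) = -1 - y / (1 - y)`
  have hinv : ∀ {v : ℂ}, ex (2 * v) ≠ 1 →
      ex (2 * -v) / (1 - ex (2 * -v)) = -1 - ex (2 * v) / (1 - ex (2 * v)) := by
    intro v hv
    have h3 := ex_ne_zero (2 * v)
    have h4 : 1 - ex (2 * v) ≠ 0 := sub_ne_zero.2 hv.symm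
    have h5 : ex (2 * v) - 1 ≠ 0 := sub_ne_zero.2 hv
    rw [mul_neg, ex_neg]
    have h6 : 1 - (ex (2 * v))⁻¹ ≠ 0 := by
      rw [sub_ne_zero, ne_comm, Ne, inv_eq_one]; exact hv
    field_simp
    ring
  have e1 : ex χ ^ 2 * ex ζ ^ 2 = ex (2 * (χ + ζ)) := by
    rw [← ex_two_mul, ← ex_two_mul, ← ex_add, mul_add]
  have e2 : ex χ ^ 2 * ex ζ ^ (-2 : ℤ) = ex (2 * (χ - ζ)) := by
    rw [← ex_int_mul, ← ex_two_mul, ← ex_add]; push_cast; ring_nf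
  have e3 : (ex χ ^ 2)⁻¹ * ex ζ ^ 2 = ex (2 * -(χ - ζ)) := by
    rw [← ex_two_mul, ← ex_two_mul, ← ex_neg, ← ex_add]; ring_nf
  have e4 : (ex χ ^ 2)⁻¹ * ex ζ ^ (-2 : ℤ) = ex (2 * -(χ + ζ)) := by
    rw [← ex_int_mul, ← ex_two_mul, ← ex_neg, ← ex_add]; push_cast; ring_nf
  have e5 : (ex χ ^ 2)⁻¹ = ex (2 * -χ) := by rw [← ex_two_mul, ← ex_neg, mul_neg]
  have f1 := tsum_fTerm (N := N) hζ χ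
  have f2 := tsum_fTerm (N := N) hζ (-χ)
  rw [show -χ + ζ = -(χ - ζ) by ring, show -χ - ζ = -(χ + ζ) by ring] at f2
  rw [structureCoeff, fStruct, fHalf, fHalf, e1, e2, e3, e4, e5, ← ex_two_mul, f1, f2,
    eulerLogTau_eq hζ h1 h0', eulerLogTau_eq hζ h2 (by rwa [neg_neg]), neg_neg,
    logDeriv_thetaE hσ h1, logDeriv_thetaE hσ h2, logDeriv_thetaE hσ h0, logDeriv_thetaE hσ h0',
    neg_neg, show ζ + χ = χ + ζ by ring, show ζ + -χ = -(χ - ζ) by ring, neg_neg, hinv hne,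
    hinv hne']
  field_simp
  ring

end LogDeriv

/-! ### The derivative of the exchange matrix at the critical level -/

section MatDeriv

variable {n : Type*}

/-- Entrywise differentiability of a matrix-valued function at `x`, with derivative `F'`. -/
def HasMatDerivAt (F : ℂ → Matrix n n ℂ) (F' : Matrix n n ℂ) (x : ℂ) : Prop :=
  ∀ i j, HasDerivAt (fun t => F t i j) (F' i j) x

variable {F G : ℂ → Matrix n n ℂ} {F' G' : Matrix n n ℂ} {x : ℂ}

theorem hasMatDerivAt_const (M : Matrix n n ℂ) (x : ℂ) : HasMatDerivAt (fun _ => M) 0 x :=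
  fun i j => hasDerivAt_const x (M i j)

theorem HasMatDerivAt.mul [Fintype n] (hF : HasMatDerivAt F F' x) (hG : HasMatDerivAt G G' x) :
    HasMatDerivAt (fun t => F t * G t) (F' * G x + F x * G') x := fun i j => by
  simp only [Matrix.mul_apply, Matrix.add_apply, ← Finset.sum_add_distrib]
  exact HasDerivAt.fun_sum fun k _ => (hF i k).mul (hG k j)

theorem HasMatDerivAt.congr (hF : HasMatDerivAt F F' x) (h : G =ᶠ[𝓝 x] F) :
    HasMatDerivAt G F' x := fun i j =>
  (hF i j).congr_of_eventuallyEq (h.mono fun t ht => by simp only [ht])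

theorem HasMatDerivAt.unique (hF : HasMatDerivAt F F' x) (hG : HasMatDerivAt F G' x) : F' = G' := by
  ext i j
  exact (hF i j).unique (hG i j)

theorem HasMatDerivAt.comp_affine {a b : ℂ} (hF : HasMatDerivAt F F' (a + b * x)) :
    HasMatDerivAt (fun t => F (a + b * t)) (b • F') x := fun i j => by
  have h : HasDerivAt (fun t : ℂ => a + b * t) b x := by
    simpa using ((hasDerivAt_id x).const_mul b).const_add a
  have := (hF i j).comp x h
  rw [mul_comm] at this
  exact this

theorem HasMatDerivAt.pt₂ {N : ℕ} {F : ℂ → Mat₂ N ℂ} {F' : Mat₂ N ℂ} (hF : HasMatDerivAt F F' x) :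
    HasMatDerivAt (fun t => EllipticW.pt₂ (F t)) (EllipticW.pt₂ F') x := fun _ _ => hF _ _

theorem HasMatDerivAt.flip₁₂ {N : ℕ} {F : ℂ → Mat₂ N ℂ} {F' : Mat₂ N ℂ}
    (hF : HasMatDerivAt F F' x) :
    HasMatDerivAt (fun t => EllipticW.flip₁₂ (F t)) (EllipticW.flip₁₂ F') x := fun _ _ => hF _ _

end MatDeriv

section Exchange

variable {N : ℕ} {ζ τ : ℂ}

theorem dense_regular (ζ τ : ℂ) : Dense {ξ | Regular ζ τ ξ} := by
  have h : (Set.range fun a : ℤ × ℤ × ℤ => (a.1 + a.2.1 * τ + a.2.2 * ζ : ℂ)).Countable :=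
    Set.countable_range _
  refine Dense.mono ?_ (h.dense_compl ℂ)
  intro ξ hξ k l m e
  exact hξ ⟨(k, l, m), e.symm⟩

/-- A relation between values of the `R`-matrix that holds at all regular points extends by
continuity to a neighbourhood of each regular point. -/
theorem Regular.eventually_eq_one {F : ℂ → Mat₂ N ℂ}
    (hF : ∀ ξ, Regular ζ τ ξ → F ξ = 1) {ξ : ℂ}
    (hc : ∀ᶠ ξ' in 𝓝 ξ, ∀ p q, ContinuousAt (fun t => F t p q) ξ') :
    ∀ᶠ ξ' in 𝓝 ξ, F ξ' = 1 := by
  filter_upwards [hc] with ξ' h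
  ext p q
  have h1 := mem_closure_image (h p q) (dense_regular ζ τ ξ')
  have h2 : (fun t => F t p q) '' {ξ | Regular ζ τ ξ} ⊆ {(1 : Mat₂ N ℂ) p q} := by
    rintro _ ⟨t, ht, rfl⟩
    simp only [hF t ht, Set.mem_singleton_iff]
  simpa using closure_mono h2 h1

variable [NeZero N]

/-- The exponents of `q` in the four factors of `T` are such that at `c = -N` numerator and denominator
agree, by the invariance of `τ_N` under `z ↦ q^N z`. -/
theorem Regular.hasDerivAt_Tfun (hζ : 0 < ζ.im) {χ : ℂ} (h : Regular ζ τ χ) :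
    Tfun N ζ (-(N : ℂ)) χ = 1 ∧
      HasDerivAt (fun c => Tfun N ζ c χ) (structureCoeff N ζ χ) (-(N : ℂ)) := by
  set F : ℂ → ℂ := fun u => tauN N ζ (ζ / 2 + u) with hF
  have n1 : F χ ≠ 0 := h.tauN_ne_zero hζ
  have n2 : F (-χ) ≠ 0 := h.neg.tauN_ne_zero hζ
  have hT : ∀ c, Tfun N ζ c χ =
      F (-χ) / F χ * (F (χ - (c + N) * ζ) / F (-χ - (c + N) * ζ)) := fun c => by
    have e : ∀ u, F (u - (c + N) * ζ) = tauN N ζ (ζ / 2 + (u - c * ζ)) := fun u => by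
      rw [← tauN_sub hζ, hF]; simp only; ring_nf
    rw [e, e, Tfun, hF, div_mul_div_comm]
    simp only
    ring_nf
  have d1 : HasDerivAt F (deriv F χ) χ :=
    (differentiableAt_tauN hζ (h.neg.thetaE_ne_zero hζ)).hasDerivAt
  have d2 : HasDerivAt F (deriv F (-χ)) (-χ) :=
    (differentiableAt_tauN hζ (by rw [neg_neg]; exact h.thetaE_ne_zero hζ)).hasDerivAt
  have hl : ∀ u : ℂ, HasDerivAt (fun c : ℂ => u - (c + N) * ζ) (-ζ) (-(N : ℂ)) := fun u => by
    simpa using (((hasDerivAt_id (-(N : ℂ))).add_const (N : ℂ)).mul_const ζ).const_sub u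
  have h0 : ∀ u : ℂ, u - (-(N : ℂ) + N) * ζ = u := fun u => by ring
  have d3 : HasDerivAt (fun c : ℂ => F (χ - (c + N) * ζ)) (deriv F χ * -ζ) (-(N : ℂ)) :=
    HasDerivAt.comp (h₂ := F) _ (by rw [h0]; exact d1) (hl χ)
  have d4 : HasDerivAt (fun c : ℂ => F (-χ - (c + N) * ζ)) (deriv F (-χ) * -ζ) (-(N : ℂ)) :=
    HasDerivAt.comp (h₂ := F) _ (by rw [h0]; exact d2) (hl (-χ))
  refine ⟨by rw [hT, h0, h0]; field_simp, ?_⟩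
  rw [funext hT]
  have hpi : Complex.I * (Real.pi : ℂ) ≠ 0 :=
    mul_ne_zero Complex.I_ne_zero (by exact_mod_cast Real.pi_ne_zero)
  have d5 := (d3.div d4 (by rw [h0]; exact n2)).const_mul (F (-χ) / F χ)
  refine d5.congr_deriv ?_
  have hl' : ∀ s, eulerLogTau N ζ s = deriv F s / F s / (Complex.I * Real.pi) := fun _ => rfl
  rw [h0, h0, structureCoeff, hl', hl']
  field_simp
  ring

theorem differentiableAt_R (hζ : 0 < ζ.im) (hτ : 0 < τ.im) {ξ : ℂ}
    (h1 : oddTheta τ (ξ + ζ) ≠ 0) (h2 : kapNum N ζ τ (-ξ) ≠ 0) (p q : Fin N × Fin N) :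
    DifferentiableAt ℂ (fun ξ => R N ζ τ ξ p q) ξ := by
  have hK := differentiable_kapNum (N := N) hζ hτ
  have hθ := differentiable_oddTheta hτ
  have hpref : DifferentiableAt ℂ (pref N ζ τ) ξ := by
    have e : pref N ζ τ = fun ξ => ex ((2 / (N : ℂ) - 2) * ξ) *
        (kapNum N ζ τ ξ / kapNum N ζ τ (-ξ)) * (oddTheta τ ζ / oddTheta τ (ξ + ζ)) / N := by
      funext ξ
      rw [pref, invKappa_eq]
    have hD : DifferentiableAt ℂ (fun ξ => oddTheta τ (ξ + ζ)) ξ := (hθ _).comp ξ (by fun_prop)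
    rw [e]
    exact ((((differentiable_ex.comp (by fun_prop)) ξ).mul ((hK ξ).div
      ((hK _).comp ξ (by fun_prop)) h2)).mul ((differentiableAt_const _).div
      hD h1)).div_const _
  have hphi : Differentiable ℂ fun ξ => phiMat N ζ τ ξ p q := by
    simp only [phiMat, tensISum, Matrix.sum_apply, Matrix.smul_apply, smul_eq_mul]
    exact Differentiable.fun_sum fun α _ => (differentiable_phi hτ _ _ _).mul_const _
  simp only [R_eq, Matrix.smul_apply, diagConj_apply, smul_eq_mul]
  exact hpref.mul (((hphi ξ).const_mul _).mul_const _)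

/-- The entrywise derivative of the `R`-matrix. -/
noncomputable def Rderiv (N : ℕ) (ζ τ ξ : ℂ) : Mat₂ N ℂ :=
  Matrix.of fun p q => deriv (fun ξ => R N ζ τ ξ p q) ξ

variable (hζ : 0 < ζ.im) (hτ : 0 < τ.im)
include hζ hτ

/-- The poles of the `R`-matrix avoid a neighbourhood of each regular point. -/
theorem Regular.eventually_differentiableAt {ξ : ℂ} (h : Regular ζ τ ξ) :
    ∀ᶠ ξ' in 𝓝 ξ, ∀ p q : Fin N × Fin N, DifferentiableAt ℂ (fun ξ => R N ζ τ ξ p q) ξ' := by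
  have hK := (differentiable_kapNum (N := N) hζ hτ).continuous
  have hθ := (differentiable_oddTheta hτ).continuous
  have r1 : Regular ζ τ (ξ + ζ) := by
    have := h.add 0 0 1; push_cast at this; convert this using 1; ring
  have e1 : ∀ᶠ ξ' in 𝓝 ξ, oddTheta τ (ξ' + ζ) ≠ 0 :=
    (hθ.comp (continuous_id.add continuous_const)).continuousAt.eventually_ne
      (r1.oddTheta_ne_zero hτ)
  have e2 : ∀ᶠ ξ' in 𝓝 ξ, kapNum N ζ τ (-ξ') ≠ 0 :=
    (hK.comp continuous_neg).continuousAt.eventually_ne (h.neg.kapNum_ne_zero hζ hτ)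
  filter_upwards [e1, e2] with ξ' h1 h2 using differentiableAt_R hζ hτ h1 h2

theorem Regular.hasMatDerivAt_R {ξ : ℂ} (h : Regular ζ τ ξ) :
    HasMatDerivAt (R N ζ τ) (Rderiv N ζ τ ξ) ξ := fun p q =>
  ((h.eventually_differentiableAt (N := N) hζ hτ).self_of_nhds p q).hasDerivAt

variable (hs : oddTheta τ ζ ≠ 0)
include hs

theorem Regular.eventually_R_mul_flip {ξ : ℂ} (h : Regular ζ τ ξ) :
    ∀ᶠ ξ' in 𝓝 ξ, R N ζ τ ξ' * flip₁₂ (R N ζ τ (-ξ')) = 1 := by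
  refine Regular.eventually_eq_one (fun ξ' h' => R_mul_flip hζ hτ hs h') ?_
  have e2 := (continuous_neg.tendsto ξ).eventually (h.neg.eventually_differentiableAt (N := N) hζ hτ)
  filter_upwards [h.eventually_differentiableAt (N := N) hζ hτ, e2] with ξ' h1 h2 p q
  simp only [Matrix.mul_apply, flip₁₂_apply]
  refine tendsto_finsetSum _ fun r _ => (h1 p r).continuousAt.mul ?_
  exact ContinuousAt.comp (f := fun t : ℂ => -t) (h2 _ _).continuousAt continuous_neg.continuousAt

theorem Regular.eventually_pt₂_R_mul {ξ : ℂ} (h : Regular ζ τ ξ) :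
    ∀ᶠ ξ' in 𝓝 ξ, pt₂ (R N ζ τ ξ') * pt₂ (flip₁₂ (R N ζ τ (-ξ' - N * ζ))) = 1 := by
  refine Regular.eventually_eq_one (fun ξ' h' => pt₂_R_mul hζ hτ hs h') ?_
  have r1 : Regular ζ τ (-ξ - N * ζ) := by
    have := h.neg.add 0 0 (-N); push_cast at this; convert this using 1; ring
  have hc : Continuous fun t : ℂ => -t - N * ζ := by fun_prop
  have e2 := (hc.tendsto ξ).eventually (r1.eventually_differentiableAt (N := N) hζ hτ)
  filter_upwards [h.eventually_differentiableAt (N := N) hζ hτ, e2] with ξ' h1 h2 p q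
  simp only [Matrix.mul_apply, pt₂_apply, flip₁₂_apply]
  refine tendsto_finsetSum _ fun r _ => (h1 _ _).continuousAt.mul ?_
  exact ContinuousAt.comp (f := fun t : ℂ => -t - N * ζ) (h2 _ _).continuousAt hc.continuousAt

/-- At the critical level the matrix part of the exchange matrix is the identity, to first order in
the level. By unitarity the first three factors are, to first order, the matrix
`R_{21}(q^{-c-N} x)`, and by crossing unitarity the partial transpose of the latter is inverse to
`R_{12}(q^c x^{-1})^{t_2}`. -/
theorem Regular.Mcal_deriv {χ : ℂ} (h : Regular ζ τ χ) :
    Mcal N ζ τ (-(N : ℂ)) χ = 1 ∧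
      HasMatDerivAt (fun c => Mcal N ζ τ c χ) 0 (-(N : ℂ)) := by
  set c₀ : ℂ := -(N : ℂ) with hc₀
  have r1 : Regular ζ τ (-χ - N * ζ) := by
    have := h.neg.add 0 0 (-N); push_cast at this; convert this using 1; ring
  -- `f` and `f'` are the second factor and its reflection in the critical level, `k` is inverse
  -- to `f`, and `g` is the last factor.
  set f : ℂ → Mat₂ N ℂ := fun c => flip₁₂ (R N ζ τ (χ + (c + N) * ζ)) with hf
  set f' : ℂ → Mat₂ N ℂ := fun c => flip₁₂ (R N ζ τ (χ - (c + N) * ζ)) with hf'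
  set k : ℂ → Mat₂ N ℂ := fun c => R N ζ τ (-χ - (c + N) * ζ) with hk
  set g : ℂ → Mat₂ N ℂ := fun c => R N ζ τ (-χ + c * ζ) with hg
  have hkf : ∀ᶠ c in 𝓝 c₀, k c * f c = 1 := by
    have hc : Continuous fun c : ℂ => -χ - (c + N) * ζ := by fun_prop
    have ht := hc.tendsto c₀
    rw [hc₀, neg_add_cancel, zero_mul, sub_zero] at ht
    filter_upwards [ht.eventually (h.neg.eventually_R_mul_flip (N := N) hζ hτ hs)] with c e
    rw [show -(-χ - (c + N) * ζ) = χ + (c + N) * ζ by ring] at e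
    exact e
  have hfg : ∀ᶠ c in 𝓝 c₀, pt₂ (f' c) * pt₂ (g c) = 1 := by
    have hc : Continuous fun c : ℂ => -χ + c * ζ := by fun_prop
    have ht := hc.tendsto c₀
    rw [show -χ + c₀ * ζ = -χ - N * ζ by rw [hc₀]; ring] at ht
    filter_upwards [ht.eventually (r1.eventually_pt₂_R_mul (N := N) hζ hτ hs)] with c e
    rw [show -(-χ + c * ζ) - N * ζ = χ - (c + N) * ζ by ring] at e
    exact mul_eq_one_comm.1 e
  have ef : f c₀ = flip₁₂ (R N ζ τ χ) := by simp [hf, hc₀]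
  have ef' : f' c₀ = f c₀ := by simp [hf, hf', hc₀]
  have ek : k c₀ = R N ζ τ (-χ) := by simp [hk, hc₀]
  have kf0 : k c₀ * f c₀ = 1 := hkf.self_of_nhds
  have fk0 : f c₀ * k c₀ = 1 := mul_eq_one_comm.1 kf0
  have fg0 : pt₂ (f c₀) * pt₂ (g c₀) = 1 := ef' ▸ hfg.self_of_nhds
  have hM : ∀ᶠ c in 𝓝 c₀, Mcal N ζ τ c χ = pt₂ (pt₂ (f c₀ * k c * f c₀) * pt₂ (g c)) := by
    filter_upwards [hkf] with c e
    have e1 : (f c)⁻¹ = k c := Matrix.inv_eq_left_inv e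
    have e2 : (R N ζ τ (-χ))⁻¹ = f c₀ := by rw [← ek]; exact Matrix.inv_eq_right_inv kf0
    rw [Mcal, e2, ← ef, ← e1]
  -- the derivatives of the four factors
  have df : HasMatDerivAt f (ζ • flip₁₂ (Rderiv N ζ τ χ)) c₀ := by
    have : HasMatDerivAt (R N ζ τ) (Rderiv N ζ τ χ) (χ + N * ζ + ζ * c₀) := by
      rw [show χ + N * ζ + ζ * c₀ = χ by rw [hc₀]; ring]; exact h.hasMatDerivAt_R hζ hτ
    have := this.comp_affine.flip₁₂
    rw [flip₁₂_smul] at this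
    convert this using 3
    ring_nf
  have df' : HasMatDerivAt f' (-ζ • flip₁₂ (Rderiv N ζ τ χ)) c₀ := by
    have : HasMatDerivAt (R N ζ τ) (Rderiv N ζ τ χ) (χ - N * ζ + -ζ * c₀) := by
      rw [show χ - N * ζ + -ζ * c₀ = χ by rw [hc₀]; ring]; exact h.hasMatDerivAt_R hζ hτ
    have := this.comp_affine.flip₁₂
    rw [flip₁₂_smul] at this
    convert this using 3
    ring_nf
  have dk : HasMatDerivAt k (-ζ • Rderiv N ζ τ (-χ)) c₀ := by
    have : HasMatDerivAt (R N ζ τ) (Rderiv N ζ τ (-χ)) (-χ - N * ζ + -ζ * c₀) := by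
      rw [show -χ - N * ζ + -ζ * c₀ = -χ by rw [hc₀]; ring]; exact h.neg.hasMatDerivAt_R hζ hτ
    have := this.comp_affine
    convert this using 3
    ring_nf
  have dg : HasMatDerivAt g (ζ • Rderiv N ζ τ (-χ - N * ζ)) c₀ := by
    have : HasMatDerivAt (R N ζ τ) (Rderiv N ζ τ (-χ - N * ζ)) (-χ + ζ * c₀) := by
      rw [show -χ + ζ * c₀ = -χ - N * ζ by rw [hc₀]; ring]; exact r1.hasMatDerivAt_R hζ hτ
    have := this.comp_affine
    convert this using 3
    ring_nf
  have hdf' : -ζ • flip₁₂ (Rderiv N ζ τ χ) = -(ζ • flip₁₂ (Rderiv N ζ τ χ)) := neg_smul _ _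
  rw [hdf'] at df'
  generalize ζ • flip₁₂ (Rderiv N ζ τ χ) = F at df df'
  generalize -ζ • Rderiv N ζ τ (-χ) = K at dk
  generalize ζ • Rderiv N ζ τ (-χ - N * ζ) = G at dg
  have d1 : K * f c₀ + k c₀ * F = 0 :=
    (dk.mul df).unique ((hasMatDerivAt_const 1 c₀).congr hkf)
  have d2 : pt₂ (-F) * pt₂ (g c₀) + pt₂ (f' c₀) * pt₂ G = 0 :=
    (df'.pt₂.mul dg.pt₂).unique ((hasMatDerivAt_const 1 c₀).congr hfg)
  have d3 : f c₀ * K * f c₀ = -F := by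
    rw [mul_assoc, eq_neg_of_add_eq_zero_left d1, mul_neg, ← mul_assoc, fk0, one_mul]
  have d4 := ((((hasMatDerivAt_const (f c₀) c₀).mul dk).mul
    (hasMatDerivAt_const (f c₀) c₀)).pt₂.mul dg.pt₂).pt₂
  refine ⟨?_, ?_⟩
  · rw [hM.self_of_nhds, fk0, one_mul, fg0, pt₂_one]
  · have d5 := d4.congr hM
    rw [zero_mul, zero_add, mul_zero, add_zero, d3, fk0, one_mul, ← ef', d2] at d5
    exact d5

theorem Regular.hasDerivAt_Ycal {χ : ℂ} (h : Regular ζ τ χ) (a b : Fin N × Fin N) :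
    HasDerivAt (fun c : ℂ => Ycal N ζ τ c χ a b)
      (structureCoeff N ζ χ * (1 : Mat₂ N ℂ) a b) (-(N : ℂ)) := by
  obtain ⟨m1, m2⟩ := h.Mcal_deriv (N := N) hζ hτ hs
  obtain ⟨t1, t2⟩ := h.hasDerivAt_Tfun (N := N) hζ
  have : HasDerivAt (fun c : ℂ => Ycal N ζ τ c χ a b) _ (-(N : ℂ)) := t2.mul (m2 a b)
  refine this.congr_deriv ?_
  rw [m1, Matrix.zero_apply, mul_zero, add_zero]

end Exchange

end EllipticW

theorem theorem3 (N : ℕ) (hN : 2 ≤ N) (ζ τ : ℂ) (hζ : 0 < ζ.im) (hτ : 0 < τ.im)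
    (hR : ∀ a b : ℤ, ζ ≠ a + b * τ)
    (hRstar : ∀ a b : ℤ, ζ ≠ a + b * (τ + N * ζ)) :
    (∀ χ : ℂ, χ ∉ EllipticW.singular ζ τ (-(N : ℂ)) →
      ∀ a b : Fin N × Fin N,
        HasDerivAt (fun c : ℂ => EllipticW.Ycal N ζ τ c χ a b)
          (EllipticW.structureCoeff N ζ χ * (1 : EllipticW.Mat₂ N ℂ) a b) (-(N : ℂ))) ∧
    (∀ χ : ℂ,
      (∀ k : ℤ, EllipticW.ex χ ^ 2 ≠ EllipticW.ex ζ ^ (2 * N * k) ∧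
        EllipticW.ex χ ^ 2 ≠ EllipticW.ex ζ ^ (2 * N * k + 2) ∧
        EllipticW.ex χ ^ 2 ≠ EllipticW.ex ζ ^ (2 * N * k - 2)) →
      (∀ s : ℂ, s = χ ∨ s = -χ →
        DifferentiableAt ℂ (fun u : ℂ => EllipticW.tauN N ζ (ζ / 2 + u)) s ∧
        EllipticW.tauN N ζ (ζ / 2 + s) ≠ 0) ∧
      Summable (EllipticW.fTerm N (EllipticW.ex ζ) (EllipticW.ex χ ^ 2)) ∧
      Summable (EllipticW.fTerm N (EllipticW.ex ζ) (EllipticW.ex χ ^ 2)⁻¹) ∧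
      EllipticW.structureCoeff N ζ χ = EllipticW.fStruct N ζ χ) ∧
    (∀ (k : EllipticW.Kind) (ξ η : ℂ), η - ξ ∉ EllipticW.singular ζ τ (-(N : ℂ)) →
      let L := EllipticW.Lop k N ζ τ (-(N : ℂ))
      let t := EllipticW.tOp ζ τ (-(N : ℂ)) L
      (∀ i j : Fin N, Commute (t ξ) (L η i j)) ∧
      Commute (t ξ) (t η) ∧
      EllipticW.tBracket ζ τ L ξ η =
        EllipticW.structureCoeff N ζ (η - ξ) • (t ξ * t η) ∧
      EllipticW.tBracket ζ τ L η ξ = -EllipticW.tBracket ζ τ L ξ η) := by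
  open EllipticW in
  have : NeZero N := ⟨by omega⟩
  have hτ' : 0 < (τ + N * ζ).im := add_pos hτ (im_nat_mul_pos hζ)
  have hs : oddTheta τ ζ ≠ 0 := fun h => by
    obtain ⟨m, n, e⟩ := (oddTheta_eq_zero_iff hτ ζ).1 h
    exact hR m n e
  have hs' : oddTheta (τ + N * ζ) ζ ≠ 0 := fun h => by
    obtain ⟨m, n, e⟩ := (oddTheta_eq_zero_iff hτ' ζ).1 h
    exact hRstar m n e
  have hY : ∀ χ : ℂ, χ ∉ singular ζ τ (-(N : ℂ)) → ∀ a b : Fin N × Fin N,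
      HasDerivAt (fun c : ℂ => Ycal N ζ τ c χ a b)
        (structureCoeff N ζ χ * (1 : Mat₂ N ℂ) a b) (-(N : ℂ)) := fun χ h =>
    (Regular.of_notMem h).hasDerivAt_Ycal hζ hτ hs
  refine ⟨hY, fun χ hχ => ?_, fun k ξ η h => ?_⟩
  · have hσ := im_nat_mul_pos (N := N) hζ
    -- `χ` and `χ ± ζ` are not congruent to elements of `ℤNζ` modulo `ℤ`
    have hex : ∀ (k l m : ℤ), χ = k + l * (N * ζ) + m * ζ →
        ex χ ^ 2 = ex ζ ^ (2 * N * l + 2 * m) := fun k l m e => by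
      rw [← ex_two_mul, ← ex_int_mul, ex_eq_ex_iff]
      exact ⟨k, by rw [e]; push_cast; ring⟩
    have h0 : ∀ k l : ℤ, χ ≠ k + l * (N * ζ) := fun k l e =>
      (hχ l).1 (by simpa using hex k l 0 (by simpa using e))
    have h1 : ∀ k l : ℤ, χ + ζ ≠ k + l * (N * ζ) := fun k l e =>
      (hχ l).2.2 (by
        simpa [sub_eq_add_neg] using hex k l (-1) (by push_cast; linear_combination e))
    have h2 : ∀ k l : ℤ, χ - ζ ≠ k + l * (N * ζ) := fun k l e =>
      (hχ l).2.1 (hex k l 1 (by push_cast; linear_combination e))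
    have t0 : thetaE (N * ζ) χ ≠ 0 := thetaE_ne_zero hσ h0
    have t0' : thetaE (N * ζ) (-χ) ≠ 0 := thetaE_ne_zero hσ fun k l e =>
      h0 (-k) (-l) (by push_cast; linear_combination -e)
    have t1 : thetaE (N * ζ) (ζ + χ) ≠ 0 := thetaE_ne_zero hσ fun k l e =>
      h1 k l (by linear_combination e)
    have t2 : thetaE (N * ζ) (ζ + -χ) ≠ 0 := thetaE_ne_zero hσ fun k l e =>
      h2 (-k) (-l) (by push_cast; linear_combination -e)
    have n1 : ex (2 * (χ + ζ)) ≠ 1 := fun e => by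
      obtain ⟨n, hn⟩ := (ex_eq_one_iff _).1 e
      exact h1 n 0 (by push_cast; linear_combination hn / 2)
    have n2 : ex (2 * (χ - ζ)) ≠ 1 := fun e => by
      obtain ⟨n, hn⟩ := (ex_eq_one_iff _).1 e
      exact h2 n 0 (by push_cast; linear_combination hn / 2)
    refine ⟨?_, summable_fTerm hζ _, summable_fTerm hζ _,
      structureCoeff_eq_fStruct hζ t0 t0' t1 t2 n1 n2⟩
    rintro s (rfl | rfl)
    · exact ⟨differentiableAt_tauN hζ t0', by
        rw [tauN_eq hζ]; exact div_ne_zero (mul_ne_zero (ex_ne_zero _) t1) t0'⟩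
    · refine ⟨differentiableAt_tauN hζ (by rwa [neg_neg]), ?_⟩
      rw [tauN_eq hζ, neg_neg]
      exact div_ne_zero (mul_ne_zero (ex_ne_zero _) t2) t0
  · intro L t
    have hreg := Regular.of_notMem h
    have hreg' : Regular ζ τ (ξ - η) := neg_sub η ξ ▸ hreg.neg
    have hc : Commute (t ξ) (t η) := commute_tOp_tOp k hζ hτ hs hs' hreg'
    have b1 := tBracket_eq L fun a b => (hY (η - ξ) h a b).deriv
    have b2 := tBracket_eq L fun a b => (hY (ξ - η) (hreg'.notMem N) a b).deriv
    refine ⟨commute_tOp_Lop k hζ hτ hs hs' hreg', hc, ?_, ?_⟩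
    · rw [b1, hc.eq]
    · rw [b1, b2, ← neg_sub η ξ, structureCoeff_neg]
      exact (neg_smul _ _).trans (congrArg (fun z => -(structureCoeff N ζ (η - ξ) • z)) hc.eq)
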